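/- **Setting.** Let $N\ge 1$. Let $\mathcal G$ be the Galileian group of elements $g=(c,\mathbf a,\mathbf v,R)\in\mathbb R\times\mathbb R^3\times\mathbb R^3\times SO(3)$, acting on space-time by $g(t,\mathbf x)=(t+c,\ \mathbf a+t\mathbf v+R\mathbf x)$. Let $g\mapsto\gamma_g\in\mathbb R$ be an arbitrary function and put $$\varphi_g(t,\mathbf x)=\mathbf v\cdot\mathbf x-\tfrac12\mathbf v^2t+\gamma_g,\qquad \xi(g',g)=\varphi_g(g'^{-1}(t,\mathbf x))+\varphi_{g'}(t,\mathbf x)-\varphi_{g'g}(t,\mathbf x)$$ (independent of $(t,\mathbf x)$), and $\omega=e^{i\xi}$. Let $U(1)\times_\omega\mathcal G$ be the central extension with product $(\chi',g')(\chi,g)=(\chi'\chi\,\omega(g',g),g'g)$. For $n=(n_1,\dots,n_N)\in(\mathbb Z\setminus\{0\})^N$ let $M=\sum_k|n_k|$ and $\mathsf H_n=L^2(\mathbb R^{3N})$. Let $H_n$ be the closure of $\sum_k \mathbf p_k^2/(2|n_k|)+V$ on $C_c^\infty(\mathbb R^{3N})$, with $\mathbf p_k=-i\nabla_{\mathbf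 x_k}$, where the real potential $V$ (which may depend on the masses $|n_k|$) is invariant under common translations and rotations of the particles and $V\phi\in L^2$ for $\phi\in C_c^\infty$. Let $\mathbf X$ be the centre of mass for the masses $m_k=|n_k|$, let $\mathbf y_k=\mathbf x_k-(\sum_{j>k}m_j\mathbf x_j)/(\sum_{j>k}m_j)$ ($k<N$) be the Jacobi coordinates, $\mu_k=m_k(\sum_{j>k}m_j)/(m_k+\sum_{j>k}m_j)$, $\mathbf q_k=-i\nabla_{\mathbf y_k}$, and let $H_n^{int}$ be the closure of $\sum_{k<N}\mathbf q_k^2/(2\mu_k)+V$ on $C_c^\infty(\mathbb R^{3N-3})$. Assume that $H_n$ and $H_n^{int}$ are self-adjoint for every $n$, and put $U_t(n)=e^{-itH_n}$. Let $\mathsf H=\bigoplus_{n\in(\mathbb Z\setminus\{0\})^N}\mathsf H_n$, with the time evolution acting as $U_t(n)$ on $\mathsf H_n$. For $\chi\in U(1)$, $g\in\mathcal G$, $\Psi\in\mathsf H$ define $$(U_{(\chi,g)}\Psi)(n,\{\mathbf x_k\})=\chi^{M}\,e^{i\sum_j|n_j|(\mathbf v\cdot\mathbf x_j+\gamma_g)}\;U_{-c}(n)\,\Psi\big(n,\{R^{-1}(\mathbf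 x_k+c\,\mathbf v-\mathbf a)\}\big).$$ **Claim.** (i) $(\chi,g)\mapsto U_{(\chi,g)}$ is a unitary representation of $U(1)\times_\omega\mathcal G$ on $\mathsf H$. For $\chi=1$ it restricts on each $\mathsf H_n$ to the unitary projective representation $U^{(M)}_g$ with multiplier $e^{iM\xi(g',g)}$, that is $U^{(M)}_{g'}U^{(M)}_g=e^{iM\xi(g',g)}U^{(M)}_{g'g}$. Here $U^{(M)}_g=Z^{(M)}_g\otimes T_{(c,R)}$ on $L^2(\mathbb R^3,d^3X)\otimes L^2(\mathbb R^{3N-3},d^{3N-3}y)$, where in momentum picture $$(\widetilde Z^{(M)}_g\widetilde\psi)(\mathbf P)=e^{i(c\mathbf v-\mathbf a)\cdot(\mathbf P-M\mathbf v)}\,e^{i\frac{c}{2M}(\mathbf P-M\mathbf v)^2+iM\gamma_g}\,\widetilde\psi(R^{-1}(\mathbf P-M\mathbf v)),$$ and $T_{(c,R)}h=e^{icH_n^{int}}\,h(R^{-1}\,\cdot\,)$. (ii) Pass to the $\zeta$-picture $\check\Psi(\zeta,\mathbf x)=(2\pi)^{-N/2}\sum_n e^{i\sum_k n_k\zeta_k}\Psi(n,\mathbf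 x)$, $\zeta\in\mathbb T^N=(\mathbb R/2\pi\mathbb Z)^N$, and let $\check\Psi(t,\zeta,\mathbf x)$ be the wavefunction evolved to time $t$. For $(\chi,g)$ with $\chi=e^{ir}$ let $$\check G^{n}_{(\chi,g)}(t,\zeta,\mathbf x)=\big(t+c,\ \{\zeta_k+\mathrm{sign}(n_k)(\varphi_{g^{-1}}(t,\mathbf x_k)-r-\xi(g^{-1},g))\ \mathrm{mod}\ 2\pi\},\ \{\mathbf a+t\mathbf v+R\mathbf x_k\}\big).$$ If $\Psi\in\mathsf H_n$ and $\Psi'=U_{(\chi,g)}\Psi$, then $\Psi'$ lies in $\mathsf H_n$ at all times, and for every $t$ and almost every $(\zeta,\mathbf x)$ $$\check\Psi'(t,\zeta,\mathbf x)=\check\Psi\big(\check G^{n}_{(\chi^{-1}\omega(g^{-1},g)^{-1},\;g^{-1})}(t,\zeta,\mathbf x)\big).$$ If $e^{i\gamma_e}=1$ (that is $U_{(1,e)}=I$), then $(\chi^{-1}\omega(g^{-1},g)^{-1},g^{-1})=(\chi,g)^{-1}$ in $U(1)\times_\omega\mathcal G$, and $\check G^n_{(\chi,g)^{-1}}$ is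 the inverse of the map $\check G^n_{(\chi,g)}$, so that $\check\Psi'=\check\Psi\circ(\check G^n_{(\chi,g)})^{-1}$. -/

import Mathlib

open MeasureTheory
open scoped FourierTransform ContDiff

noncomputable section

namespace GalileiMass

/-! ## The Galileian group -/

/-- Physical space `ℝ³` with its Euclidean structure. -/
abbrev E3 := EuclideanSpace ℝ (Fin 3)

/-- `SO(3)`: the linear isometries of `ℝ³` with determinant one. -/
def SO3 : Subgroup (E3 ≃ₗᵢ[ℝ] E3) where
  carrier := {R | LinearMap.det (R.toLinearEquiv : E3 →ₗ[ℝ] E3) = 1}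
  one_mem' := by
    change LinearMap.det (LinearMap.id : E3 →ₗ[ℝ] E3) = 1
    exact LinearMap.det_id
  mul_mem' := by
    intro A B hA hB
    have h : LinearMap.det ((A.toLinearEquiv : E3 →ₗ[ℝ] E3) ∘ₗ
        (B.toLinearEquiv : E3 →ₗ[ℝ] E3)) = 1 := by
      rw [LinearMap.det_comp]
      rw [Set.mem_ofPred_eq] at hA hB
      rw [hA, hB, one_mul]
    exact h
  inv_mem' := by
    intro A hA
    rw [Set.mem_ofPred_eq] at hA
    have h : (A⁻¹.toLinearEquiv : E3 →ₗ[ℝ] E3) ∘ₗ (A.toLinearEquiv : E3 →ₗ[ℝ] E3)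
        = LinearMap.id := by
      ext1 x
      exact A.symm_apply_apply x
    have h2 := congrArg LinearMap.det h
    rw [LinearMap.det_comp, hA, mul_one, LinearMap.det_id] at h2
    exact h2

/-- An element `(c, a, v, R)` of the Galileian group: time translation `c`, space translation `a`,
boost velocity `v` and rotation `R`. -/
@[ext]
structure Galilei where
  c : ℝ
  a : E3
  v : E3
  R : SO3

namespace Galilei

instance : Mul Galilei where
  mul g₂ g₁ := ⟨g₁.c + g₂.c, g₂.R.1 g₁.a + g₁.c • g₂.v + g₂.a, g₂.R.1 g₁.v + g₂.v, g₂.R * g₁.R⟩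

instance : One Galilei where
  one := ⟨0, 0, 0, 1⟩

instance : Inv Galilei where
  inv g := ⟨-g.c, g.R⁻¹.1 (g.c • g.v - g.a), -(g.R⁻¹.1 g.v), g.R⁻¹⟩

@[simp] theorem mul_c (g h : Galilei) : (g * h).c = h.c + g.c := rfl
@[simp] theorem mul_a (g h : Galilei) : (g * h).a = g.R.1 h.a + h.c • g.v + g.a := rfl
@[simp] theorem mul_v (g h : Galilei) : (g * h).v = g.R.1 h.v + g.v := rfl
@[simp] theorem mul_R (g h : Galilei) : (g * h).R = g.R * h.R := rfl
@[simp] theorem one_c : (1 : Galilei).c = 0 := rfl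
@[simp] theorem one_a : (1 : Galilei).a = 0 := rfl
@[simp] theorem one_v : (1 : Galilei).v = 0 := rfl
@[simp] theorem one_R : (1 : Galilei).R = 1 := rfl
@[simp] theorem inv_c (g : Galilei) : (g⁻¹).c = -g.c := rfl
@[simp] theorem inv_a (g : Galilei) : (g⁻¹).a = g.R⁻¹.1 (g.c • g.v - g.a) := rfl
@[simp] theorem inv_v (g : Galilei) : (g⁻¹).v = -(g.R⁻¹.1 g.v) := rfl
@[simp] theorem inv_R (g : Galilei) : (g⁻¹).R = g.R⁻¹ := rfl

@[simp] theorem so3_mul_apply (A B : SO3) (x : E3) : (A * B).1 x = A.1 (B.1 x) := rfl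
@[simp] theorem so3_one_apply (x : E3) : (1 : SO3).1 x = x := rfl
@[simp] theorem so3_inv_apply_self (A : SO3) (x : E3) : (A⁻¹).1 (A.1 x) = x :=
  A.1.symm_apply_apply x
@[simp] theorem so3_self_apply_inv (A : SO3) (x : E3) : A.1 ((A⁻¹).1 x) = x :=
  A.1.apply_symm_apply x

instance : Group Galilei :=
  Group.ofLeftAxioms
    (by
      intro g h k
      refine Galilei.ext ?_ ?_ ?_ (mul_assoc _ _ _)
      · simp only [mul_c]; ring
      · simp only [mul_a, mul_v, mul_c, mul_R, so3_mul_apply, map_add, map_smul]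
        module
      · simp only [mul_v, mul_R, so3_mul_apply, map_add]
        abel)
    (by
      intro g
      refine Galilei.ext ?_ ?_ ?_ (one_mul _)
      · simp
      · simp
      · simp)
    (by
      intro g
      refine Galilei.ext ?_ ?_ ?_ (inv_mul_cancel _)
      · simp
      · simp only [mul_a, inv_R, inv_v, inv_a, map_sub, map_smul, one_a]
        module
      · simp)

/-- The action of the Galileian group on space-time: `(t, x) ↦ (t + c, a + t v + R x)`. -/
def act (g : Galilei) (p : ℝ × E3) : ℝ × E3 :=
  (p.1 + g.c, g.a + p.1 • g.v + g.R.1 p.2)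

theorem act_mul (g h : Galilei) (p : ℝ × E3) : (g * h).act p = g.act (h.act p) := by
  refine Prod.ext ?_ ?_
  · simp only [act, mul_c]; ring
  · simp only [act, mul_a, mul_v, mul_R, so3_mul_apply, map_add, map_smul]
    module

end Galilei

/-! ## The phases and the central extension -/

/-- `φ_g(t, x) = v_g · x - v_g² t / 2 + γ_g`. -/
def phi (γ : Galilei → ℝ) (g : Galilei) (p : ℝ × E3) : ℝ :=
  inner ℝ g.v p.2 - ‖g.v‖ ^ 2 * p.1 / 2 + γ g

/-- `ξ(g', g) = φ_g(g'⁻¹(t, x)) + φ_{g'}(t, x) - φ_{g'g}(t, x)`; the right-hand side does not depend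
on `(t, x)`, see `phi_cocycle`, and is evaluated at the origin. -/
def xi (γ : Galilei → ℝ) (g' g : Galilei) : ℝ :=
  phi γ g (g'⁻¹.act (0, 0)) + phi γ g' (0, 0) - phi γ (g' * g) (0, 0)

theorem phi_cocycle (γ : Galilei → ℝ) (g' g : Galilei) (p : ℝ × E3) :
    phi γ g (g'⁻¹.act p) + phi γ g' p = phi γ (g' * g) p + xi γ g' g := by
  obtain ⟨t, x⟩ := p
  have key : ∀ y z : E3, inner ℝ y (g'.R⁻¹.1 z) = inner ℝ (g'.R.1 y) z := by
    intro y z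
    rw [← g'.R.1.inner_map_map y (g'.R⁻¹.1 z), Galilei.so3_self_apply_inv]
  have hn : ‖g'.R.1 g.v + g'.v‖ ^ 2
      = ‖g.v‖ ^ 2 + 2 * inner ℝ (g'.R.1 g.v) g'.v + ‖g'.v‖ ^ 2 := by
    rw [norm_add_sq_real, LinearIsometryEquiv.norm_map]
  simp only [xi, phi, Galilei.act, Galilei.inv_c, Galilei.inv_a, Galilei.inv_v, Galilei.inv_R,
    Galilei.mul_v, hn, inner_add_left, inner_add_right, inner_sub_right, inner_smul_right, key,
    smul_neg, inner_neg_right, map_sub, map_smul, map_zero, inner_zero_right, zero_smul]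
  ring

theorem xi_cocycle (γ : Galilei → ℝ) (a b c : Galilei) :
    xi γ a b + xi γ (a * b) c = xi γ a (b * c) + xi γ b c := by
  have h1 := phi_cocycle γ a b (0, 0)
  have h2 := phi_cocycle γ (a * b) c (0, 0)
  have h3 := phi_cocycle γ a (b * c) (0, 0)
  have h4 := phi_cocycle γ b c (a⁻¹.act (0, 0))
  rw [mul_inv_rev, Galilei.act_mul] at h2
  rw [mul_assoc] at h2
  linarith

theorem xi_one_left (γ : Galilei → ℝ) (g : Galilei) : xi γ 1 g = γ 1 := by
  have h := phi_cocycle γ 1 g (0, 0)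
  have h1 : phi γ 1 (0, 0) = γ 1 := by simp [phi]
  have h2 : (1 : Galilei)⁻¹.act (0, 0) = (0, 0) := by simp [Galilei.act]
  rw [h2, one_mul, h1] at h
  linarith

/-- `ω(g', g) = e^{i ξ(g', g)}`. -/
def omega (γ : Galilei → ℝ) (g' g : Galilei) : Circle := Circle.exp (xi γ g' g)

/-- The central extension `U(1) ×_ω 𝒢`, as a set of pairs `(χ, g)`. -/
@[ext]
structure CentralExtension (γ : Galilei → ℝ) where
  χ : Circle
  g : Galilei

namespace CentralExtension

variable {γ : Galilei → ℝ}

instance : Mul (CentralExtension γ) where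
  mul p' p := ⟨p'.χ * p.χ * omega γ p'.g p.g, p'.g * p.g⟩

instance : One (CentralExtension γ) where
  one := ⟨(Circle.exp (γ 1))⁻¹, 1⟩

instance : Inv (CentralExtension γ) where
  inv p := ⟨(p.χ * omega γ p.g⁻¹ p.g * Circle.exp (γ 1))⁻¹, p.g⁻¹⟩

instance : Group (CentralExtension γ) :=
  Group.ofLeftAxioms
    (by
      intro p q r
      refine CentralExtension.ext ?_ (mul_assoc _ _ _)
      change p.χ * q.χ * omega γ p.g q.g * r.χ * omega γ (p.g * q.g) r.g
        = p.χ * (q.χ * r.χ * omega γ q.g r.g) * omega γ p.g (q.g * r.g)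
      have h : omega γ p.g q.g * omega γ (p.g * q.g) r.g
          = omega γ p.g (q.g * r.g) * omega γ q.g r.g := by
        simp only [omega, ← Circle.exp_add, xi_cocycle]
      calc p.χ * q.χ * omega γ p.g q.g * r.χ * omega γ (p.g * q.g) r.g
          = p.χ * q.χ * r.χ * (omega γ p.g q.g * omega γ (p.g * q.g) r.g) := by
            simp only [mul_assoc, mul_left_comm, mul_comm]
        _ = _ := by rw [h]; simp only [mul_assoc, mul_left_comm, mul_comm])
    (by
      intro p
      refine CentralExtension.ext ?_ (one_mul _)
      change (Circle.exp (γ 1))⁻¹ * p.χ * omega γ 1 p.g = p.χ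
      rw [omega, xi_one_left, mul_right_comm, inv_mul_cancel, one_mul])
    (by
      intro p
      refine CentralExtension.ext ?_ (inv_mul_cancel _)
      change (p.χ * omega γ p.g⁻¹ p.g * Circle.exp (γ 1))⁻¹ * p.χ * omega γ p.g⁻¹ p.g
        = (Circle.exp (γ 1))⁻¹
      rw [mul_assoc, inv_mul_eq_iff_eq_mul, mul_inv_cancel_right])

end CentralExtension

/-! ## Configuration spaces and Hamiltonians -/

/-- Configurations `(x_1, …, x_N)` of `N` points of `ℝ³`, with Lebesgue measure `d^{3N}x`. -/
abbrev Config (N : ℕ) := Fin N → E3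

/-- `L²(ℝ^{3N}, d^{3N}x)`. -/
abbrev L2 (N : ℕ) := Lp ℂ 2 (volume : Measure (Config N))

/-- Compactly supported smooth functions. -/
def IsTest {N : ℕ} (φ : Config N → ℂ) : Prop := ContDiff ℝ ∞ φ ∧ HasCompactSupport φ

/-- The Laplacian `Δ_k φ` with respect to the position of the `k`-th particle. -/
def particleLaplacian {N : ℕ} (k : Fin N) (φ : Config N → ℂ) (x : Config N) : ℂ :=
  Laplacian.laplacian (fun y : E3 => φ (Function.update x k y)) (x k)

/-- The differential expression `∑_k p_k² / (2 m_k) + V` with `p_k² = -Δ_k`. -/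
def hamExpr {N : ℕ} (m : Fin N → ℝ) (V : Config N → ℝ) (φ : Config N → ℂ) (x : Config N) : ℂ :=
  (∑ k, (1 / (2 * m k) : ℂ) * -particleLaplacian k φ x) + V x * φ x

theorem IsTest.contDiffAt_slice {N : ℕ} {φ : Config N → ℂ} (hφ : IsTest φ) (x : Config N)
    (k : Fin N) (y : E3) : ContDiffAt ℝ 2 (fun y : E3 => φ (Function.update x k y)) y := by
  have h1 : ContDiff ℝ 2 φ := contDiff_infty.1 hφ.1 2
  exact (h1.comp (contDiff_update 2 x k)).contDiffAt

theorem hamExpr_add {N : ℕ} (m : Fin N → ℝ) (V : Config N → ℝ) {φ ψ : Config N → ℂ}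
    (hφ : IsTest φ) (hψ : IsTest ψ) :
    hamExpr m V (φ + ψ) = hamExpr m V φ + hamExpr m V ψ := by
  funext x
  have h : ∀ k, particleLaplacian k (φ + ψ) x
      = particleLaplacian k φ x + particleLaplacian k ψ x := fun k =>
    (hφ.contDiffAt_slice x k (x k)).laplacian_add (hψ.contDiffAt_slice x k (x k))
  simp only [hamExpr, h, Pi.add_apply, neg_add, mul_add, Finset.sum_add_distrib]
  ring

theorem hamExpr_smul {N : ℕ} (m : Fin N → ℝ) (V : Config N → ℝ) {φ : Config N → ℂ}
    (c : ℂ) (hφ : IsTest φ) : hamExpr m V (c • φ) = c • hamExpr m V φ := by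
  funext x
  have h : ∀ k, particleLaplacian k (c • φ) x = c * particleLaplacian k φ x := fun k =>
    InnerProductSpace.laplacian_smul c (hφ.contDiffAt_slice x k (x k))
  simp only [hamExpr, h, Pi.smul_apply, smul_eq_mul, mul_add, Finset.mul_sum]
  congr 1
  · refine Finset.sum_congr rfl fun k _ => ?_
    ring
  · ring

/-- The graph of the operator `∑_k p_k² / (2 m_k) + V` on `C_c^∞(ℝ^{3N})`. -/
def hamGraph {N : ℕ} (m : Fin N → ℝ) (V : Config N → ℝ) : Submodule ℂ (L2 N × L2 N) where
  carrier := {p | ∃ φ : Config N → ℂ, IsTest φ ∧ p.1 =ᵐ[volume] φ ∧ p.2 =ᵐ[volume] hamExpr m V φ}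
  zero_mem' := by
    refine ⟨0, ⟨contDiff_const, HasCompactSupport.zero⟩, Lp.coeFn_zero _ _ _, ?_⟩
    have : hamExpr m V 0 = 0 := by
      have h := hamExpr_smul m V (φ := 0) 0 ⟨contDiff_const, HasCompactSupport.zero⟩
      simpa using h
    rw [this]
    exact Lp.coeFn_zero _ _ _
  add_mem' := by
    rintro p q ⟨φ, hφ, h1, h2⟩ ⟨ψ, hψ, h3, h4⟩
    refine ⟨φ + ψ, ⟨hφ.1.add hψ.1, hφ.2.add hψ.2⟩, ?_, ?_⟩
    · exact (Lp.coeFn_add _ _).trans (h1.add h3)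
    · rw [hamExpr_add m V hφ hψ]
      exact (Lp.coeFn_add _ _).trans (h2.add h4)
  smul_mem' := by
    rintro c p ⟨φ, hφ, h1, h2⟩
    refine ⟨c • φ, ⟨hφ.1.const_smul c, ?_⟩, ?_, ?_⟩
    · exact HasCompactSupport.smul_left (f := fun _ => c) hφ.2
    · exact (Lp.coeFn_smul _ _).trans (h1.const_smul c)
    · rw [hamExpr_smul m V c hφ]
      exact (Lp.coeFn_smul _ _).trans (h2.const_smul c)

/-- The symmetric operator `∑_k p_k² / (2 m_k) + V` in `L²(ℝ^{3N})`, defined on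
`C_c^∞(ℝ^{3N})`. -/
def hamiltonian {N : ℕ} (m : Fin N → ℝ) (V : Config N → ℝ) : L2 N →ₗ.[ℂ] L2 N :=
  (hamGraph m V).toLinearPMap

/-- The graph of `hamiltonian m V` is indeed `hamGraph m V`. -/
theorem hamiltonian_graph {N : ℕ} (m : Fin N → ℝ) (V : Config N → ℝ) :
    (hamiltonian m V).graph = hamGraph m V := by
  refine Submodule.toLinearPMap_graph_eq _ ?_
  rintro ⟨f, h⟩ ⟨φ, hφ, h1, h2⟩ (hf : f = 0)
  have h0 : φ =ᵐ[volume] (0 : Config N → ℂ) := by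
    subst hf
    exact h1.symm.trans (Lp.coeFn_zero _ _ _)
  have hz : φ = 0 := (hφ.1.continuous.ae_eq_iff_eq volume continuous_zero).1 h0
  subst hz
  have h3 : hamExpr m V 0 = 0 := by
    have h := hamExpr_smul m V 0 hφ
    simpa using h
  rw [h3] at h2
  exact Lp.ext (h2.trans (Lp.coeFn_zero _ _ _).symm)

/-- `U` is the strongly continuous one-parameter unitary group `t ↦ e^{-itA}`: its
derivative at `t = 0` on the domain of `A` is `-iA`. For self-adjoint `A` there is exactly one such
group, by Stone's theorem. -/
structure IsUnitaryGroupOf {E : Type*} [NormedAddCommGroup E] [InnerProductSpace ℂ E]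
    (A : E →ₗ.[ℂ] E) (U : ℝ → (E ≃ₗᵢ[ℂ] E)) : Prop where
  map_zero : ∀ ψ, U 0 ψ = ψ
  map_add : ∀ s t ψ, U (s + t) ψ = U s (U t ψ)
  continuous : ∀ ψ, Continuous fun t => U t ψ
  hasDerivAt : ∀ ψ : A.domain, HasDerivAt (fun t => U t ψ) (-(Complex.I • A ψ)) 0

open Classical in
/-- `e^{-itA}` for self-adjoint `A`. -/
def unitaryGroup {E : Type*} [NormedAddCommGroup E] [InnerProductSpace ℂ E]
    (A : E →ₗ.[ℂ] E) : ℝ → (E ≃ₗᵢ[ℂ] E) :=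
  if h : ∃ U : ℝ → (E ≃ₗᵢ[ℂ] E), IsUnitaryGroupOf A U then h.choose
  else fun _ => LinearIsometryEquiv.refl ℂ E

/-- The time evolution `e^{-itH}` of the self-adjoint Hamiltonian `H`, the closure of
`∑_k p_k² / (2 m_k) + V` on `C_c^∞`. -/
def evolution {N : ℕ} (m : Fin N → ℝ) (V : Config N → ℝ) (t : ℝ) : L2 N ≃ₗᵢ[ℂ] L2 N :=
  unitaryGroup (hamiltonian m V).closure t

/-! ## Centre of mass and Jacobi coordinates -/

/-- The position `X` of the centre of mass. -/
def centreOfMass {N : ℕ} (m : Fin N → ℝ) (x : Config N) : E3 :=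
  (∑ j, m j)⁻¹ • ∑ j, m j • x j

/-- The mass `∑_{j > k} m_j` of the particles following the `k`-th one. -/
def tailMass {N : ℕ} (m : Fin N → ℝ) (k : Fin (N - 1)) : ℝ :=
  ∑ j ∈ Finset.univ.filter (fun j : Fin N => k.castLE (Nat.sub_le N 1) < j), m j

/-- The Jacobi coordinates `y_k = x_k - (∑_{j>k} m_j x_j) / (∑_{j>k} m_j)`, `k = 1, …, N - 1`. -/
def jacobi {N : ℕ} (m : Fin N → ℝ) (x : Config N) : Config (N - 1) := fun k =>
  x (k.castLE (Nat.sub_le N 1)) - (tailMass m k)⁻¹ •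
    ∑ j ∈ Finset.univ.filter (fun j : Fin N => k.castLE (Nat.sub_le N 1) < j), m j • x j

/-- The reduced masses `μ_k = m_k (∑_{j>k} m_j) / (m_k + ∑_{j>k} m_j)`. -/
def reducedMass {N : ℕ} (m : Fin N → ℝ) (k : Fin (N - 1)) : ℝ :=
  m (k.castLE (Nat.sub_le N 1)) * tailMass m k / (m (k.castLE (Nat.sub_le N 1)) + tailMass m k)

/-- The potential as a function of the Jacobi coordinates, `V(x) = V_int(y(x))`; this is well
defined when `V` is translation invariant. -/
def internalPotential {N : ℕ} (m : Fin N → ℝ) (V : Config N → ℝ) : Config (N - 1) → ℝ :=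
  Function.extend (jacobi m) V 0

/-- The standing assumptions on the interaction `V` of `N` particles with masses `m`: invariance
under translations and rotations, the Hamiltonian is defined on `C_c^∞(ℝ^{3N})`, and it and the
internal Hamiltonian are essentially self-adjoint on the compactly supported smooth functions. -/
structure IsGalileanPotential {N : ℕ} (m : Fin N → ℝ) (V : Config N → ℝ) : Prop where
  translation : ∀ (b : E3) (x : Config N), V (fun k => x k + b) = V x
  rotation : ∀ (R : SO3) (x : Config N), V (fun k => R.1 (x k)) = V x
  memLp : ∀ φ : Config N → ℂ, IsTest φ → MemLp (fun x => (V x : ℂ) * φ x) 2 volume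
  essSelfAdjoint : IsSelfAdjoint (hamiltonian m V).closure
  essSelfAdjoint_internal :
    IsSelfAdjoint (hamiltonian (reducedMass m) (internalPotential m V)).closure

/-! ## The projective representation for fixed masses -/

theorem measurePreserving_affine (R : SO3) (b : E3) :
    MeasurePreserving (fun x : E3 => R.1 (x + b)) volume volume :=
  R.1.measurePreserving.comp (measurePreserving_add_right volume b)

theorem measurePreserving_affine_config (N : ℕ) (R : SO3) (b : E3) :
    MeasurePreserving (fun (x : Config N) k => R.1 (x k + b)) volume volume :=
  volume_preserving_pi fun _ : Fin N => measurePreserving_affine R b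

/-- Multiplication by the phase `e^{iθ(x)}` on `L²(ℝ³)`. -/
def mulPhase (θ : E3 → ℝ) (hθ : Continuous θ) (f : Lp ℂ 2 (volume : Measure E3)) :
    Lp ℂ 2 (volume : Measure E3) :=
  MemLp.toLp (fun x => Complex.exp (Complex.I * θ x) * f x) <| by
    refine (Lp.memLp f).of_le (AEStronglyMeasurable.mul ?_ (Lp.aestronglyMeasurable f)) ?_
    · exact (Complex.continuous_exp.comp
        (continuous_const.mul (Complex.continuous_ofReal.comp hθ))).aestronglyMeasurable
    · refine Filter.Eventually.of_forall fun x => ?_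
      rw [norm_mul, mul_comm Complex.I, Complex.norm_exp_ofReal_mul_I, one_mul]

/-- The phase `(c v - a)·(P - M v) + c (P - M v)² / (2M) + M γ_g`. -/
def momentumPhase (M : ℝ) (γ : Galilei → ℝ) (g : Galilei) (P : E3) : ℝ :=
  inner ℝ (g.c • g.v - g.a) (P - M • g.v) + g.c / (2 * M) * ‖P - M • g.v‖ ^ 2 + M * γ g

theorem continuous_momentumPhase (M : ℝ) (γ : Galilei → ℝ) (g : Galilei) :
    Continuous (fun κ : E3 => momentumPhase M γ g ((2 * Real.pi) • κ)) := by
  unfold momentumPhase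
  fun_prop

/-- The operator `Z_g^{(M)}` on `L²(ℝ³, d³X)`, given in momentum picture by
`ψ̃(P) ↦ e^{i(c v - a)·(P - M v)} e^{i c (P - M v)²/(2M) + i M γ_g} ψ̃(R⁻¹(P - M v))`.
With Mathlib's normalisation of the Fourier transform the momentum is `P = 2πκ`. -/
def comOp (M : ℝ) (γ : Galilei → ℝ) (g : Galilei) (f : Lp ℂ 2 (volume : Measure E3)) :
    Lp ℂ 2 (volume : Measure E3) :=
  𝓕⁻ (mulPhase (fun κ => momentumPhase M γ g ((2 * Real.pi) • κ)) (continuous_momentumPhase M γ g)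
    (Lp.compMeasurePreserving (fun κ => g.R⁻¹.1 (κ + -((M / (2 * Real.pi)) • g.v)))
      (measurePreserving_affine g.R⁻¹ _) (𝓕 f)))

/-- The operator `T_{(c,R)}` on the internal space `L²(ℝ^{3N-3}, d^{3N-3}y)`: the rotation `R`
followed by the internal time translation `e^{icH_int}`. -/
def internalOp {N : ℕ} (m : Fin N → ℝ) (V : Config N → ℝ) (g : Galilei) (h : L2 (N - 1)) :
    L2 (N - 1) :=
  evolution (reducedMass m) (internalPotential m V) (-g.c)
    (Lp.compMeasurePreserving (fun y k => g.R⁻¹.1 (y k + 0))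
      (measurePreserving_affine_config (N - 1) g.R⁻¹ 0) h)

/-- `A` is the operator `U_g^{(M)} = Z_g^{(M)} ⊗ T_{(c,R)}` on `L²(ℝ^{3N}) ≃ L²(ℝ³) ⊗ L²(ℝ^{3N-3})`,
the identification being the change to the coordinates `(X, y)`. As the products `f(X) h(y)` span
a dense subspace, this determines the bounded operator `A`. -/
def IsGalileanOp {N : ℕ} (m : Fin N → ℝ) (V : Config N → ℝ) (γ : Galilei → ℝ) (g : Galilei)
    (A : L2 N →L[ℂ] L2 N) : Prop :=
  ∀ (f : Lp ℂ 2 (volume : Measure E3)) (h : L2 (N - 1)) (ψ : L2 N),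
    ψ =ᵐ[volume] (fun x => f (centreOfMass m x) * h (jacobi m x)) →
    A ψ =ᵐ[volume] fun x =>
      comOp (∑ j, m j) γ g f (centreOfMass m x) * internalOp m V g h (jacobi m x)

/-! ## The Hilbert space of the extended system -/

/-- The labels `{n_k}` of the sectors, `n_k ∈ ℤ ∖ {0}`. -/
abbrev Sector (N : ℕ) := Fin N → {z : ℤ // z ≠ 0}

/-- The masses `m_k = |n_k|` in a sector. -/
def masses {N : ℕ} (n : Sector N) (k : Fin N) : ℝ := ((n k).1.natAbs : ℝ)

/-- The total mass `M = ∑ |n_k|` of a sector, the eigenvalue of the mass operator. -/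
def totalMass {N : ℕ} (n : Sector N) : ℕ := ∑ k, (n k).1.natAbs

/-- The Hilbert space `H = ⨁_{n_k ≠ 0} L²(ℝ^{3N})`. -/
abbrev HSpace (N : ℕ) := lp (fun _ : Sector N => L2 N) 2

/-- The subspace `H_{{n_k}}` of `H`. -/
def sectorSubspace {N : ℕ} (n : Sector N) : Submodule ℂ (HSpace N) where
  carrier := {Ψ | ∀ n', n' ≠ n → Ψ n' = 0}
  zero_mem' := fun _ _ => rfl
  add_mem' := by
    intro Ψ Φ h1 h2 n' hn
    rw [lp.coeFn_add, Pi.add_apply, h1 n' hn, h2 n' hn, add_zero]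
  smul_mem' := by
    intro c Ψ h1 n' hn
    rw [lp.coeFn_smul, Pi.smul_apply, h1 n' hn, smul_zero]

/-- The time evolution of the whole system: on each sector it is the time evolution with the
masses `|n_k|`. -/
def evolve {N : ℕ} (V : (Fin N → ℝ) → Config N → ℝ) (t : ℝ) (Ψ : HSpace N) : HSpace N :=
  ⟨fun n => evolution (masses n) (V (masses n)) t (Ψ n), by
    have h : Memℓp (fun n => Ψ n) 2 := lp.memℓp Ψ
    have h' : Memℓp (fun n => evolution (masses n) (V (masses n)) t (Ψ n)) 2 := by
      rw [memℓp_gen_iff (by norm_num)] at h ⊢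
      simpa using h
    exact h'⟩

/-! ## The `ζ`-picture -/

instance : Fact (0 < 2 * Real.pi) := ⟨Real.two_pi_pos⟩

/-- The torus `𝕋^N` of the angles `ζ_k`, with the measure `d^Nζ` of total mass `(2π)^N`. -/
abbrev Torus (N : ℕ) := Fin N → AddCircle (2 * Real.pi)

/-- The common eigenfunctions `(2π)^{-N/2} e^{i ∑ n_k ζ_k}` of the operators `-i ∂/∂ζ_k`. -/
def torusChar {N : ℕ} (n : Sector N) (ζ : Torus N) : ℂ :=
  ((Real.sqrt (2 * Real.pi))⁻¹ : ℝ) ^ N * ∏ k, fourier (n k).1 (ζ k)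

theorem continuous_torusChar {N : ℕ} (n : Sector N) : Continuous (torusChar n) := by
  unfold torusChar
  fun_prop

theorem memLp_torus_mul {N : ℕ} (n : Sector N) (f : L2 N) :
    MemLp (fun z : Torus N × Config N => torusChar n z.1 * f z.2) 2 volume := by
  have h1 : MemLp (fun z : Torus N × Config N => f z.2) 2 volume :=
    (Lp.memLp f).comp_snd (volume : Measure (Torus N))
  refine h1.of_le_mul (c := ‖(((Real.sqrt (2 * Real.pi))⁻¹ : ℝ) : ℂ) ^ N‖)
    (((continuous_torusChar n).comp continuous_fst).aestronglyMeasurable.mul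
      h1.aestronglyMeasurable) (Filter.Eventually.of_forall fun z => ?_)
  rw [norm_mul]
  refine le_of_eq (congrArg (· * _) ?_)
  have h2 : ∀ (j : ℤ) (y : AddCircle (2 * Real.pi)), ‖fourier j y‖ = 1 := fun j y => by
    rw [fourier_apply, Circle.norm_coe]
  rw [torusChar, norm_mul, norm_prod]
  simp only [h2, Finset.prod_const_one, mul_one]

theorem integral_fourier_mul (j l : ℤ) :
    ∫ y : AddCircle (2 * Real.pi), starRingEnd ℂ (fourier j y) * fourier l y
      = if j = l then ((2 * Real.pi : ℝ) : ℂ) else 0 := by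
  have h := orthonormal_iff_ite.1 (orthonormal_fourier (T := 2 * Real.pi)) j l
  rw [ContinuousMap.inner_toLp] at h
  rw [AddCircle.volume_eq_smul_haarAddCircle, integral_smul_measure,
    ENNReal.toReal_ofReal Real.two_pi_pos.le]
  have h3 : ∫ y : AddCircle (2 * Real.pi), starRingEnd ℂ (fourier j y) * fourier l y
      ∂AddCircle.haarAddCircle = if j = l then 1 else 0 := by
    rw [← h]
    refine integral_congr_ae (Filter.Eventually.of_forall fun y => ?_)
    simp only [mul_comm]
  rw [h3]
  split_ifs <;> simp

theorem integral_torusChar {N : ℕ} (n n' : Sector N) :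
    ∫ ζ : Torus N, starRingEnd ℂ (torusChar n ζ) * torusChar n' ζ = if n = n' then 1 else 0 := by
  have h1 : ∀ ζ : Torus N, starRingEnd ℂ (torusChar n ζ) * torusChar n' ζ
      = ∏ k, ((2 * Real.pi : ℝ) : ℂ)⁻¹ *
        (starRingEnd ℂ (fourier (n k).1 (ζ k)) * fourier (n' k).1 (ζ k)) := by
    intro ζ
    have h2 : (((Real.sqrt (2 * Real.pi))⁻¹ : ℝ) : ℂ) * (((Real.sqrt (2 * Real.pi))⁻¹ : ℝ) : ℂ)
        = ((2 * Real.pi : ℝ) : ℂ)⁻¹ := by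
      rw [← Complex.ofReal_mul, ← mul_inv, Real.mul_self_sqrt Real.two_pi_pos.le,
        Complex.ofReal_inv]
    rw [Finset.prod_mul_distrib, Finset.prod_mul_distrib, Finset.prod_const, Finset.card_univ,
      Fintype.card_fin, ← h2, mul_pow, torusChar, torusChar, map_mul, map_pow, Complex.conj_ofReal,
      map_prod]
    ring
  simp only [h1]
  rw [integral_fintype_prod_volume_eq_prod (fun k (y : AddCircle (2 * Real.pi)) =>
    ((2 * Real.pi : ℝ) : ℂ)⁻¹ * (starRingEnd ℂ (fourier (n k).1 y) * fourier (n' k).1 y))]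
  simp only [integral_const_mul, integral_fourier_mul]
  have hpi : ((2 * Real.pi : ℝ) : ℂ) ≠ 0 := by exact_mod_cast Real.two_pi_pos.ne'
  split_ifs with h
  · subst h
    simp only [if_true, inv_mul_cancel₀ hpi, Finset.prod_const_one]
  · obtain ⟨k, hk⟩ := Function.ne_iff.1 h
    refine Finset.prod_eq_zero (Finset.mem_univ k) ?_
    rw [if_neg (fun h' => hk (Subtype.ext h')), mul_zero]

theorem inner_torus_mul {N : ℕ} (n n' : Sector N) (f h : L2 N) :
    inner ℂ ((memLp_torus_mul n f).toLp _) ((memLp_torus_mul n' h).toLp _)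
      = if n = n' then inner ℂ f h else 0 := by
  rw [L2.inner_def, L2.inner_def]
  have h1 : ∀ᵐ z : Torus N × Config N,
      inner ℂ ((memLp_torus_mul n f).toLp _ z) ((memLp_torus_mul n' h).toLp _ z)
        = (starRingEnd ℂ (torusChar n z.1) * torusChar n' z.1) * inner ℂ (f z.2) (h z.2) := by
    filter_upwards [(memLp_torus_mul n f).coeFn_toLp, (memLp_torus_mul n' h).coeFn_toLp]
      with z h2 h3
    rw [h2, h3]
    simp only [RCLike.inner_apply, map_mul]
    ring
  rw [integral_congr_ae h1]
  have h4 := integral_prod_mul (μ := (volume : Measure (Torus N)))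
    (ν := (volume : Measure (Config N)))
    (fun ζ => starRingEnd ℂ (torusChar n ζ) * torusChar n' ζ) (fun x => inner ℂ (f x) (h x))
  rw [integral_torusChar] at h4
  refine h4.trans ?_
  split_ifs <;> simp

/-- The embedding of `H_{{n_k}} ≃ L²(ℝ^{3N})` into `L²(𝕋^N × ℝ^{3N})` as the common eigenspace of
the operators `-i ∂/∂ζ_k` with eigenvalues `n_k`:
`f ↦ (2π)^{-N/2} e^{i ∑ n_k ζ_k} f(x)`. -/
def sectorEmbedding {N : ℕ} (n : Sector N) :
    L2 N →ₗᵢ[ℂ] Lp ℂ 2 (volume : Measure (Torus N × Config N)) :=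
  LinearMap.isometryOfInner
    { toFun := fun f => (memLp_torus_mul n f).toLp _
      map_add' := fun f h => by
        rw [← MemLp.toLp_add, MemLp.toLp_eq_toLp_iff]
        have h1 := Measure.quasiMeasurePreserving_snd (μ := (volume : Measure (Torus N)))
          (ν := (volume : Measure (Config N))) |>.ae (Lp.coeFn_add f h)
        filter_upwards [h1] with z hz
        simp only [Pi.add_apply] at hz ⊢
        rw [hz, mul_add]
      map_smul' := fun c f => by
        rw [RingHom.id_apply, ← MemLp.toLp_const_smul, MemLp.toLp_eq_toLp_iff]
        have h1 := Measure.quasiMeasurePreserving_snd (μ := (volume : Measure (Torus N)))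
          (ν := (volume : Measure (Config N))) |>.ae (Lp.coeFn_smul c f)
        filter_upwards [h1] with z hz
        simp only [Pi.smul_apply, smul_eq_mul] at hz ⊢
        rw [hz, mul_left_comm] }
    fun f h => (inner_torus_mul n n f h).trans (if_pos rfl)

theorem orthogonalFamily_sectorEmbedding (N : ℕ) :
    OrthogonalFamily ℂ (fun _ : Sector N => L2 N) (fun n => sectorEmbedding n) :=
  fun n n' hn f h => (inner_torus_mul n n' f h).trans (if_neg hn)

/-- The passage to the `ζ`-picture: the isometry `Ψ ↦ Ψ̌` of `H` onto a closed subspace of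
`L²(𝕋^N × ℝ^{3N})`, `Ψ̌(ζ, x) = ∑_n (2π)^{-N/2} e^{i ∑ n_k ζ_k} Ψ(n, x)`. -/
def zetaPicture (N : ℕ) :
    HSpace N →ₗᵢ[ℂ] Lp ℂ 2 (volume : Measure (Torus N × Config N)) :=
  (orthogonalFamily_sectorEmbedding N).linearIsometry

/-- The time-dependent wavefunction `Ψ̌(t, ζ, x)` in `ζ`-picture; at each time `t` it is an element
of `L²(𝕋^N × ℝ^{3N})`. -/
def zetaWave {N : ℕ} (V : (Fin N → ℝ) → Config N → ℝ) (Ψ : HSpace N)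
    (q : ℝ × Torus N × Config N) : ℂ :=
  zetaPicture N (evolve V q.1 Ψ) q.2

/-- The classical map `Ǧ_{(χ,g)}`, `χ = e^{ir}`, for the signs of the charges `n_k`:
`(t, ζ, x) ↦ (t + c, ζ_k + sign(n_k) (φ_{g⁻¹}(t, x_k) - r - ξ(g⁻¹, g)), a + t v + R x_k)`,
the angles being taken mod `2π`. -/
def classicalMap {N : ℕ} {γ : Galilei → ℝ} (n : Sector N) (p : CentralExtension γ)
    (q : ℝ × Torus N × Config N) : ℝ × Torus N × Config N :=
  (q.1 + p.g.c,
   fun k => q.2.1 k + (((n k).1.sign * (phi γ p.g⁻¹ (q.1, q.2.2 k) - Complex.arg p.χ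
      - xi γ p.g⁻¹ p.g) : ℝ) : AddCircle (2 * Real.pi)),
   fun k => p.g.a + q.1 • p.g.v + p.g.R.1 (q.2.2 k))

/-! ## The operators of the extended group -/

/-- The transformation `Ψ ↦ Ψ(R_g⁻¹(x_k + c_g v_g - a_g))` on `L²(ℝ^{3N})`. -/
def pullBack {N : ℕ} (g : Galilei) (ψ : L2 N) : L2 N :=
  Lp.compMeasurePreserving (fun x k => g.R⁻¹.1 (x k + (g.c • g.v - g.a)))
    (measurePreserving_affine_config N g.R⁻¹ (g.c • g.v - g.a)) ψ

/-- The function `χ^M e^{i ∑_j (v_g · x_j + γ_g) |n_j|} (U_{-c_g}(n) Ψ(n, R_g⁻¹(x_k + c_g v_g - a_g)))`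
on `ℝ^{3N}` which defines `U_{(χ,g)} Ψ` on the sector `n`. -/
def extendedOp {N : ℕ} {γ : Galilei → ℝ} (V : (Fin N → ℝ) → Config N → ℝ) (p : CentralExtension γ)
    (Ψ : HSpace N) (n : Sector N) (x : Config N) : ℂ :=
  (p.χ : ℂ) ^ totalMass n *
    Complex.exp (Complex.I * ((∑ j, (inner ℝ p.g.v (x j) + γ p.g) * masses n j : ℝ) : ℂ)) *
    evolution (masses n) (V (masses n)) (-p.g.c) (pullBack p.g (Ψ n)) x

end GalileiMass

end

open GalileiMass

noncomputable section

namespace GalileiMass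

/-! ## Stone's theorem -/

section Stone

variable {E : Type*} [NormedAddCommGroup E] [InnerProductSpace ℂ E] [CompleteSpace E]
  {A : E →ₗ.[ℂ] E}

open Filter Topology Complex

/-! Everything happens inside one sector, where the masses are fixed. There `galOp` is a product of
three operators in a fixed order: multiplication by a boost phase, the evolution, and the pullback
along a common rotation and translation of the particles. The composition law is the computation
that brings a product of two such operators back to this order (`galOp_galOp`); the scalar left over
is e^{iMξ}. Three exchange relations enter. Pullback against boost is pointwise. Pullback against
evolution is the invariance of the kinetic energy and of V (`evolution_affinePull`). Evolution
against boost is the real content (`evolution_boost`): the exchange produces a translation by tv and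
the phase -tMv²/2.

A boost does not commute with H, but ∑ m_j v·x_j = M v·X, so it sees the centre of mass only. In the
coordinates (X, y) the kinetic form is diagonal with masses M and μ_k, so H acts on products
f(X)h(y) of test functions as P²/2M plus the internal Hamiltonian (`hamExpr_product`). A product of
a free solution and an internal solution therefore solves the Schrödinger equation, strong solutions
are unique, and the evolution factorizes (`evolution_tensor`). Products span a dense subspace
(`ext_tensor`), so the exchange relation reduces to a free particle in ℝ³, where it is the
completion of a square in momentum space (`freeEvolution_boost`). The same factorization yields the
form Z ⊗ T (`comOp_eq`, `galOp_tensor`).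

Two analytic facts support this. `unitaryGroup` is a choice conditional on existence, so the
existence half of Stone's theorem is proved, by bounded approximations (`exists_isUnitaryGroupOf`).
And the free evolution preserves Schwartz functions but not compact supports, so Schwartz functions
are shown to lie in the closure of the graph on test functions (`kinSchwartz_mem_closure`).

The rest is algebra. The character χ^M turns the multiplier ω^M into the product of the central
extension (`sectorOp_sectorOp`). At time t the transformed wavefunction carries the phase ∑ m_k
φ_g(t, x_k) (`evolution_galOp`). Since |n| = n sign n, multiplying e^{inζ} by e^{i|n|r} is the same
as shifting ζ by sign(n) r (`torusChar_add`), so in the ζ-picture the phase becomes part of the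
classical map (`zetaWave_extendedHom`). -/

theorem inner_graph_symm (hA : IsSelfAdjoint A) {x y : E × E} (hx : x ∈ A.graph)
    (hy : y ∈ A.graph) : inner ℂ x.2 y.1 = inner ℂ x.1 y.2 := by
  obtain ⟨x', hx1, hx2⟩ := (LinearPMap.mem_graph_iff A).1 hx
  have h : A.adjoint = A := hA
  have hy' : y ∈ A.adjoint.graph := by rw [h]; exact hy
  obtain ⟨y', hy1, hy2⟩ := (LinearPMap.mem_graph_iff _).1 hy'
  have h1 := (A.adjoint_isFormalAdjoint hA.dense_domain) y' x'
  rw [hx1, hx2, hy1, hy2] at h1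
  rw [← inner_conj_symm, ← h1, inner_conj_symm]

/-- The inclusion A* ⊆ A in graph form. It is how membership in the domain of `A` is checked, for
the range of A + il and for the invariance of the domain. -/
theorem mem_graph_of_forall_inner (hA : IsSelfAdjoint A) {y y' : E}
    (h : ∀ x ∈ A.graph, inner ℂ x.2 y = inner ℂ x.1 y') : (y, y') ∈ A.graph := by
  have hA' : A.adjoint = A := hA
  have h2 : ∀ x : A.domain, inner ℂ y' (x : E) = inner ℂ y (A x) := fun x => by
    rw [← inner_conj_symm, ← h _ (A.mem_graph x), inner_conj_symm]
  have h1 : y ∈ A.adjoint.domain := LinearPMap.mem_adjoint_domain_of_exists y ⟨y', h2⟩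
  have h3 := LinearPMap.adjoint_apply_eq hA.dense_domain ⟨y, h1⟩ h2
  rw [← hA', LinearPMap.mem_graph_iff]
  exact ⟨⟨y, h1⟩, rfl, h3⟩

/-- The cross term vanishes because ⟨Ax, x⟩ is real. Hence A + il is bounded below in the graph norm
when l ≠ 0. -/
theorem norm_sq_add_I_smul (hA : IsSelfAdjoint A) (l : ℝ) {x : E × E} (hx : x ∈ A.graph) :
    ‖x.2 + (I * l : ℂ) • x.1‖ ^ 2 = ‖x.2‖ ^ 2 + l ^ 2 * ‖x.1‖ ^ 2 := by
  have h1 := inner_graph_symm hA hx hx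
  have h2 : (inner ℂ x.2 x.1 : ℂ).im = 0 := by
    have := congrArg Complex.im h1
    rw [← inner_conj_symm x.1 x.2, Complex.conj_im] at this
    linarith
  rw [norm_add_sq (𝕜 := ℂ), inner_smul_right, norm_smul]
  simp [h2, mul_pow]

/-- A closed graph is complete, so A + il, being bounded below on it, is injective with closed
range. It remains to see that nothing is orthogonal to the range. -/
theorem exists_resolvent (hA : IsSelfAdjoint A) {l : ℝ} (hl : l ≠ 0) :
    ∃ R : E →L[ℂ] E, (∀ y, (R y, y - (I * l : ℂ) • R y) ∈ A.graph) ∧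
      (∀ x ∈ A.graph, R (x.2 + (I * l : ℂ) • x.1) = x.1) ∧ ∀ y, |l| * ‖R y‖ ≤ ‖y‖ := by
  let T : A.graph →ₗ[ℂ] E :=
    (LinearMap.snd ℂ E E + (I * l : ℂ) • LinearMap.fst ℂ E E) ∘ₗ A.graph.subtype
  have hT : ∀ x : A.graph, T x = x.1.2 + (I * l : ℂ) • x.1.1 := fun x => rfl
  have hnorm : ∀ x : A.graph, ‖T x‖ ^ 2 = ‖x.1.2‖ ^ 2 + l ^ 2 * ‖x.1.1‖ ^ 2 := fun x =>
    norm_sq_add_I_smul hA l x.2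
  have hb2 : ∀ x : A.graph, ‖x.1.2‖ ≤ ‖T x‖ := fun x => by
    refine abs_le_of_sq_le_sq' ?_ (norm_nonneg _) |>.2
    rw [hnorm]; nlinarith [sq_nonneg (l * ‖x.1.1‖)]
  have hb1 : ∀ x : A.graph, |l| * ‖x.1.1‖ ≤ ‖T x‖ := fun x => by
    refine abs_le_of_sq_le_sq' ?_ (norm_nonneg _) |>.2
    rw [hnorm, mul_pow, sq_abs]; nlinarith [sq_nonneg (‖x.1.2‖)]
  have hl' : 0 < |l| := abs_pos.2 hl
  have hanti : AntilipschitzWith (Real.toNNReal (max 1 |l|⁻¹)) T := by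
    refine AddMonoidHomClass.antilipschitz_of_bound T fun x => ?_
    rw [Real.coe_toNNReal _ (le_max_of_le_left zero_le_one)]
    change max ‖x.1.1‖ ‖x.1.2‖ ≤ _
    refine max_le ?_ ?_
    · calc ‖x.1.1‖ = |l|⁻¹ * (|l| * ‖x.1.1‖) := by field_simp
        _ ≤ |l|⁻¹ * ‖T x‖ := by gcongr; exact hb1 x
        _ ≤ _ := by gcongr; exact le_max_right _ _
    · calc ‖x.1.2‖ ≤ 1 * ‖T x‖ := by rw [one_mul]; exact hb2 x
        _ ≤ _ := by gcongr; exact le_max_left _ _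
  have hcl : IsClosed (A.graph : Set (E × E)) := hA.isClosed
  have : CompleteSpace A.graph := hcl.completeSpace_coe
  have hcont : Continuous T := by
    change Continuous fun x : A.graph => x.1.2 + (I * l : ℂ) • x.1.1
    fun_prop
  have hrange : IsClosed (Set.range T) := by
    have : UniformContinuous (⟨T, hcont⟩ : A.graph →L[ℂ] E) :=
      ContinuousLinearMap.uniformContinuous _
    exact hanti.isClosed_range this
  have hsurj : LinearMap.range T = ⊤ := by
    have hc : IsClosed (LinearMap.range T : Set E) := by
      rw [LinearMap.coe_range]; exact hrange
    have : CompleteSpace (LinearMap.range T) := hc.completeSpace_coe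
    rw [← Submodule.orthogonal_eq_bot_iff, Submodule.eq_bot_iff]
    intro y hy
    -- A vector orthogonal to the range satisfies A y = i l y; a symmetric operator has no nonreal
    -- eigenvalue, so y = 0.
    have h1 : (y, (I * l : ℂ) • y) ∈ A.graph := by
      refine mem_graph_of_forall_inner hA fun x hx => ?_
      have h2 := (Submodule.mem_orthogonal _ _).1 hy (T ⟨x, hx⟩) ⟨_, rfl⟩
      rw [hT, inner_add_left, inner_smul_left] at h2
      rw [inner_smul_right]
      simp only [map_mul, conj_I, conj_ofReal] at h2
      linear_combination h2
    have h2 := inner_graph_symm hA h1 h1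
    simp only [inner_smul_left, inner_smul_right, map_mul, conj_I, conj_ofReal] at h2
    have h3 : (I * l : ℂ) * inner ℂ y y = 0 := by linear_combination -(1/2 : ℂ) * h2
    rcases mul_eq_zero.1 h3 with h4 | h4
    · rcases mul_eq_zero.1 h4 with h5 | h5
      · exact absurd h5 I_ne_zero
      · exact absurd (ofReal_eq_zero.1 h5) hl
    · exact inner_self_eq_zero.1 h4
  let e := LinearEquiv.ofBijective T ⟨hanti.injective, LinearMap.range_eq_top.1 hsurj⟩
  have he : ∀ y, T (e.symm y) = y := fun y => e.apply_symm_apply y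
  have hbd : ∀ y, |l| * ‖(e.symm y).1.1‖ ≤ ‖y‖ := fun y => by
    have := hb1 (e.symm y)
    rwa [he] at this
  refine ⟨LinearMap.mkContinuous
    (LinearMap.fst ℂ E E ∘ₗ A.graph.subtype ∘ₗ e.symm.toLinearMap) |l|⁻¹ fun y => ?_, ?_, ?_, hbd⟩
  · change ‖(e.symm y).1.1‖ ≤ _
    rw [inv_mul_eq_div, le_div_iff₀' hl']
    exact hbd y
  · intro y
    change ((e.symm y).1.1, y - (I * l : ℂ) • (e.symm y).1.1) ∈ A.graph
    have h1 : y - (I * l : ℂ) • (e.symm y).1.1 = (e.symm y).1.2 := by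
      nth_rw 1 [← he y]; rw [hT]; abel
    rw [h1]
    exact (e.symm y).2
  · intro x hx
    change (e.symm (T ⟨x, hx⟩)).1.1 = x.1
    have : e.symm (T ⟨x, hx⟩) = ⟨x, hx⟩ := e.symm_apply_apply _
    rw [this]

/-- The resolvent `(A + il)⁻¹` of a self-adjoint operator. -/
def stoneResolvent (hA : IsSelfAdjoint A) (l : {l : ℝ // l ≠ 0}) : E →L[ℂ] E :=
  (exists_resolvent hA l.2).choose

theorem stoneResolvent_mem (hA : IsSelfAdjoint A) (l : {l : ℝ // l ≠ 0}) (y : E) :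
    (stoneResolvent hA l y, y - (I * l : ℂ) • stoneResolvent hA l y) ∈ A.graph :=
  (exists_resolvent hA l.2).choose_spec.1 y

theorem stoneResolvent_apply (hA : IsSelfAdjoint A) (l : {l : ℝ // l ≠ 0}) {x x' : E}
    (hx : (x, x') ∈ A.graph) : stoneResolvent hA l (x' + (I * l : ℂ) • x) = x :=
  (exists_resolvent hA l.2).choose_spec.2.1 _ hx

theorem norm_stoneResolvent_le (hA : IsSelfAdjoint A) (l : {l : ℝ // l ≠ 0}) (y : E) :
    |(l : ℝ)| * ‖stoneResolvent hA l y‖ ≤ ‖y‖ :=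
  (exists_resolvent hA l.2).choose_spec.2.2 y

/-- Symmetry of `A` tested on the two resolvent vectors: the resolvents at l and -l are adjoint to
each other, which is why the approximations below average over both signs. -/
theorem inner_stoneResolvent (hA : IsSelfAdjoint A) (l l' : {l : ℝ // l ≠ 0})
    (hl : (l' : ℝ) = -l) (x y : E) :
    inner ℂ (stoneResolvent hA l x) y = inner ℂ x (stoneResolvent hA l' y) := by
  have h := inner_graph_symm hA (stoneResolvent_mem hA l x) (stoneResolvent_mem hA l' y)
  simp only [inner_sub_left, inner_sub_right, inner_smul_left, inner_smul_right, map_mul, conj_I,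
    conj_ofReal, hl, ofReal_neg] at h
  linear_combination -h

theorem stoneResolvent_comm (hA : IsSelfAdjoint A) (l l' : {l : ℝ // l ≠ 0}) :
    Commute (stoneResolvent hA l) (stoneResolvent hA l') := by
  refine ContinuousLinearMap.ext fun y => ?_
  change stoneResolvent hA l (stoneResolvent hA l' y)
    = stoneResolvent hA l' (stoneResolvent hA l y)
  have h1 := stoneResolvent_mem hA l (stoneResolvent hA l' y)
  have h2 := stoneResolvent_mem hA l' y
  set w := stoneResolvent hA l' y
  set u := stoneResolvent hA l w
  -- `v = A u + i l' u` is in the domain and is mapped to `y` by `A + i l`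
  have h3 : (w + (I * l' - I * l : ℂ) • u,
      (y - (I * l' : ℂ) • w) + (I * l' - I * l : ℂ) • (w - (I * l : ℂ) • u)) ∈ A.graph :=
    A.graph.add_mem h2 (A.graph.smul_mem _ h1)
  have h4 := stoneResolvent_apply hA l h3
  have h5 : (y - (I * l' : ℂ) • w) + (I * l' - I * l : ℂ) • (w - (I * l : ℂ) • u)
      + (I * l : ℂ) • (w + (I * l' - I * l : ℂ) • u) = y := by module
  rw [h5] at h4
  rw [h4]
  refine (stoneResolvent_apply hA l' h1).symm.trans (congrArg _ ?_)
  module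

/-- On the domain the error is -(A + il)⁻¹Ax, of norm at most ‖Ax‖/|l|. The operators il(A + il)⁻¹
are contractions, so density of the domain gives the limit everywhere. -/
theorem tendsto_stoneResolvent (hA : IsSelfAdjoint A) (l : ℕ → {l : ℝ // l ≠ 0})
    (hl : Tendsto (fun n => |(l n : ℝ)|) atTop atTop) (y : E) :
    Tendsto (fun n => (I * (l n : ℝ) : ℂ) • stoneResolvent hA (l n) y) atTop (𝓝 y) := by
  have hbd : ∀ n y, ‖(I * (l n : ℝ) : ℂ) • stoneResolvent hA (l n) y‖ ≤ ‖y‖ := fun n y => by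
    rw [norm_smul, norm_mul, norm_I, one_mul, norm_real, Real.norm_eq_abs]
    exact norm_stoneResolvent_le hA _ _
  have hinv : Tendsto (fun n => |(l n : ℝ)|⁻¹) atTop (𝓝 0) := tendsto_inv_atTop_zero.comp hl
  have hD : ∀ x : A.domain,
      Tendsto (fun n => (I * (l n : ℝ) : ℂ) • stoneResolvent hA (l n) (x : E)) atTop (𝓝 (x : E)) := by
    intro x
    rw [tendsto_iff_norm_sub_tendsto_zero]
    refine squeeze_zero (fun _ => norm_nonneg _) (fun n => ?_)
      (by simpa using hinv.mul_const ‖A x‖)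
    have h1 := stoneResolvent_apply hA (l n) (A.mem_graph x)
    rw [map_add, map_smul] at h1
    have h2 : (I * (l n : ℝ) : ℂ) • stoneResolvent hA (l n) (x : E) - x
        = -stoneResolvent hA (l n) (A x) := by
      nth_rw 2 [← h1]; abel
    rw [h2, norm_neg, inv_mul_eq_div, le_div_iff₀' (abs_pos.2 (l n).2)]
    exact norm_stoneResolvent_le hA _ _
  rw [Metric.tendsto_atTop]
  intro ε hε
  obtain ⟨x, hx, hxy⟩ := Metric.mem_closure_iff.1 (hA.dense_domain y) (ε / 3) (by positivity)
  obtain ⟨n0, hn0⟩ := Metric.tendsto_atTop.1 (hD ⟨x, hx⟩) (ε / 3) (by positivity)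
  refine ⟨n0, fun n hn => ?_⟩
  have h1 := hn0 n hn
  have h2 := hbd n (y - x)
  rw [map_sub, smul_sub] at h2
  rw [dist_eq_norm] at hxy h1 ⊢
  have : (I * (l n : ℝ) : ℂ) • stoneResolvent hA (l n) y - y
      = ((I * (l n : ℝ) : ℂ) • stoneResolvent hA (l n) y
          - (I * (l n : ℝ) : ℂ) • stoneResolvent hA (l n) x)
        + ((I * (l n : ℝ) : ℂ) • stoneResolvent hA (l n) x - x) - (y - x) := by abel
  rw [this]
  refine (norm_sub_le _ _).trans_lt ?_
  have := norm_add_le ((I * (l n : ℝ) : ℂ) • stoneResolvent hA (l n) y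
          - (I * (l n : ℝ) : ℂ) • stoneResolvent hA (l n) x)
        ((I * (l n : ℝ) : ℂ) • stoneResolvent hA (l n) x - x)
  linarith

/-! ### Bounded self-adjoint approximations -/

/-- The approximations `(l² / 2) ((A + il)⁻¹ + (A - il)⁻¹)`, `l = n + 1`, of a self-adjoint
operator `A` by bounded ones. -/
def yosida (hA : IsSelfAdjoint A) (n : ℕ) : E →L[ℂ] E :=
  (((n + 1 : ℝ) ^ 2 / 2 : ℝ) : ℂ) • (stoneResolvent hA ⟨n + 1, by positivity⟩
    + stoneResolvent hA ⟨-(n + 1), neg_ne_zero.2 (by positivity)⟩)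

theorem isSelfAdjoint_yosida (hA : IsSelfAdjoint A) (n : ℕ) : IsSelfAdjoint (yosida hA n) := by
  rw [ContinuousLinearMap.isSelfAdjoint_iff_isSymmetric]
  intro x y
  have h1 := inner_stoneResolvent hA ⟨(n + 1 : ℝ), by positivity⟩
    ⟨-(n + 1 : ℝ), neg_ne_zero.2 (by positivity)⟩ rfl x y
  have h2 := inner_stoneResolvent hA
    ⟨-(n + 1 : ℝ), neg_ne_zero.2 (by positivity)⟩ ⟨(n + 1 : ℝ), by positivity⟩ (neg_neg _).symm x y
  change inner ℂ (yosida hA n x) y = inner ℂ x (yosida hA n y)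
  simp only [yosida, _root_.smul_apply, _root_.add_apply, conj_ofReal,
    inner_smul_left, inner_smul_right, inner_add_left, inner_add_right, h1, h2]
  ring

theorem commute_yosida (hA : IsSelfAdjoint A) (m n : ℕ) : Commute (yosida hA m) (yosida hA n) := by
  have h := stoneResolvent_comm hA
  exact ((((h _ _).add_right (h _ _)).add_left ((h _ _).add_right (h _ _))).smul_left _).smul_right _

/-- From (A + il)⁻¹Ax = x - il(A + il)⁻¹x, the mean of ±il(A ± il)⁻¹Ax over the two signs is the
approximation applied to x, the terms ±ilx cancelling. Both means converge to Ax by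
`tendsto_stoneResolvent`. -/
theorem tendsto_yosida (hA : IsSelfAdjoint A) (x : A.domain) :
    Tendsto (fun n => yosida hA n x) atTop (𝓝 (A x)) := by
  have hn : Tendsto (fun n : ℕ => |(n + 1 : ℝ)|) atTop atTop :=
    tendsto_abs_atTop_atTop.comp
      ((tendsto_natCast_atTop_atTop (R := ℝ)).atTop_add tendsto_const_nhds)
  have h1 := tendsto_stoneResolvent hA (fun n => ⟨(n + 1 : ℝ), by positivity⟩) hn (A x)
  have h2 := tendsto_stoneResolvent hA
    (fun n => ⟨-(n + 1 : ℝ), neg_ne_zero.2 (by positivity)⟩) (by simpa only [abs_neg] using hn) (A x)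
  have h3 := (h1.add h2).const_smul (1 / 2 : ℂ)
  have h4 : (1 / 2 : ℂ) • (A x + A x) = A x := by module
  rw [h4] at h3
  refine h3.congr fun n => ?_
  have e1 := stoneResolvent_apply hA ⟨(n + 1 : ℝ), by positivity⟩ (A.mem_graph x)
  have e2 := stoneResolvent_apply hA ⟨-(n + 1 : ℝ), neg_ne_zero.2 (by positivity)⟩ (A.mem_graph x)
  rw [map_add, map_smul] at e1 e2
  simp only [yosida, _root_.smul_apply, _root_.add_apply]
  rw [eq_sub_of_add_eq e1, eq_sub_of_add_eq e2]
  simp only [ofReal_neg, ofReal_div, ofReal_pow, ofReal_ofNat]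
  match_scalars
  · ring
  · linear_combination (-((n : ℂ) + 1) ^ 2 / 2) * I_mul_I
  · linear_combination (-((n : ℂ) + 1) ^ 2 / 2) * I_mul_I

/-! ### Unitary groups of bounded self-adjoint operators -/

/-- The unitary group `e^{-itB}` of a bounded self-adjoint operator. -/
def boundedGroup (B : E →L[ℂ] E) (t : ℝ) : E →L[ℂ] E := NormedSpace.exp (t • (-I) • B)

theorem boundedGroup_zero (B : E →L[ℂ] E) : boundedGroup B 0 = 1 := by
  simp [boundedGroup, NormedSpace.exp_zero]

theorem boundedGroup_add (B : E →L[ℂ] E) (s t : ℝ) :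
    boundedGroup B (s + t) = boundedGroup B s * boundedGroup B t := by
  let +nondep : NormedAlgebra ℚ (E →L[ℂ] E) := .restrictScalars ℚ ℂ (E →L[ℂ] E)
  rw [boundedGroup, add_smul]
  exact NormedSpace.exp_add_of_commute ((Commute.refl _).smul_left _ |>.smul_right _)

theorem hasDerivAt_boundedGroup (B : E →L[ℂ] E) (t : ℝ) (x : E) :
    HasDerivAt (fun s => boundedGroup B s x) (boundedGroup B t (-(I • B x))) t := by
  have h := ((ContinuousLinearMap.apply ℂ E x).restrictScalars ℝ).hasFDerivAt.comp_hasDerivAt t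
    (hasDerivAt_exp_smul_const (𝕂 := ℝ) ((-I) • B) t)
  refine h.congr_deriv ?_
  change NormedSpace.exp (t • (-I) • B) ((-I) • B x) = boundedGroup B t (-(I • B x))
  rw [neg_smul I (B x)]
  rfl

theorem norm_boundedGroup {B : E →L[ℂ] E} (hB : IsSelfAdjoint B) (t : ℝ) (x : E) :
    ‖boundedGroup B t x‖ = ‖x‖ := by
  let +nondep : NormedAlgebra ℚ (E →L[ℂ] E) := .restrictScalars ℚ ℂ (E →L[ℂ] E)
  have h1 : (t • (-I) • B : E →L[ℂ] E) ∈ skewAdjoint (E →L[ℂ] E) := by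
    rw [skewAdjoint.mem_iff, star_smul, star_smul, hB.star_eq]
    simp
  have h2 : boundedGroup B t ∈ unitary (E →L[ℂ] E) :=
    NormedSpace.exp_mem_unitary_of_mem_skewAdjoint h1
  exact ContinuousLinearMap.norm_map_of_mem_unitary h2 x

theorem norm_boundedGroup_sub_le {B : E →L[ℂ] E} (hB : IsSelfAdjoint B) (t : ℝ) (x : E) :
    ‖boundedGroup B t x - x‖ ≤ |t| * ‖B x‖ := by
  have h := Convex.norm_image_sub_le_of_norm_hasDerivWithin_le (f := fun s => boundedGroup B s x)
    (f' := fun s => boundedGroup B s (-(I • B x))) (C := ‖B x‖) (s := Set.univ) (x := 0) (y := t)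
    (fun s _ => (hasDerivAt_boundedGroup B s x).hasDerivWithinAt)
    (fun s _ => by rw [norm_boundedGroup hB, norm_neg, norm_smul, norm_I, one_mul])
    convex_univ trivial trivial
  rw [boundedGroup_zero] at h
  simpa [mul_comm] using h

/-- Since B and C commute, e^{-itB} = e^{-itC}e^{-it(B-C)}, and the first factor is isometric; no
Duhamel integral is needed. -/
theorem norm_boundedGroup_sub_boundedGroup_le {B C : E →L[ℂ] E} (hB : IsSelfAdjoint B)
    (hC : IsSelfAdjoint C) (h : Commute B C) (t : ℝ) (x : E) :
    ‖boundedGroup B t x - boundedGroup C t x‖ ≤ |t| * ‖B x - C x‖ := by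
  let +nondep : NormedAlgebra ℚ (E →L[ℂ] E) := .restrictScalars ℚ ℂ (E →L[ℂ] E)
  have h1 : boundedGroup B t = boundedGroup C t * boundedGroup (B - C) t := by
    rw [boundedGroup, boundedGroup, boundedGroup, ← NormedSpace.exp_add_of_commute]
    · congr 1; module
    · have : Commute C (B - C) := h.symm.sub_right (Commute.refl C)
      exact (((this.smul_left _).smul_left _).smul_right _).smul_right _
  have h2 : boundedGroup B t x - boundedGroup C t x
      = boundedGroup C t (boundedGroup (B - C) t x - x) := by
    rw [h1, map_sub]; rfl
  rw [h2, norm_boundedGroup hC]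
  exact norm_boundedGroup_sub_le (hB.sub hC) t x

/-- On the domain the approximating groups are Cauchy because their commuting generators converge
there. They are isometries, so an ε/4 argument extends this to every vector. -/
theorem exists_tendsto_yosidaGroup (hA : IsSelfAdjoint A) (t : ℝ) (x : E) :
    ∃ y, Tendsto (fun n => boundedGroup (yosida hA n) t x) atTop (𝓝 y) := by
  refine cauchySeq_tendsto_of_complete (Metric.cauchySeq_iff'.2 fun ε hε => ?_)
  obtain ⟨d, hd, hxd⟩ := Metric.mem_closure_iff.1 (hA.dense_domain x) (ε / 4) (by positivity)
  have h1 := (tendsto_yosida hA ⟨d, hd⟩).cauchySeq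
  obtain ⟨n0, hn0⟩ := Metric.cauchySeq_iff'.1 h1 (ε / (4 * (|t| + 1))) (by positivity)
  refine ⟨n0, fun n hn => ?_⟩
  have h2 := hn0 n hn
  have h3 := norm_boundedGroup_sub_boundedGroup_le (isSelfAdjoint_yosida hA n)
    (isSelfAdjoint_yosida hA n0) (commute_yosida hA n n0) t d
  have h4 := norm_boundedGroup (isSelfAdjoint_yosida hA n) t (x - d)
  have h5 := norm_boundedGroup (isSelfAdjoint_yosida hA n0) t (x - d)
  rw [map_sub] at h4 h5
  rw [dist_eq_norm] at h2 hxd ⊢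
  have h6 : |t| * ‖yosida hA n d - yosida hA n0 d‖ ≤ ε / 4 := by
    calc _ ≤ (|t| + 1) * (ε / (4 * (|t| + 1))) := by
          gcongr
          linarith
      _ = ε / 4 := by field_simp
  have h7 : boundedGroup (yosida hA n) t x - boundedGroup (yosida hA n0) t x
      = (boundedGroup (yosida hA n) t x - boundedGroup (yosida hA n) t d)
        + (boundedGroup (yosida hA n) t d - boundedGroup (yosida hA n0) t d)
        - (boundedGroup (yosida hA n0) t x - boundedGroup (yosida hA n0) t d) := by abel
  rw [h7]
  refine (norm_sub_le _ _).trans_lt ?_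
  have := norm_add_le (boundedGroup (yosida hA n) t x - boundedGroup (yosida hA n) t d)
    (boundedGroup (yosida hA n) t d - boundedGroup (yosida hA n0) t d)
  linarith

/-! ### The limit group -/

/-- The limit of the unitary groups of the bounded approximations. -/
def stoneLimit (hA : IsSelfAdjoint A) (t : ℝ) (x : E) : E :=
  (exists_tendsto_yosidaGroup hA t x).choose

theorem tendsto_stoneLimit (hA : IsSelfAdjoint A) (t : ℝ) (x : E) :
    Tendsto (fun n => boundedGroup (yosida hA n) t x) atTop (𝓝 (stoneLimit hA t x)) :=
  (exists_tendsto_yosidaGroup hA t x).choose_spec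

theorem norm_stoneLimit (hA : IsSelfAdjoint A) (t : ℝ) (x : E) : ‖stoneLimit hA t x‖ = ‖x‖ :=
  tendsto_nhds_unique (tendsto_stoneLimit hA t x).norm
    (by simp only [norm_boundedGroup (isSelfAdjoint_yosida hA _), tendsto_const_nhds])

theorem stoneLimit_zero (hA : IsSelfAdjoint A) (x : E) : stoneLimit hA 0 x = x :=
  tendsto_nhds_unique (tendsto_stoneLimit hA 0 x)
    (by simp [boundedGroup_zero])

/-- The limit group as a linear isometry. -/
def stoneIsometry (hA : IsSelfAdjoint A) (t : ℝ) : E →ₗᵢ[ℂ] E where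
  toFun := stoneLimit hA t
  map_add' x y := tendsto_nhds_unique (tendsto_stoneLimit hA t (x + y)) <| by
    simpa using (tendsto_stoneLimit hA t x).add (tendsto_stoneLimit hA t y)
  map_smul' c x := tendsto_nhds_unique (tendsto_stoneLimit hA t (c • x)) <| by
    simpa using (tendsto_stoneLimit hA t x).const_smul c
  norm_map' := norm_stoneLimit hA t

theorem stoneLimit_add (hA : IsSelfAdjoint A) (s t : ℝ) (x : E) :
    stoneLimit hA (s + t) x = stoneLimit hA s (stoneLimit hA t x) := by
  refine tendsto_nhds_unique (tendsto_stoneLimit hA (s + t) x) ?_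
  have h1 := tendsto_stoneLimit hA s (stoneLimit hA t x)
  -- Although the outer operators vary with n, they are isometric and so keep a null sequence null.
  have h2 : Tendsto (fun n => boundedGroup (yosida hA n) s
      (boundedGroup (yosida hA n) t x - stoneLimit hA t x)) atTop (𝓝 0) := by
    rw [tendsto_zero_iff_norm_tendsto_zero]
    simp only [norm_boundedGroup (isSelfAdjoint_yosida hA _)]
    exact tendsto_iff_norm_sub_tendsto_zero.1 (tendsto_stoneLimit hA t x)
  refine (by simpa using h2.add h1 : Tendsto _ _ _).congr fun n => ?_
  rw [boundedGroup_add]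
  rfl

/-- The factor |t| is the point: divided by t, the error is small uniformly in t, so derivatives at
0 pass to the limit. -/
theorem norm_stoneLimit_sub_le (hA : IsSelfAdjoint A) (n : ℕ) (t : ℝ) (x : A.domain) :
    ‖stoneLimit hA t x - boundedGroup (yosida hA n) t x‖ ≤ |t| * ‖A x - yosida hA n x‖ := by
  refine le_of_tendsto_of_tendsto
    ((tendsto_stoneLimit hA t x).sub tendsto_const_nhds).norm
    (((tendsto_yosida hA x).sub tendsto_const_nhds).norm.const_mul _)
    (Eventually.of_forall fun m => ?_)
  exact norm_boundedGroup_sub_boundedGroup_le (isSelfAdjoint_yosida hA m)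
    (isSelfAdjoint_yosida hA n) (commute_yosida hA m n) t x

theorem hasDerivAt_stoneLimit (hA : IsSelfAdjoint A) (x : A.domain) :
    HasDerivAt (fun t => stoneLimit hA t x) (-(I • A x)) 0 := by
  rw [hasDerivAt_iff_isLittleO, Asymptotics.isLittleO_iff]
  intro ε hε
  obtain ⟨n, hn⟩ := Metric.tendsto_atTop.1 (tendsto_yosida hA x) (ε / 3) (by positivity)
  have h1 := hn n le_rfl
  rw [dist_eq_norm] at h1
  have h2 := hasDerivAt_boundedGroup (yosida hA n) 0 (x : E)
  rw [boundedGroup_zero, hasDerivAt_iff_isLittleO, Asymptotics.isLittleO_iff] at h2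
  filter_upwards [h2 (show 0 < ε / 3 by positivity)] with t ht
  have h3 := norm_stoneLimit_sub_le hA n t x
  rw [boundedGroup_zero] at ht
  simp only [sub_zero, stoneLimit_zero, one_apply_eq_self] at ht ⊢
  have h4 : stoneLimit hA t x - x - t • -(I • A x)
      = (stoneLimit hA t x - boundedGroup (yosida hA n) t x)
        + (boundedGroup (yosida hA n) t x - x - t • -(I • yosida hA n x))
        - t • I • (yosida hA n x - A x) := by
    module
  rw [h4]
  refine (norm_sub_le _ _).trans ?_
  have h5 := norm_add_le (stoneLimit hA t x - boundedGroup (yosida hA n) t x)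
    (boundedGroup (yosida hA n) t x - x - t • -(I • yosida hA n x))
  have h6 : ‖t • I • (yosida hA n x - A x)‖ = |t| * ‖yosida hA n x - A x‖ := by
    rw [norm_smul, norm_smul, norm_I, one_mul, Real.norm_eq_abs]
  rw [norm_sub_rev] at h3
  rw [norm_sub_rev] at h3
  rw [norm_sub_rev (A x)] at h3
  rw [h6]
  rw [Real.norm_eq_abs] at ht ⊢
  have h7 : |t| * ‖yosida hA n x - A x‖ ≤ |t| * (ε / 3) := by gcongr
  linarith

theorem continuous_stoneLimit (hA : IsSelfAdjoint A) (x : E) :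
    Continuous fun t => stoneLimit hA t x := by
  have h0 : ∀ x : E, ContinuousAt (fun t => stoneLimit hA t x) 0 := by
    intro x
    rw [Metric.continuousAt_iff']
    intro ε hε
    obtain ⟨d, hd, hxd⟩ := Metric.mem_closure_iff.1 (hA.dense_domain x) (ε / 3) (by positivity)
    have h1 := Metric.continuousAt_iff'.1 (hasDerivAt_stoneLimit hA ⟨d, hd⟩).continuousAt (ε / 3)
      (by positivity)
    filter_upwards [h1] with t ht
    rw [stoneLimit_zero] at ht ⊢
    have h2 : ‖stoneIsometry hA t (x - d)‖ = ‖x - d‖ := (stoneIsometry hA t).norm_map _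
    rw [map_sub] at h2
    change ‖stoneLimit hA t x - stoneLimit hA t d‖ = _ at h2
    rw [dist_eq_norm] at ht hxd ⊢
    have h3 : stoneLimit hA t x - x
        = (stoneLimit hA t x - stoneLimit hA t d) + (stoneLimit hA t d - d) - (x - d) := by abel
    rw [h3]
    refine (norm_sub_le _ _).trans_lt ?_
    have := norm_add_le (stoneLimit hA t x - stoneLimit hA t d) (stoneLimit hA t d - d)
    linarith
  rw [continuous_iff_continuousAt]
  intro s
  have h1 : (fun t => stoneLimit hA t x) = fun t => stoneLimit hA (t - s) (stoneLimit hA s x) := by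
    funext t
    rw [← stoneLimit_add, sub_add_cancel]
  rw [h1]
  have h2 := h0 (stoneLimit hA s x)
  rw [← sub_self s] at h2
  exact ContinuousAt.comp (f := fun t => t - s) h2 (by fun_prop)

theorem exists_isUnitaryGroupOf (hA : IsSelfAdjoint A) :
    ∃ U : ℝ → (E ≃ₗᵢ[ℂ] E), IsUnitaryGroupOf A U := by
  refine ⟨fun t => LinearIsometryEquiv.ofSurjective (stoneIsometry hA t) fun y =>
    ⟨stoneLimit hA (-t) y, ?_⟩, stoneLimit_zero hA, stoneLimit_add hA, continuous_stoneLimit hA,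
    hasDerivAt_stoneLimit hA⟩
  change stoneLimit hA t (stoneLimit hA (-t) y) = y
  rw [← stoneLimit_add, add_neg_cancel, stoneLimit_zero]

theorem isUnitaryGroupOf_unitaryGroup (hA : IsSelfAdjoint A) :
    IsUnitaryGroupOf A (unitaryGroup A) := by
  have h := exists_isUnitaryGroupOf hA
  rw [unitaryGroup, dif_pos h]
  exact h.choose_spec

/-! ### Invariance of the domain, uniqueness of solutions, commuting operators -/

namespace IsUnitaryGroupOf

variable {U : ℝ → (E ≃ₗᵢ[ℂ] E)}

theorem apply_neg_apply (hU : IsUnitaryGroupOf A U) (t : ℝ) (x : E) : U t (U (-t) x) = x := by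
  rw [← hU.map_add, add_neg_cancel, hU.map_zero]

theorem neg_apply_apply (hU : IsUnitaryGroupOf A U) (t : ℝ) (x : E) : U (-t) (U t x) = x := by
  rw [← hU.map_add, neg_add_cancel, hU.map_zero]

theorem hasDerivAt_of_mem_graph (hU : IsUnitaryGroupOf A U) {x x' : E} (hx : (x, x') ∈ A.graph)
    (t : ℝ) : HasDerivAt (fun s => U s x) (U t (-(I • x'))) t := by
  obtain ⟨y, rfl, rfl⟩ := (LinearPMap.mem_graph_iff A).1 hx
  have h1 : (fun s => U s y) = fun s => U t (U (s - t) y) := by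
    funext s
    rw [← hU.map_add, add_sub_cancel]
  rw [h1]
  have h2 := hU.hasDerivAt y
  rw [← sub_self t] at h2
  have h3 : HasDerivAt (fun s => U (s - t) (y : E)) (-(I • A y)) t := by
    have h4 := HasDerivAt.scomp (h := fun s => s - t) t h2 ((hasDerivAt_id' t).sub_const t)
    rwa [one_smul] at h4
  exact ((U t).toContinuousLinearEquiv.toContinuousLinearMap.restrictScalars ℝ).hasFDerivAt
    |>.comp_hasDerivAt t h3

theorem hasDerivAt_apply (hU : IsUnitaryGroupOf A U) {x x' : E} (hx : (x, x') ∈ A.graph)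
    (t : ℝ) : HasDerivAt (fun s => U s x) (-(I • U t x')) t := by
  rw [← map_smul, ← map_neg]
  exact hU.hasDerivAt_of_mem_graph hx t

theorem inner_apply_left (hU : IsUnitaryGroupOf A U) (t : ℝ) (x y : E) :
    inner ℂ (U t x) y = inner ℂ x (U (-t) y) := by
  rw [← (U (-t)).inner_map_map, hU.neg_apply_apply]

/-- The domain of a self-adjoint operator is invariant under its unitary group. -/
theorem mem_graph (hA : IsSelfAdjoint A) (hU : IsUnitaryGroupOf A U) {x x' : E}
    (hx : (x, x') ∈ A.graph) (t : ℝ) : (U t x, U t x') ∈ A.graph := by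
  refine mem_graph_of_forall_inner hA fun y hy => ?_
  -- The function s ↦ ⟨y, U_s x⟩ is differentiated in two ways, with the group acting on x and,
  -- through its adjoint, on y. Comparing gives ⟨Ay, U_t x⟩ = ⟨y, U_t Ax⟩, so U_t x is in the domain
  -- of A* = A.
  have h1 : HasDerivAt (fun s => inner ℂ y.1 (U s x)) (inner ℂ y.1 (U t (-(I • x')))) t := by
    simpa using (hasDerivAt_const t y.1).inner ℂ (hU.hasDerivAt_of_mem_graph hx t)
  have h2 : HasDerivAt (fun s => inner ℂ (U (-s) y.1) x)
      (inner ℂ (U (-t) (I • y.2)) x) t := by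
    have h3 := (hU.hasDerivAt_of_mem_graph (x := y.1) (x' := y.2) hy (-t)).scomp t (hasDerivAt_neg t)
    have h4 : HasDerivAt (fun s => U (-s) y.1) (U (-t) (I • y.2)) t := by
      refine h3.congr_deriv ?_
      simp
    simpa only [inner_zero_right, zero_add] using h4.inner ℂ (hasDerivAt_const t x)
  have h5 : (fun s => inner ℂ (U (-s) y.1) x) = fun s => inner ℂ y.1 (U s x) := by
    funext s
    rw [hU.inner_apply_left, neg_neg]
  rw [h5, hU.inner_apply_left, neg_neg] at h2
  have h6 := h2.unique h1
  rw [inner_smul_left, map_neg, map_smul, inner_neg_right, inner_smul_right, conj_I] at h6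
  have h7 : I * (inner ℂ y.2 (U t x) - inner ℂ y.1 (U t x')) = 0 := by linear_combination -h6
  exact sub_eq_zero.1 ((mul_eq_zero.1 h7).resolve_left I_ne_zero)

/-- A strong solution of the Schrödinger equation is given by the unitary group. -/
theorem eq_of_hasDerivAt (hU : IsUnitaryGroupOf A U) {ψ ψ' : ℝ → E}
    (hψ : ∀ t, (ψ t, ψ' t) ∈ A.graph) (h : ∀ t, HasDerivAt ψ (-(I • ψ' t)) t) (t : ℝ) :
    ψ t = U t (ψ 0) := by
  have h1 : ∀ t, HasDerivAt (fun s => U (-s) (ψ s)) 0 t := by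
    intro t
    have h2 : HasDerivAt (fun s => U (-s) (ψ t)) (U (-t) (I • ψ' t)) t := by
      refine ((hU.hasDerivAt_of_mem_graph (hψ t) (-t)).scomp t (hasDerivAt_neg t)).congr_deriv ?_
      simp
    -- The group is only strongly continuous, so the product rule is done by hand: ψ(s) is split
    -- into ψ(t), which lies in the domain, and ψ(s) - ψ(t), which vanishes at s = t and whose slope
    -- is U(-s) applied to the slope of ψ. The two derivatives cancel.
    have h3 : HasDerivAt (fun s => U (-s) (ψ s - ψ t)) (U (-t) (-(I • ψ' t))) t := by
      have h4 := (h t)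
      rw [hasDerivAt_iff_tendsto_slope] at h4 ⊢
      have h5 : ∀ s, slope (fun s => U (-s) (ψ s - ψ t)) t s = U (-s) (slope ψ t s) := fun s => by
        have hr : ∀ (r : ℝ) (z : E), U (-s) (r • z) = r • U (-s) z := fun r z =>
          (U (-s)).toLinearEquiv.toLinearMap.map_smul_of_tower r z
        simp [slope_def_module, hr]
      simp only [funext h5]
      have h6 : Tendsto (fun s => U (-s) (-(I • ψ' t))) (𝓝[≠] t) (𝓝 (U (-t) (-(I • ψ' t)))) :=
        (((hU.continuous (-(I • ψ' t))).comp continuous_neg).tendsto t).mono_left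
          nhdsWithin_le_nhds
      have h7 : Tendsto (fun s => U (-s) (slope ψ t s - -(I • ψ' t))) (𝓝[≠] t) (𝓝 0) := by
        rw [tendsto_zero_iff_norm_tendsto_zero]
        simp only [LinearIsometryEquiv.norm_map]
        exact tendsto_iff_norm_sub_tendsto_zero.1 h4
      refine (by simpa using h7.add h6 : Tendsto _ _ _).congr fun s => ?_
      simp
    refine (h3.add h2).congr_of_eventuallyEq (Eventually.of_forall fun s => ?_) |>.congr_deriv ?_
    · simp
    · simp
  have h2 := is_const_of_deriv_eq_zero (fun t => (h1 t).differentiableAt)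
    (fun t => (h1 t).deriv) t 0
  simp only [neg_zero, hU.map_zero] at h2
  rw [← h2, hU.apply_neg_apply]

/-- A bounded operator which commutes with a self-adjoint operator commutes with its unitary
group. -/
theorem map_apply_of_mapsTo_graph (hA : IsSelfAdjoint A) (hU : IsUnitaryGroupOf A U)
    (W : E →L[ℂ] E) (hW : ∀ x ∈ A.graph, (W x.1, W x.2) ∈ A.graph) (t : ℝ) (x : E) :
    W (U t x) = U t (W x) := by
  have hc : ∀ s, Continuous (U s) := fun s => (U s).continuous
  refine hA.dense_domain.induction (P := fun x => W (U t x) = U t (W x)) (fun x hx => ?_)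
    (isClosed_eq (W.continuous.comp (hc t)) ((hc t).comp W.continuous)) x
  have hx' := A.mem_graph ⟨x, hx⟩
  have h := hU.eq_of_hasDerivAt (ψ := fun s => W (U s x)) (ψ' := fun s => W (U s (A ⟨x, hx⟩)))
    (fun s => hW _ (hU.mem_graph hA hx' s)) (fun s => ?_) t
  · rwa [hU.map_zero] at h
  · refine ((W.restrictScalars ℝ).hasFDerivAt.comp_hasDerivAt s
      (hU.hasDerivAt_of_mem_graph hx' s)).congr_deriv ?_
    simp

end IsUnitaryGroupOf

end Stone

/-! ## The graph of the Hamiltonian -/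

section HamiltonianGraph

variable {N : ℕ} {m : Fin N → ℝ} {V : Config N → ℝ}

/-- A self-adjoint closure is in particular a closed extension, so closability needs no separate
assumption. -/
theorem graph_closure_hamiltonian (h : IsSelfAdjoint (hamiltonian m V).closure) :
    (hamiltonian m V).closure.graph = (hamGraph m V).topologicalClosure := by
  have hc : (hamiltonian m V).IsClosable :=
    (LinearPMap.isClosable_iff_exists_closed_extension).2
      ⟨_, h.isClosed, LinearPMap.le_closure _⟩
  rw [← hc.graph_closure_eq_closure_graph, hamiltonian_graph]

theorem isUnitaryGroupOf_evolution (h : IsSelfAdjoint (hamiltonian m V).closure) :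
    IsUnitaryGroupOf (hamiltonian m V).closure (evolution m V) :=
  isUnitaryGroupOf_unitaryGroup h

/-- A bounded operator which maps the graph of the Hamiltonian on the test functions to itself
commutes with the time evolution. -/
theorem evolution_comm (h : IsSelfAdjoint (hamiltonian m V).closure) (W : L2 N →L[ℂ] L2 N)
    (hW : ∀ p ∈ hamGraph m V, (W p.1, W p.2) ∈ hamGraph m V) (t : ℝ) (ψ : L2 N) :
    W (evolution m V t ψ) = evolution m V t (W ψ) := by
  refine (isUnitaryGroupOf_evolution h).map_apply_of_mapsTo_graph h W ?_ t ψ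
  rw [graph_closure_hamiltonian h]
  intro x hx
  have hc : Continuous fun x : L2 N × L2 N => (W x.1, W x.2) := by fun_prop
  exact map_mem_closure (f := fun x : L2 N × L2 N => (W x.1, W x.2)) hc hx hW

end HamiltonianGraph

/-! ## Jacobi coordinates -/

section Jacobi

variable {N : ℕ} {m : Fin N → ℝ}

/-- The position `k` of the `k`-th Jacobi coordinate among all particles. -/
def jacobiIndex (k : Fin (N - 1)) : Fin N := k.castLE (Nat.sub_le N 1)

/-- The coefficients of the Jacobi coordinates. -/
def jacobiCoeff (m : Fin N → ℝ) (k : Fin (N - 1)) (l : Fin N) : ℝ :=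
  if l = jacobiIndex k then 1 else if jacobiIndex k < l then -((tailMass m k)⁻¹ * m l) else 0

theorem sum_jacobiCoeff_smul {F : Type*} [AddCommGroup F] [Module ℝ F] (m : Fin N → ℝ)
    (k : Fin (N - 1)) (w : Fin N → F) :
    ∑ l, jacobiCoeff m k l • w l = w (jacobiIndex k) - (tailMass m k)⁻¹ •
      ∑ l ∈ Finset.univ.filter (fun l => jacobiIndex k < l), m l • w l := by
  have h : ∀ l, jacobiCoeff m k l • w l = (if l = jacobiIndex k then w l else 0)
      - (tailMass m k)⁻¹ • (if jacobiIndex k < l then m l • w l else 0) := by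
    intro l
    unfold jacobiCoeff
    by_cases h1 : l = jacobiIndex k
    · subst h1; simp
    · by_cases h2 : jacobiIndex k < l
      · simp [h1, h2, smul_smul]
      · simp [h1, h2]
  simp only [h, Finset.sum_sub_distrib, Finset.sum_ite_eq', Finset.mem_univ, if_true,
    ← Finset.smul_sum, ← Finset.sum_filter]

theorem jacobi_eq_sum (m : Fin N → ℝ) (x : Config N) (k : Fin (N - 1)) :
    jacobi m x k = ∑ l, jacobiCoeff m k l • x l :=
  (sum_jacobiCoeff_smul m k x).symm

theorem tailMass_pos (hm : ∀ k, 0 < m k) (k : Fin (N - 1)) : 0 < tailMass m k := by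
  -- The index k + 1 is available because k < N - 1: every Jacobi coordinate has a particle behind
  -- it.
  refine Finset.sum_pos (fun j _ => hm j) ⟨⟨k + 1, by have := k.2; omega⟩, ?_⟩
  simp [Fin.lt_def]

theorem sum_jacobiCoeff (hm : ∀ k, 0 < m k) (k : Fin (N - 1)) : ∑ l, jacobiCoeff m k l = 0 := by
  have h := sum_jacobiCoeff_smul m k (fun _ => (1 : ℝ))
  simp only [smul_eq_mul, mul_one] at h
  rw [h]
  change 1 - (tailMass m k)⁻¹ * tailMass m k = 0
  rw [inv_mul_cancel₀ (tailMass_pos hm k).ne', sub_self]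

theorem jacobiCoeff_of_lt {k : Fin (N - 1)} {l : Fin N} (h : l < jacobiIndex k) :
    jacobiCoeff m k l = 0 := by
  rw [jacobiCoeff, if_neg h.ne, if_neg h.not_gt]

theorem jacobiCoeff_self (k : Fin (N - 1)) : jacobiCoeff m k (jacobiIndex k) = 1 := if_pos rfl

theorem sum_filter_jacobiCoeff (hm : ∀ k, 0 < m k) (k : Fin (N - 1)) :
    ∑ l ∈ Finset.univ.filter (fun l => jacobiIndex k < l), jacobiCoeff m k l = -1 := by
  have h : ∑ l ∈ Finset.univ.filter (fun l => jacobiIndex k < l), jacobiCoeff m k l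
      = ∑ l, (jacobiCoeff m k l - if l = jacobiIndex k then 1 else 0) := by
    rw [Finset.sum_filter]
    refine Finset.sum_congr rfl fun l _ => ?_
    rcases lt_trichotomy l (jacobiIndex k) with h1 | h1 | h1
    · rw [if_neg h1.not_gt, if_neg h1.ne, jacobiCoeff_of_lt h1, sub_zero]
    · subst h1; simp [jacobiCoeff_self]
    · rw [if_pos h1, if_neg h1.ne', sub_zero]
  rw [h, Finset.sum_sub_distrib, sum_jacobiCoeff hm]
  simp

/-- The later coordinate involves only particles behind k, and on these the coefficient of y_k is
proportional to m_l. The masses cancel, leaving a multiple of the total of the coefficients of the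
later coordinate, which is zero. -/
theorem sum_jacobiCoeff_mul_of_lt (hm : ∀ k, 0 < m k) {k k' : Fin (N - 1)} (h : k < k') :
    ∑ l, jacobiCoeff m k l * (jacobiCoeff m k' l * (m l)⁻¹) = 0 := by
  have hlt : jacobiIndex k < jacobiIndex k' := h
  have h1 := sum_jacobiCoeff_smul m k (fun l => jacobiCoeff m k' l * (m l)⁻¹)
  simp only [smul_eq_mul] at h1
  rw [h1, jacobiCoeff_of_lt hlt]
  have h2 : ∑ l ∈ Finset.univ.filter (fun l => jacobiIndex k < l),
      m l * (jacobiCoeff m k' l * (m l)⁻¹) = ∑ l, jacobiCoeff m k' l := by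
    rw [Finset.sum_filter]
    refine Finset.sum_congr rfl fun l _ => ?_
    split_ifs with h3
    · have := (hm l).ne'
      field_simp
    · rw [jacobiCoeff_of_lt (lt_of_le_of_lt (not_lt.1 h3) hlt)]
  rw [h2, sum_jacobiCoeff hm]
  simp

/-- Particle k contributes 1/m_k and the particles behind it 1/`tailMass m k`; the sum is the
inverse reduced mass. -/
theorem sum_jacobiCoeff_mul_self (hm : ∀ k, 0 < m k) (k : Fin (N - 1)) :
    ∑ l, jacobiCoeff m k l * (jacobiCoeff m k l * (m l)⁻¹) = (reducedMass m k)⁻¹ := by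
  have h1 := sum_jacobiCoeff_smul m k (fun l => jacobiCoeff m k l * (m l)⁻¹)
  simp only [smul_eq_mul] at h1
  rw [h1, jacobiCoeff_self]
  have h2 : ∑ l ∈ Finset.univ.filter (fun l => jacobiIndex k < l),
      m l * (jacobiCoeff m k l * (m l)⁻¹)
      = ∑ l ∈ Finset.univ.filter (fun l => jacobiIndex k < l), jacobiCoeff m k l := by
    refine Finset.sum_congr rfl fun l _ => ?_
    have := (hm l).ne'
    field_simp
  rw [h2, sum_filter_jacobiCoeff hm]
  have h3 := (tailMass_pos hm k).ne'
  have h4 := (hm (jacobiIndex k)).ne'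
  have h5 : reducedMass m k = m (jacobiIndex k) * tailMass m k
    / (m (jacobiIndex k) + tailMass m k) := rfl
  rw [h5]
  field_simp
  ring

theorem reducedMass_pos (hm : ∀ k, 0 < m k) (k : Fin (N - 1)) : 0 < reducedMass m k :=
  div_pos (mul_pos (hm _) (tailMass_pos hm k)) (add_pos (hm _) (tailMass_pos hm k))

/-- The coefficients of the centre of mass (index `none`) and of the Jacobi coordinates. -/
def jacobiMatrix (m : Fin N → ℝ) (a : Option (Fin (N - 1))) (l : Fin N) : ℝ :=
  a.elim ((∑ j, m j)⁻¹ * m l) (fun k => jacobiCoeff m k l)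

/-- The total mass (index `none`) and the reduced masses. -/
def jacobiMass (m : Fin N → ℝ) (a : Option (Fin (N - 1))) : ℝ :=
  a.elim (∑ j, m j) (reducedMass m)

theorem jacobiMass_pos (hN : 1 ≤ N) (hm : ∀ k, 0 < m k) (a : Option (Fin (N - 1))) :
    0 < jacobiMass m a := by
  cases a with
  | none => exact Finset.sum_pos (fun j _ => hm j) ⟨⟨0, hN⟩, Finset.mem_univ _⟩
  | some k => exact reducedMass_pos hm k

/-- Orthogonality of the centre of mass and the Jacobi coordinates. -/
theorem sum_jacobiMatrix_mul (hN : 1 ≤ N) (hm : ∀ k, 0 < m k) (a b : Option (Fin (N - 1))) :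
    ∑ l, jacobiMatrix m a l * (jacobiMatrix m b l * (m l)⁻¹)
      = if a = b then (jacobiMass m a)⁻¹ else 0 := by
  have hM : (∑ j, m j) ≠ 0 := (jacobiMass_pos hN hm none).ne'
  have hnone : ∀ k, ∑ l, jacobiCoeff m k l * (((∑ j, m j)⁻¹ * m l) * (m l)⁻¹) = 0 := by
    intro k
    have : ∀ l, jacobiCoeff m k l * (((∑ j, m j)⁻¹ * m l) * (m l)⁻¹)
        = (∑ j, m j)⁻¹ * jacobiCoeff m k l := fun l => by
      have := (hm l).ne'
      field_simp
    simp only [this, ← Finset.mul_sum, sum_jacobiCoeff hm, mul_zero]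
  cases a with
  | none =>
    cases b with
    | none =>
      have : ∀ l, ((∑ j, m j)⁻¹ * m l) * (((∑ j, m j)⁻¹ * m l) * (m l)⁻¹)
          = ((∑ j, m j)⁻¹ * (∑ j, m j)⁻¹) * m l := fun l => by
        have := (hm l).ne'
        field_simp
      simp only [jacobiMatrix, jacobiMass, Option.elim, this, ← Finset.mul_sum, if_true]
      field_simp
    | some k =>
      rw [if_neg (by simp), ← hnone k]
      refine Finset.sum_congr rfl fun l _ => ?_
      simp only [jacobiMatrix, Option.elim]
      ring
  | some k =>
    cases b with
    | none => rw [if_neg (by simp)]; exact hnone k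
    | some k' =>
      simp only [jacobiMatrix, jacobiMass, Option.elim, Option.some.injEq]
      rcases lt_trichotomy k k' with h | h | h
      · rw [if_neg h.ne, sum_jacobiCoeff_mul_of_lt hm h]
      · subst h; rw [if_pos rfl, sum_jacobiCoeff_mul_self hm]
      · rw [if_neg h.ne', ← sum_jacobiCoeff_mul_of_lt hm h]
        exact Finset.sum_congr rfl fun l _ => by ring

/-- Orthogonality exhibits a right inverse of the coordinate matrix. That matrix is square, as 1 +
(N - 1) = N for N ≥ 1, so the inverse is two-sided; this order of the product recovers the x_l from
(X, y). -/
theorem sum_jacobiMatrix_mul_jacobiMatrix (hN : 1 ≤ N) (hm : ∀ k, 0 < m k) (l l' : Fin N) :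
    ∑ a, (m l)⁻¹ * jacobiMatrix m a l * jacobiMass m a * jacobiMatrix m a l'
      = if l = l' then 1 else 0 := by
  have h1 : (Matrix.of fun a l => jacobiMatrix m a l) *
      (Matrix.of fun (l : Fin N) a => (m l)⁻¹ * jacobiMatrix m a l * jacobiMass m a) = 1 := by
    ext a b
    rw [Matrix.mul_apply, Matrix.one_apply]
    have h2 : ∀ l, jacobiMatrix m a l * ((m l)⁻¹ * jacobiMatrix m b l * jacobiMass m b)
        = (jacobiMatrix m a l * (jacobiMatrix m b l * (m l)⁻¹)) * jacobiMass m b :=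
      fun l => by ring
    simp only [Matrix.of_apply, h2]
    rw [← Finset.sum_mul, sum_jacobiMatrix_mul hN hm]
    split_ifs with h
    · rw [h, inv_mul_cancel₀ (jacobiMass_pos hN hm b).ne']
    · rw [zero_mul]
  replace h1 := (Matrix.mul_eq_one_comm_of_card_eq _ _ _
    (by rw [Fintype.card_option, Fintype.card_fin, Fintype.card_fin]; omega)).1 h1
  have h2 := congrFun (congrFun h1 l) l'
  rwa [Matrix.mul_apply, Matrix.one_apply] at h2

/-- The coordinates `(X, y)` as a linear map. -/
def jacobiMap (m : Fin N → ℝ) : Config N →ₗ[ℝ] E3 × Config (N - 1) where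
  toFun x := (centreOfMass m x, jacobi m x)
  map_add' x y := by
    refine Prod.ext ?_ (funext fun k => ?_)
    · simp [centreOfMass, Finset.sum_add_distrib]
    · simp [jacobi_eq_sum, Finset.sum_add_distrib]
  map_smul' c x := by
    refine Prod.ext ?_ (funext fun k => ?_)
    · simp only [centreOfMass, Pi.smul_apply, RingHom.id_apply, Prod.smul_fst, Finset.smul_sum]
      exact Finset.sum_congr rfl fun l _ => by module
    · simp only [jacobi_eq_sum, Pi.smul_apply, RingHom.id_apply, Prod.smul_snd, Finset.smul_sum]
      exact Finset.sum_congr rfl fun l _ => by module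

/-- The component of the coordinates `(X, y)` with index `none` or `some k`. -/
def jacobiComp (p : E3 × Config (N - 1)) (a : Option (Fin (N - 1))) : E3 := a.elim p.1 p.2

theorem jacobiComp_jacobiMap (m : Fin N → ℝ) (x : Config N) (a : Option (Fin (N - 1))) :
    jacobiComp (jacobiMap m x) a = ∑ l, jacobiMatrix m a l • x l := by
  cases a with
  | none =>
    change centreOfMass m x = _
    simp only [centreOfMass, jacobiMatrix, Option.elim, Finset.smul_sum, smul_smul]
  | some k => exact jacobi_eq_sum m x k

theorem injective_jacobiMap (hN : 1 ≤ N) (hm : ∀ k, 0 < m k) :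
    Function.Injective (jacobiMap m) := by
  have key : ∀ x l, x l = ∑ a, ((m l)⁻¹ * jacobiMatrix m a l * jacobiMass m a) •
      jacobiComp (jacobiMap m x) a := by
    intro x l
    simp only [jacobiComp_jacobiMap, Finset.smul_sum, smul_smul]
    rw [Finset.sum_comm]
    simp only [← Finset.sum_smul, sum_jacobiMatrix_mul_jacobiMatrix hN hm, ite_smul, one_smul,
      zero_smul, Finset.sum_ite_eq, Finset.mem_univ, if_true]
  intro x y h
  funext l
  rw [key x l, key y l, h]

/-- The change to the coordinates `(X, y)`. -/
def jacobiEquiv (hN : 1 ≤ N) (hm : ∀ k, 0 < m k) : Config N ≃L[ℝ] E3 × Config (N - 1) :=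
  (LinearEquiv.ofBijective (jacobiMap m) ⟨injective_jacobiMap hN hm,
    (LinearMap.injective_iff_surjective_of_finrank_eq_finrank (by
      obtain ⟨n, rfl⟩ := Nat.exists_eq_add_of_le' hN
      simp [Config, Module.finrank_pi_fintype]; ring)).1
        (injective_jacobiMap hN hm)⟩).toContinuousLinearEquiv

theorem jacobiEquiv_apply (hN : 1 ≤ N) (hm : ∀ k, 0 < m k) (x : Config N) :
    jacobiEquiv hN hm x = (centreOfMass m x, jacobi m x) := rfl

instance isAddHaarMeasure_prod_config (n : ℕ) :
    (volume : Measure (E3 × Config n)).IsAddHaarMeasure :=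
  Measure.prod.instIsAddHaarMeasure _ _

instance isAddHaarMeasure_map_jacobiEquiv (hN : 1 ≤ N) (hm : ∀ k, 0 < m k) :
    (Measure.map (jacobiEquiv hN hm) volume).IsAddHaarMeasure :=
  AddEquiv.isAddHaarMeasure_map _ (jacobiEquiv hN hm).toLinearEquiv.toAddEquiv
    (jacobiEquiv hN hm).continuous (jacobiEquiv hN hm).symm.continuous

/-- Uniqueness of Haar measure replaces a computation of the Jacobian; its value plays no role. -/
theorem exists_map_jacobiEquiv (hN : 1 ≤ N) (hm : ∀ k, 0 < m k) :
    ∃ c : NNReal, c ≠ 0 ∧ Measure.map (jacobiEquiv hN hm) volume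
      = c • (volume : Measure (E3 × Config (N - 1))) :=
  ⟨_, (Measure.addHaarScalarFactor_pos_of_isAddHaarMeasure _ _).ne',
    Measure.isAddLeftInvariant_eq_smul _ _⟩

theorem quasiMeasurePreserving_jacobiEquiv (hN : 1 ≤ N) (hm : ∀ k, 0 < m k) :
    Measure.QuasiMeasurePreserving (jacobiEquiv hN hm) volume volume := by
  obtain ⟨c, _, hc⟩ := exists_map_jacobiEquiv hN hm
  refine ⟨(jacobiEquiv hN hm).continuous.measurable, ?_⟩
  rw [hc]
  exact Measure.smul_absolutelyContinuous

/-- Configurations with equal Jacobi coordinates differ by a common translation, namely the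
difference of their centres of mass. So V factors through `jacobi m`, and `Function.extend` returns
its value rather than the default 0. -/
theorem internalPotential_jacobi (hN : 1 ≤ N) (hm : ∀ k, 0 < m k) {V : Config N → ℝ}
    (hV : ∀ (b : E3) (x : Config N), V (fun k => x k + b) = V x) (x : Config N) :
    internalPotential m V (jacobi m x) = V x := by
  refine Function.FactorsThrough.extend_apply (fun x y hxy => ?_) _ x
  have h1 : x = fun k => y k + (centreOfMass m x - centreOfMass m y) := by
    refine injective_jacobiMap hN hm ?_
    have h2 : jacobiMap m (fun _ => centreOfMass m x - centreOfMass m y)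
        = (centreOfMass m x - centreOfMass m y, 0) := by
      refine Prod.ext ?_ (funext fun k => ?_)
      · change centreOfMass m _ = _
        rw [centreOfMass, ← Finset.sum_smul, smul_smul,
          inv_mul_cancel₀ (show (∑ j, m j) ≠ 0 from (jacobiMass_pos hN hm none).ne'), one_smul]
      · change jacobi m (fun _ => centreOfMass m x - centreOfMass m y) k = 0
        rw [jacobi_eq_sum, ← Finset.sum_smul, sum_jacobiCoeff hm, zero_smul]
    have h3 := (jacobiMap m).map_add y (fun _ => centreOfMass m x - centreOfMass m y)
    rw [h2] at h3
    refine Eq.trans ?_ h3.symm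
    refine Prod.ext ?_ ?_
    · change centreOfMass m x = centreOfMass m y + (centreOfMass m x - centreOfMass m y)
      rw [add_sub_cancel]
    · change jacobi m x = jacobi m y + 0
      rw [hxy, add_zero]
  rw [h1, hV]

end Jacobi

/-! ## Second derivatives and Laplacians -/

section SecondDerivative

variable {E F : Type*} [NormedAddCommGroup E] [NormedSpace ℝ E] [NormedAddCommGroup F]
  [NormedSpace ℝ F]

theorem fderiv_fderiv_comp_affine {φ : F → ℂ} (hφ : ContDiff ℝ 2 φ) (c : F) (L : E →L[ℝ] F)
    (x u v : E) : fderiv ℝ (fderiv ℝ fun y => φ (c + L y)) x u v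
      = fderiv ℝ (fderiv ℝ φ) (c + L x) (L u) (L v) := by
  have h0 : ∀ y, HasFDerivAt (fun y => c + L y) L y := fun y => L.hasFDerivAt.const_add c
  have h1 : (fderiv ℝ fun y => φ (c + L y)) = fun y => (fderiv ℝ φ (c + L y)).comp L := by
    funext y
    exact (((hφ.differentiable (by norm_num)) _).hasFDerivAt.comp y (h0 y)).fderiv
  have h2 : Differentiable ℝ (fderiv ℝ φ) :=
    (hφ.fderiv_right (m := 1) (by norm_num)).differentiable (by norm_num)
  have h3 : HasFDerivAt (fun y => fderiv ℝ φ (c + L y))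
      ((fderiv ℝ (fderiv ℝ φ) (c + L x)).comp L) x := (h2 _).hasFDerivAt.comp x (h0 x)
  have h4 := (((ContinuousLinearMap.compL ℝ E F ℂ).flip L).hasFDerivAt.comp x h3).fderiv
  rw [h1]
  exact congrFun (congrArg DFunLike.coe (congrFun (congrArg DFunLike.coe h4) u)) v

theorem fderiv_fderiv_const_mul {f : E → ℂ} (hf : ContDiff ℝ 2 f) (c : ℂ) (x u v : E) :
    fderiv ℝ (fderiv ℝ fun y => c * f y) x u v = c * fderiv ℝ (fderiv ℝ f) x u v := by
  have h1 : (fderiv ℝ fun y => c * f y) = fun y => c • fderiv ℝ f y := by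
    funext y
    exact fderiv_const_mul (hf.differentiable (by norm_num) y) c
  have h2 : Differentiable ℝ (fderiv ℝ f) :=
    (hf.fderiv_right (m := 1) (by norm_num)).differentiable (by norm_num)
  rw [h1, fderiv_fun_const_smul (h2 x)]
  rfl

theorem laplacian_eq_sum_fderiv {E : Type*} [NormedAddCommGroup E] [InnerProductSpace ℝ E]
    [FiniteDimensional ℝ E] {ι : Type*} [Fintype ι] (b : OrthonormalBasis ι ℝ E) (f : E → ℂ)
    (x : E) : Laplacian.laplacian f x = ∑ i, fderiv ℝ (fderiv ℝ f) x (b i) (b i) := by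
  rw [InnerProductSpace.laplacian_eq_iteratedFDeriv_orthonormalBasis f b]
  simp [iteratedFDeriv_two_apply]

end SecondDerivative

/-- With Δ_k a trace of the full Hessian over directions moving only particle k, linear changes of
coordinates become bilinear algebra. The orthonormal basis is left free so that a rotation can be
absorbed into it. -/
theorem particleLaplacian_eq_sum {N : ℕ} {ι : Type*} [Fintype ι] (b : OrthonormalBasis ι ℝ E3)
    {φ : Config N → ℂ} (hφ : ContDiff ℝ 2 φ) (k : Fin N) (x : Config N) :
    particleLaplacian k φ x
      = ∑ i, fderiv ℝ (fderiv ℝ φ) x (Pi.single k (b i)) (Pi.single k (b i)) := by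
  have h1 : ∀ y, Function.update x k y
      = Function.update x k 0 + ContinuousLinearMap.single ℝ (fun _ : Fin N => E3) k y := by
    intro y
    funext l
    rcases eq_or_ne l k with rfl | h
    · simp
    · simp [h]
  have h0 : (fun y => φ (Function.update x k y)) = fun y => φ (Function.update x k 0
      + ContinuousLinearMap.single ℝ (fun _ : Fin N => E3) k y) := funext fun y => congrArg φ (h1 y)
  rw [particleLaplacian, laplacian_eq_sum_fderiv b, h0]
  have h2 : Function.update x k 0
      + ContinuousLinearMap.single ℝ (fun _ : Fin N => E3) k (x k) = x := by
    rw [← h1, Function.update_eq_self]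
  refine Finset.sum_congr rfl fun i _ => ?_
  rw [fderiv_fderiv_comp_affine hφ, h2]
  rfl

theorem hasDerivAt_bilinear {E F G : Type*} [NormedAddCommGroup E] [NormedSpace ℂ E]
    [NormedAddCommGroup F] [NormedSpace ℂ F] [NormedAddCommGroup G] [NormedSpace ℂ G]
    (B : E →L[ℂ] F →L[ℂ] G) {f : ℝ → E} {g : ℝ → F} {f' : E} {g' : F} {t : ℝ}
    (hf : HasDerivAt f (-(Complex.I • f')) t) (hg : HasDerivAt g (-(Complex.I • g')) t) :
    HasDerivAt (fun s => B (f s) (g s)) (-(Complex.I • (B f' (g t) + B (f t) g'))) t := by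
  have h := (B.bilinearRestrictScalars ℝ).hasDerivAt_of_bilinear (fun _ => hf) (fun _ => hg)
  refine h.congr_deriv ?_
  simp only [ContinuousLinearMap.bilinearRestrictScalars_apply_apply, map_neg, map_smul,
    neg_apply, smul_apply, smul_add, neg_add]
  rw [add_comm]

/-! ## Product functions in the coordinates `(X, y)` -/

section Tensor

variable {N : ℕ} {m : Fin N → ℝ}

/-- The kinetic energy `P² / (2M)` of the centre of mass as a differential expression. -/
def kinExpr (M : ℝ) (f : E3 → ℂ) (x : E3) : ℂ := (1 / (2 * M) : ℂ) * -Laplacian.laplacian f x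

/-- The direction in the coordinates `(X, y)` with component `v` at the index `a`. -/
def jacobiDir {n : ℕ} (a : Option (Fin n)) (v : E3) : E3 × Config n :=
  a.elim (v, 0) (fun k => (0, Pi.single k v))

theorem jacobiMap_single (m : Fin N → ℝ) (k : Fin N) (v : E3) :
    jacobiMap m (Pi.single k v) = ∑ a, jacobiMatrix m a k • jacobiDir a v := by
  have h1 := jacobiComp_jacobiMap m (Pi.single k v)
  have h2 : ∀ a, jacobiComp (jacobiMap m (Pi.single k v)) a = jacobiMatrix m a k • v := by
    intro a
    rw [h1, Finset.sum_eq_single k]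
    · rw [Pi.single_eq_same]
    · intro l _ hl
      rw [Pi.single_eq_of_ne hl, smul_zero]
    · simp
  rw [Fintype.sum_option]
  refine Prod.ext ?_ (funext fun l => ?_)
  · rw [Prod.fst_add, Prod.fst_sum]
    simpa [jacobiDir, jacobiComp] using h2 none
  · rw [Prod.snd_add, Prod.snd_sum]
    have := h2 (some l)
    simp only [jacobiDir, jacobiComp, Option.elim, Prod.smul_snd, smul_zero, zero_add,
      Finset.sum_apply, Pi.smul_apply] at this ⊢
    rw [this, Finset.sum_eq_single l]
    · rw [Pi.single_eq_same]
    · intro j _ hj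
      rw [Pi.single_eq_of_ne' hj, smul_zero]
    · simp

/-- The kinetic energy is the Hessian contracted with the inverse masses. In the coordinates (X, y)
the contraction is diagonal with entries 1/M and 1/μ_k, so no mixed derivatives of f and h occur,
and V depends on y alone. -/
theorem hamExpr_product (hN : 1 ≤ N) (hm : ∀ k, 0 < m k) {V : Config N → ℝ}
    (hV : ∀ (b : E3) (x : Config N), V (fun k => x k + b) = V x) {f : E3 → ℂ}
    {h : Config (N - 1) → ℂ} (hf : ContDiff ℝ 2 f) (hh : ContDiff ℝ 2 h) (x : Config N) :
    hamExpr m V (fun x => f (centreOfMass m x) * h (jacobi m x)) x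
      = kinExpr (∑ j, m j) f (centreOfMass m x) * h (jacobi m x)
        + f (centreOfMass m x)
          * hamExpr (reducedMass m) (internalPotential m V) h (jacobi m x) := by
  set F : E3 × Config (N - 1) → ℂ := fun p => f p.1 * h p.2
  have hF : ContDiff ℝ 2 F := (hf.comp contDiff_fst).mul (hh.comp contDiff_snd)
  let b := EuclideanSpace.basisFun (Fin 3) ℝ
  let J : Config N →L[ℝ] E3 × Config (N - 1) := jacobiEquiv hN hm
  have hJ : ∀ x, J x = (centreOfMass m x, jacobi m x) := fun x => rfl
  set X := centreOfMass m x
  set y := jacobi m x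
  have hφ : (fun x => f (centreOfMass m x) * h (jacobi m x)) = fun x => F (0 + J x) := by
    funext x
    rw [zero_add, hJ]
  have hφ2 : ContDiff ℝ 2 fun x => F (0 + J x) :=
    hF.comp (contDiff_const.add J.contDiff)
  set B := fderiv ℝ (fderiv ℝ F) (X, y)
  have h1 : ∀ k, particleLaplacian k (fun x => F (0 + J x)) x
      = ∑ i, ∑ a, ∑ a', ((jacobiMatrix m a k * jacobiMatrix m a' k : ℝ) : ℂ)
        * B (jacobiDir a (b i)) (jacobiDir a' (b i)) := by
    intro k
    rw [particleLaplacian_eq_sum b hφ2]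
    refine Finset.sum_congr rfl fun i _ => ?_
    rw [fderiv_fderiv_comp_affine hF, zero_add, hJ]
    have : J (Pi.single k (b i)) = ∑ a, jacobiMatrix m a k • jacobiDir a (b i) :=
      jacobiMap_single m k (b i)
    rw [this]
    simp only [map_sum, map_smul, sum_apply, smul_apply, Finset.smul_sum,
      Complex.real_smul]
    rw [Finset.sum_comm]
    refine Finset.sum_congr rfl fun a _ => Finset.sum_congr rfl fun a' _ => ?_
    push_cast
    ring
  have h2 : ∀ v, B (jacobiDir none v) (jacobiDir none v) = h y * fderiv ℝ (fderiv ℝ f) X v v := by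
    intro v
    have h3 := fderiv_fderiv_comp_affine hF (0, y)
      (ContinuousLinearMap.inl ℝ E3 (Config (N - 1))) X v v
    simp only [ContinuousLinearMap.inl_apply, Prod.mk_add_mk, zero_add, add_zero] at h3
    refine h3.symm.trans ?_
    rw [← fderiv_fderiv_const_mul hf]
    simp only [F, mul_comm]
  have h3 : ∀ l v, B (jacobiDir (some l) v) (jacobiDir (some l) v)
      = f X * fderiv ℝ (fderiv ℝ h) y (Pi.single l v) (Pi.single l v) := by
    intro l v
    have h3 := fderiv_fderiv_comp_affine hF (X, 0) (ContinuousLinearMap.inr ℝ E3 (Config (N - 1)))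
      y (Pi.single l v) (Pi.single l v)
    simp only [ContinuousLinearMap.inr_apply, Prod.mk_add_mk, zero_add, add_zero] at h3
    refine h3.symm.trans ?_
    rw [← fderiv_fderiv_const_mul hh]
  have h4 : ∑ k, (1 / (2 * m k) : ℂ) * -particleLaplacian k (fun x => F (0 + J x)) x
      = ∑ a, (1 / (2 * jacobiMass m a) : ℂ) * -∑ i, B (jacobiDir a (b i)) (jacobiDir a (b i)) := by
    have h5 : ∀ k, (1 / (2 * m k) : ℂ) * -particleLaplacian k (fun x => F (0 + J x)) x
        = ∑ a, ∑ a', ∑ i, ((jacobiMatrix m a k * (jacobiMatrix m a' k * (m k)⁻¹) : ℝ) : ℂ)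
          * (-(1 / 2) * B (jacobiDir a (b i)) (jacobiDir a' (b i))) := by
      intro k
      rw [h1, Finset.sum_comm]
      simp only [Finset.mul_sum, ← Finset.sum_neg_distrib]
      refine Finset.sum_congr rfl fun a _ => ?_
      rw [Finset.sum_comm]
      refine Finset.sum_congr rfl fun a' _ => Finset.sum_congr rfl fun i _ => ?_
      push_cast
      field_simp
    simp only [h5]
    rw [Finset.sum_comm]
    refine Finset.sum_congr rfl fun a _ => ?_
    rw [Finset.sum_comm]
    -- The sum over particles is exactly `sum_jacobiMatrix_mul`, which removes the terms with a ≠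
    -- a'.
    have h6 : ∀ a', ∑ k, ∑ i, ((jacobiMatrix m a k * (jacobiMatrix m a' k * (m k)⁻¹) : ℝ) : ℂ)
          * (-(1 / 2) * B (jacobiDir a (b i)) (jacobiDir a' (b i)))
        = if a = a' then ((jacobiMass m a)⁻¹ : ℂ) * ∑ i, (-(1 / 2) * B (jacobiDir a (b i)) (jacobiDir a' (b i)))
          else 0 := by
      intro a'
      simp only [← Finset.mul_sum]
      rw [← Finset.sum_mul, ← Complex.ofReal_sum, sum_jacobiMatrix_mul hN hm]
      split_ifs <;> simp
    simp only [h6, Finset.sum_ite_eq, Finset.mem_univ, if_true]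
    rw [← Finset.mul_sum]
    field_simp
  rw [hφ]
  have h7 : hamExpr m V (fun x => F (0 + J x)) x
      = (∑ k, (1 / (2 * m k) : ℂ) * -particleLaplacian k (fun x => F (0 + J x)) x)
        + V x * F (0 + J x) := rfl
  rw [h7, h4, Fintype.sum_option, hamExpr, internalPotential_jacobi hN hm hV, kinExpr,
    laplacian_eq_sum_fderiv b]
  simp only [h2, h3, particleLaplacian_eq_sum b hh, ← Finset.mul_sum, zero_add, hJ, F, mul_add]
  have h8 : f X * ∑ l, (1 / (2 * reducedMass m l) : ℂ)
      * -∑ i, fderiv ℝ (fderiv ℝ h) y (Pi.single l (b i)) (Pi.single l (b i))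
      = ∑ l, (1 / (2 * jacobiMass m (some l)) : ℂ)
      * -(f X * ∑ i, fderiv ℝ (fderiv ℝ h) y (Pi.single l (b i)) (Pi.single l (b i))) := by
    rw [Finset.mul_sum]
    refine Finset.sum_congr rfl fun l _ => ?_
    change _ = (1 / (2 * reducedMass m l) : ℂ) * _
    ring
  rw [h8]
  change (1 / (2 * (∑ j, m j : ℝ)) : ℂ) * _ + _ + _ = _
  ring

/-! ### Square-integrable product functions -/

theorem quasiMeasurePreserving_centreOfMass (hN : 1 ≤ N) (hm : ∀ k, 0 < m k) :
    Measure.QuasiMeasurePreserving (centreOfMass m) volume volume :=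
  Measure.quasiMeasurePreserving_fst.comp (quasiMeasurePreserving_jacobiEquiv hN hm)

theorem quasiMeasurePreserving_jacobi (hN : 1 ≤ N) (hm : ∀ k, 0 < m k) :
    Measure.QuasiMeasurePreserving (jacobi m) volume volume :=
  Measure.quasiMeasurePreserving_snd.comp (quasiMeasurePreserving_jacobiEquiv hN hm)

theorem aestronglyMeasurable_product (hN : 1 ≤ N) (hm : ∀ k, 0 < m k)
    (f : Lp ℂ 2 (volume : Measure E3)) (h : L2 (N - 1)) :
    AEStronglyMeasurable (fun x => f (centreOfMass m x) * h (jacobi m x)) volume :=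
  ((Lp.aestronglyMeasurable f).comp_quasiMeasurePreserving
    (quasiMeasurePreserving_centreOfMass hN hm)).mul
    ((Lp.aestronglyMeasurable h).comp_quasiMeasurePreserving (quasiMeasurePreserving_jacobi hN hm))

theorem integrable_inner_Lp {α : Type*} [MeasurableSpace α] {μ : Measure α} (f g : Lp ℂ 2 μ) :
    Integrable (fun x => inner ℂ (f x) (g x)) μ := L2.integrable_inner f g

theorem integrable_comp_jacobiEquiv (hN : 1 ≤ N) (hm : ∀ k, 0 < m k)
    {G : E3 × Config (N - 1) → ℂ} (hG : Integrable G volume) :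
    Integrable (fun x => G (jacobiEquiv hN hm x)) volume := by
  obtain ⟨c, _, hc⟩ := exists_map_jacobiEquiv hN hm
  have h1 : Integrable G (Measure.map (jacobiEquiv hN hm) volume) := by
    rw [hc]
    exact hG.smul_measure_nnreal
  exact h1.comp_measurable (jacobiEquiv hN hm).continuous.measurable

theorem memLp_product (hN : 1 ≤ N) (hm : ∀ k, 0 < m k)
    (f : Lp ℂ 2 (volume : Measure E3)) (h : L2 (N - 1)) :
    MemLp (fun x => f (centreOfMass m x) * h (jacobi m x)) 2 volume := by
  rw [memLp_two_iff_integrable_sq_norm (aestronglyMeasurable_product hN hm f h)]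
  have h1 := integrable_comp_jacobiEquiv hN hm
    ((integrable_inner_Lp f f).mul_prod (integrable_inner_Lp h h))
  refine h1.re.congr (Filter.Eventually.of_forall fun x => ?_)
  change (inner ℂ (f (centreOfMass m x)) (f (centreOfMass m x))
    * inner ℂ (h (jacobi m x)) (h (jacobi m x)) : ℂ).re = _
  rw [inner_self_eq_norm_sq_to_K, inner_self_eq_norm_sq_to_K]
  simp only [norm_mul, mul_pow]
  norm_cast

/-- The constant Jacobian of the change to the coordinates `(X, y)`. -/
def jacobiConst (hN : 1 ≤ N) (hm : ∀ k, 0 < m k) : NNReal := (exists_map_jacobiEquiv hN hm).choose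

theorem inner_product (hN : 1 ≤ N) (hm : ∀ k, 0 < m k)
    (f f' : Lp ℂ 2 (volume : Measure E3)) (h h' : L2 (N - 1)) :
    inner ℂ ((memLp_product hN hm f h).toLp _) ((memLp_product hN hm f' h').toLp _)
      = (jacobiConst hN hm : ℂ) * (inner ℂ f f' * inner ℂ h h') := by
  rw [L2.inner_def]
  have h1 : ∀ᵐ x : Config N,
      inner ℂ ((memLp_product hN hm f h).toLp _ x) ((memLp_product hN hm f' h').toLp _ x)
        = (fun p : E3 × Config (N - 1) => (inner ℂ (f p.1) (f' p.1) * inner ℂ (h p.2) (h' p.2) : ℂ))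
          (jacobiEquiv hN hm x) := by
    filter_upwards [(memLp_product hN hm f h).coeFn_toLp, (memLp_product hN hm f' h').coeFn_toLp]
      with x h2 h3
    rw [h2, h3, jacobiEquiv_apply]
    simp only [RCLike.inner_apply, map_mul]
    ring
  rw [integral_congr_ae h1]
  have h2 : MeasurableEmbedding (jacobiEquiv hN hm) :=
    (jacobiEquiv hN hm).toHomeomorph.measurableEmbedding
  rw [← h2.integral_map (fun p : E3 × Config (N - 1) =>
      (inner ℂ (f p.1) (f' p.1) * inner ℂ (h p.2) (h' p.2) : ℂ)),
    (exists_map_jacobiEquiv hN hm).choose_spec.2,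
    integral_smul_nnreal_measure]
  have h3 := integral_prod_mul (μ := (volume : Measure E3)) (ν := (volume : Measure (Config (N - 1))))
    (fun x => (inner ℂ (f x) (f' x) : ℂ)) (fun y => (inner ℂ (h y) (h' y) : ℂ))
  rw [← L2.inner_def, ← L2.inner_def] at h3
  exact congrArg (fun z : ℂ => jacobiConst hN hm • z) h3

theorem norm_product (hN : 1 ≤ N) (hm : ∀ k, 0 < m k)
    (f : Lp ℂ 2 (volume : Measure E3)) (h : L2 (N - 1)) :
    ‖(memLp_product hN hm f h).toLp _‖ = √(jacobiConst hN hm) * ‖f‖ * ‖h‖ := by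
  have h1 := inner_product hN hm f f h h
  rw [inner_self_eq_norm_sq_to_K, inner_self_eq_norm_sq_to_K, inner_self_eq_norm_sq_to_K] at h1
  have h2 : ‖(memLp_product hN hm f h).toLp _‖ ^ 2 = jacobiConst hN hm * (‖f‖ ^ 2 * ‖h‖ ^ 2) := by
    refine Complex.ofReal_injective ?_
    push_cast
    exact h1
  rw [← sq_eq_sq₀ (norm_nonneg _) (by positivity), h2, mul_pow, mul_pow,
    Real.sq_sqrt (NNReal.coe_nonneg _), mul_assoc]

/-- The product `f(X) h(y)` of `f ∈ L²(ℝ³)` and `h ∈ L²(ℝ^{3N-3})`. -/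
def tensor (hN : 1 ≤ N) (hm : ∀ k, 0 < m k) :
    Lp ℂ 2 (volume : Measure E3) →L[ℂ] L2 (N - 1) →L[ℂ] L2 N :=
  LinearMap.mkContinuous₂
    (LinearMap.mk₂ ℂ (fun f h => (memLp_product hN hm f h).toLp _)
      (fun f f' h => by
        rw [← MemLp.toLp_add, MemLp.toLp_eq_toLp_iff]
        filter_upwards [(quasiMeasurePreserving_centreOfMass hN hm).ae (Lp.coeFn_add f f')]
          with x hx
        simp only [Pi.add_apply] at hx ⊢
        rw [hx, add_mul])
      (fun c f h => by
        rw [← MemLp.toLp_const_smul, MemLp.toLp_eq_toLp_iff]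
        filter_upwards [(quasiMeasurePreserving_centreOfMass hN hm).ae (Lp.coeFn_smul c f)]
          with x hx
        simp only [Pi.smul_apply, smul_eq_mul] at hx ⊢
        rw [hx, mul_assoc])
      (fun f h h' => by
        rw [← MemLp.toLp_add, MemLp.toLp_eq_toLp_iff]
        filter_upwards [(quasiMeasurePreserving_jacobi hN hm).ae (Lp.coeFn_add h h')] with x hx
        simp only [Pi.add_apply] at hx ⊢
        rw [hx, mul_add])
      (fun c f h => by
        rw [← MemLp.toLp_const_smul, MemLp.toLp_eq_toLp_iff]
        filter_upwards [(quasiMeasurePreserving_jacobi hN hm).ae (Lp.coeFn_smul c h)] with x hx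
        simp only [Pi.smul_apply, smul_eq_mul] at hx ⊢
        rw [hx, mul_left_comm]))
    (√(jacobiConst hN hm)) fun f h => (norm_product hN hm f h).le

theorem coeFn_tensor (hN : 1 ≤ N) (hm : ∀ k, 0 < m k)
    (f : Lp ℂ 2 (volume : Measure E3)) (h : L2 (N - 1)) :
    tensor hN hm f h =ᵐ[volume] fun x => f (centreOfMass m x) * h (jacobi m x) :=
  (memLp_product hN hm f h).coeFn_toLp

/-- The product of representatives is a representative of the product. -/
theorem coeFn_tensor_of_ae_eq (hN : 1 ≤ N) (hm : ∀ k, 0 < m k)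
    {f : Lp ℂ 2 (volume : Measure E3)} {h : L2 (N - 1)} {f' : E3 → ℂ} {h' : Config (N - 1) → ℂ}
    (hf : f =ᵐ[volume] f') (hh : h =ᵐ[volume] h') :
    tensor hN hm f h =ᵐ[volume] fun x => f' (centreOfMass m x) * h' (jacobi m x) := by
  filter_upwards [coeFn_tensor hN hm f h, (quasiMeasurePreserving_centreOfMass hN hm).ae hf,
    (quasiMeasurePreserving_jacobi hN hm).ae hh] with x h1 h2 h3
  rw [h1, h2, h3]

/-- The graph of `P² / (2M)` on the test functions on `ℝ³`. -/
def kinGraph (M : ℝ) : Set (Lp ℂ 2 (volume : Measure E3) × Lp ℂ 2 (volume : Measure E3)) :=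
  {p | ∃ f : E3 → ℂ, ContDiff ℝ ∞ f ∧ HasCompactSupport f ∧ p.1 =ᵐ[volume] f ∧
    p.2 =ᵐ[volume] kinExpr M f}

theorem tensor_mem_hamGraph (hN : 1 ≤ N) (hm : ∀ k, 0 < m k) {V : Config N → ℝ}
    (hV : ∀ (b : E3) (x : Config N), V (fun k => x k + b) = V x)
    {p : Lp ℂ 2 (volume : Measure E3) × Lp ℂ 2 (volume : Measure E3)} (hp : p ∈ kinGraph (∑ j, m j))
    {q : L2 (N - 1) × L2 (N - 1)} (hq : q ∈ hamGraph (reducedMass m) (internalPotential m V)) :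
    (tensor hN hm p.1 q.1, tensor hN hm p.2 q.1 + tensor hN hm p.1 q.2) ∈ hamGraph m V := by
  obtain ⟨f, hf1, hf2, hf3, hf4⟩ := hp
  obtain ⟨h, ⟨hh1, hh2⟩, hh3, hh4⟩ := hq
  have hJ : ContDiff ℝ ∞ (jacobiEquiv hN hm) := (jacobiEquiv hN hm).contDiff
  refine ⟨fun x => f (centreOfMass m x) * h (jacobi m x), ⟨?_, ?_⟩,
    coeFn_tensor_of_ae_eq hN hm hf3 hh3, ?_⟩
  · exact (hf1.comp (contDiff_fst.comp hJ)).mul (hh1.comp (contDiff_snd.comp hJ))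
  · have h1 : HasCompactSupport fun p : E3 × Config (N - 1) => f p.1 * h p.2 := by
      refine HasCompactSupport.intro (hf2.prod hh2) fun p hp => ?_
      by_contra h0
      refine hp ⟨?_, ?_⟩
      · exact subset_tsupport f (left_ne_zero_of_mul h0)
      · exact subset_tsupport h (right_ne_zero_of_mul h0)
    exact h1.comp_homeomorph (jacobiEquiv hN hm).toHomeomorph
  · filter_upwards [Lp.coeFn_add (tensor hN hm p.2 q.1) (tensor hN hm p.1 q.2),
      coeFn_tensor_of_ae_eq hN hm hf4 hh3, coeFn_tensor_of_ae_eq hN hm hf3 hh4] with x h1 h2 h3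
    rw [h1, Pi.add_apply, h2, h3,
      hamExpr_product hN hm hV (contDiff_infty.1 hf1 2) (contDiff_infty.1 hh1 2)]

/-- The relation on test functions is continuous in both factors, because `tensor` is a bounded
bilinear map, and so it passes to the closed graphs. -/
theorem tensor_mem_graph (hN : 1 ≤ N) (hm : ∀ k, 0 < m k) {V : Config N → ℝ}
    (hV : IsGalileanPotential m V)
    {p : Lp ℂ 2 (volume : Measure E3) × Lp ℂ 2 (volume : Measure E3)}
    (hp : p ∈ closure (kinGraph (∑ j, m j))) {q : L2 (N - 1) × L2 (N - 1)}
    (hq : q ∈ (hamiltonian (reducedMass m) (internalPotential m V)).closure.graph) :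
    (tensor hN hm p.1 q.1, tensor hN hm p.2 q.1 + tensor hN hm p.1 q.2)
      ∈ (hamiltonian m V).closure.graph := by
  rw [graph_closure_hamiltonian hV.essSelfAdjoint_internal] at hq
  rw [graph_closure_hamiltonian hV.essSelfAdjoint]
  exact map_mem_closure₂ (f := fun (p : Lp ℂ 2 (volume : Measure E3) × Lp ℂ 2 (volume : Measure E3))
      (q : L2 (N - 1) × L2 (N - 1)) =>
      (tensor hN hm p.1 q.1, tensor hN hm p.2 q.1 + tensor hN hm p.1 q.2))
    (by fun_prop) hp hq fun p hp q hq => tensor_mem_hamGraph hN hm hV.translation hp hq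

/-- Products of solutions of the free Schrödinger equation and of the internal one are solutions
of the Schrödinger equation. -/
theorem evolution_tensor_of_solution (hN : 1 ≤ N) (hm : ∀ k, 0 < m k) {V : Config N → ℝ}
    (hV : IsGalileanPotential m V) {f f' : ℝ → Lp ℂ 2 (volume : Measure E3)}
    (hf : ∀ t, (f t, f' t) ∈ closure (kinGraph (∑ j, m j)))
    (hf' : ∀ t, HasDerivAt f (-(Complex.I • f' t)) t) (t : ℝ) (h : L2 (N - 1)) :
    evolution m V t (tensor hN hm (f 0) h)
      = tensor hN hm (f t) (evolution (reducedMass m) (internalPotential m V) t h) := by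
  have hU := isUnitaryGroupOf_evolution hV.essSelfAdjoint
  have hU' := isUnitaryGroupOf_evolution hV.essSelfAdjoint_internal
  -- Both sides are continuous in h, so h may be taken in the domain of the internal Hamiltonian,
  -- where the product is a strong solution and uniqueness applies.
  refine hV.essSelfAdjoint_internal.dense_domain.induction
    (P := fun h => evolution m V t (tensor hN hm (f 0) h)
      = tensor hN hm (f t) (evolution (reducedMass m) (internalPotential m V) t h)) (fun h hh => ?_)
    (isClosed_eq ((evolution m V t).continuous.comp (tensor hN hm (f 0)).continuous)
      ((tensor hN hm (f t)).continuous.comp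
        (evolution (reducedMass m) (internalPotential m V) t).continuous)) h
  obtain ⟨h', hh'⟩ := LinearPMap.mem_domain_iff.1 hh
  have h1 := hU.eq_of_hasDerivAt
    (ψ := fun s => tensor hN hm (f s) (evolution (reducedMass m) (internalPotential m V) s h))
    (ψ' := fun s => tensor hN hm (f' s) (evolution (reducedMass m) (internalPotential m V) s h)
      + tensor hN hm (f s) (evolution (reducedMass m) (internalPotential m V) s h'))
    (fun s => tensor_mem_graph hN hm hV (hf s)
      (hU'.mem_graph hV.essSelfAdjoint_internal hh' s))
    (fun s => hasDerivAt_bilinear (tensor hN hm) (hf' s) (hU'.hasDerivAt_apply hh' s)) t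
  rw [h1, hU'.map_zero]

end Tensor

/-! ## The free evolution of the centre of mass -/

section Free

open scoped SchwartzMap LineDeriv Laplacian
open Complex (I)

theorem norm_exp_I_mul_ofReal (r : ℝ) : ‖Complex.exp (I * r)‖ = 1 := by
  rw [mul_comm, Complex.norm_exp_ofReal_mul_I]

theorem memLp_phase_mul {α : Type*} [TopologicalSpace α] [MeasurableSpace α]
    [OpensMeasurableSpace α] {μ : Measure α} {θ : α → ℝ} (hθ : Continuous θ) (f : Lp ℂ 2 μ) :
    MemLp (fun x => Complex.exp (I * θ x) * f x) 2 μ := by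
  have h1 : Continuous fun x => Complex.exp (I * θ x) := by fun_prop
  refine (Lp.memLp f).of_le (h1.aestronglyMeasurable.mul (Lp.aestronglyMeasurable f))
    (Filter.Eventually.of_forall fun x => ?_)
  rw [norm_mul, norm_exp_I_mul_ofReal, one_mul]

/-- Multiplication by the phase `e^{iθ}` as a linear isometry. -/
def phaseIsometry {α : Type*} [TopologicalSpace α] [MeasurableSpace α] [OpensMeasurableSpace α]
    {μ : Measure α} (θ : α → ℝ) (hθ : Continuous θ) : Lp ℂ 2 μ →ₗᵢ[ℂ] Lp ℂ 2 μ where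
  toFun f := (memLp_phase_mul hθ f).toLp _
  map_add' f g := by
    rw [← MemLp.toLp_add, MemLp.toLp_eq_toLp_iff]
    filter_upwards [Lp.coeFn_add f g] with x h
    rw [h, Pi.add_apply, mul_add, Pi.add_apply]
  map_smul' c f := by
    rw [RingHom.id_apply, ← MemLp.toLp_const_smul, MemLp.toLp_eq_toLp_iff]
    filter_upwards [Lp.coeFn_smul c f] with x h
    rw [h, Pi.smul_apply, Pi.smul_apply, smul_eq_mul, smul_eq_mul, mul_left_comm]
  norm_map' f := by
    change ‖(memLp_phase_mul hθ f).toLp _‖ = ‖f‖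
    rw [Lp.norm_toLp, Lp.norm_def]
    refine congrArg _ (eLpNorm_congr_norm_ae (Filter.Eventually.of_forall fun x => ?_))
    rw [norm_mul, norm_exp_I_mul_ofReal, one_mul]

theorem coeFn_phaseIsometry {α : Type*} [TopologicalSpace α] [MeasurableSpace α]
    [OpensMeasurableSpace α] {μ : Measure α} {θ : α → ℝ} (hθ : Continuous θ) (f : Lp ℂ 2 μ) :
    phaseIsometry θ hθ f =ᵐ[μ] fun x => Complex.exp (I * θ x) * f x :=
  (memLp_phase_mul hθ f).coeFn_toLp

theorem hasTemperateGrowth_exp_I : Function.HasTemperateGrowth fun s : ℝ => Complex.exp (I * s) := by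
  have h : ∀ n, iteratedDeriv n (fun s : ℝ => Complex.exp (I * s))
      = fun s : ℝ => I ^ n * Complex.exp (I * s) := by
    intro n
    induction n with
    | zero => simp
    | succ n ih =>
      rw [iteratedDeriv_succ, ih]
      funext s
      have h1 : HasDerivAt (fun s : ℝ => Complex.exp (I * s)) (Complex.exp (I * s) * (I * 1)) s :=
        ((Complex.ofRealCLM.hasDerivAt (x := s)).const_mul I).cexp
      rw [(h1.const_mul _).deriv]
      ring
  refine ⟨(contDiff_const.mul Complex.ofRealCLM.contDiff).cexp, fun n => ⟨0, 1, fun x => ?_⟩⟩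
  rw [norm_iteratedFDeriv_eq_norm_iteratedDeriv, h]
  simp

/-- A quadratic remainder bound valid for all r: the power series handles |r| ≤ 1, and for |r| ≥ 1
the trivial bound 2 + |r| is at most 3r². -/
theorem norm_exp_I_sub_le (r : ℝ) : ‖Complex.exp (I * r) - 1 - I * r‖ ≤ 3 * r ^ 2 := by
  have h0 : ‖I * (r : ℂ)‖ = |r| := by simp
  rcases le_total |r| 1 with h | h
  · have h1 := Complex.norm_exp_sub_one_sub_id_le (x := I * r) (by rwa [h0])
    rw [h0, sq_abs] at h1
    nlinarith [sq_nonneg r]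
  · have h1 := norm_sub_le (Complex.exp (I * r) - 1) (I * r)
    have h2 := norm_sub_le (Complex.exp (I * r)) 1
    rw [norm_exp_I_mul_ofReal, norm_one] at h2
    rw [h0] at h1
    nlinarith [sq_abs r, abs_nonneg r]

/-- The kinetic energy as a function of the wave number `κ = P / 2π`. -/
def kinSymbol (M : ℝ) (κ : E3) : ℝ := (2 * Real.pi) ^ 2 / (2 * M) * ‖κ‖ ^ 2

theorem hasTemperateGrowth_kinSymbol (M : ℝ) : Function.HasTemperateGrowth (kinSymbol M) := by
  unfold kinSymbol
  fun_prop

theorem continuous_kinSymbol (M t : ℝ) : Continuous fun κ => -(t * kinSymbol M κ) := by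
  unfold kinSymbol
  fun_prop

/-- The phase factor `e^{-it P² / 2M}` as a function of the wave number. -/
def freePhase (M t : ℝ) (κ : E3) : ℂ := Complex.exp (I * ((-(t * kinSymbol M κ) : ℝ) : ℂ))

theorem hasTemperateGrowth_freeSymbol (M t : ℝ) :
    Function.HasTemperateGrowth fun κ => -(t * kinSymbol M κ) :=
  ((Function.HasTemperateGrowth.const t).mul (hasTemperateGrowth_kinSymbol M)).neg

theorem hasTemperateGrowth_freePhase (M t : ℝ) : Function.HasTemperateGrowth (freePhase M t) :=
  hasTemperateGrowth_exp_I.comp (hasTemperateGrowth_freeSymbol M t)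

/-- The free evolution `e^{-itP²/2M}` on `L²(ℝ³)`. -/
def freeEvolution (M t : ℝ) :
    Lp ℂ 2 (volume : Measure E3) →ₗᵢ[ℂ] Lp ℂ 2 (volume : Measure E3) :=
  ((Lp.fourierTransformₗᵢ E3 ℂ).symm.toLinearIsometry.comp
    (phaseIsometry _ (continuous_kinSymbol M t))).comp (Lp.fourierTransformₗᵢ E3 ℂ).toLinearIsometry

theorem freeEvolution_apply (M t : ℝ) (f : Lp ℂ 2 (volume : Measure E3)) :
    freeEvolution M t f = 𝓕⁻ (phaseIsometry _ (continuous_kinSymbol M t) (𝓕 f)) := rfl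

theorem phaseIsometry_toLp {θ : E3 → ℝ} (hθ : Function.HasTemperateGrowth θ)
    (g : 𝓢(E3, ℂ)) : phaseIsometry θ hθ.1.continuous (g.toLp 2 volume)
      = (SchwartzMap.smulLeftCLM ℂ (fun κ => Complex.exp (I * θ κ)) g).toLp 2 volume := by
  have h0 : Function.HasTemperateGrowth fun κ => Complex.exp (I * θ κ) :=
    hasTemperateGrowth_exp_I.comp hθ
  refine Lp.ext ?_
  filter_upwards [coeFn_phaseIsometry hθ.1.continuous (g.toLp 2 volume), g.coeFn_toLp 2,
    (SchwartzMap.smulLeftCLM ℂ (fun κ => Complex.exp (I * θ κ)) g).coeFn_toLp 2] with x h1 h2 h3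
  rw [h1, h2, h3, SchwartzMap.smulLeftCLM_apply_apply h0]
  rfl

/-- The free evolution on Schwartz functions. -/
def freeSchwartz (M t : ℝ) (f : 𝓢(E3, ℂ)) : 𝓢(E3, ℂ) :=
  𝓕⁻ (SchwartzMap.smulLeftCLM ℂ (freePhase M t) (𝓕 f))

theorem freeEvolution_toLp (M t : ℝ) (f : 𝓢(E3, ℂ)) :
    freeEvolution M t (f.toLp 2) = (freeSchwartz M t f).toLp 2 := by
  rw [freeEvolution_apply, SchwartzMap.toLp_fourier_eq,
    phaseIsometry_toLp (hasTemperateGrowth_freeSymbol M t), SchwartzMap.toLp_fourierInv_eq]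
  rfl

/-- The kinetic energy operator on Schwartz functions. -/
def kinSchwartz (M : ℝ) (f : 𝓢(E3, ℂ)) : 𝓢(E3, ℂ) := (1 / (2 * M) : ℂ) • -Δ f

theorem kinSchwartz_coe (M : ℝ) (f : 𝓢(E3, ℂ)) : ⇑(kinSchwartz M f) = kinExpr M f := by
  funext x
  rw [kinExpr, ← SchwartzMap.laplacian_apply]
  rfl

theorem fourier_kinSchwartz (M : ℝ) (f : 𝓢(E3, ℂ)) :
    𝓕 (kinSchwartz M f) = SchwartzMap.smulLeftCLM ℂ (kinSymbol M) (𝓕 f) := by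
  have h2 : Function.HasTemperateGrowth (fun κ : E3 => ‖κ‖ ^ 2) := by fun_prop
  have h1 : kinSchwartz M f
      = 𝓕⁻ (SchwartzMap.smulLeftCLM ℂ (kinSymbol M) (𝓕 f)) := by
    rw [kinSchwartz, SchwartzMap.laplacian_eq_fourierMultiplierCLM]
    have h3 : SchwartzMap.smulLeftCLM ℂ (kinSymbol M) = ((2 * Real.pi) ^ 2 / (2 * M)) •
        SchwartzMap.smulLeftCLM ℂ (fun κ : E3 => ‖κ‖ ^ 2) :=
      SchwartzMap.smulLeftCLM_smul h2 ((2 * Real.pi) ^ 2 / (2 * M))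
    rw [h3, SchwartzMap.fourierMultiplierCLM_apply, smul_apply, FourierTransform.fourierInv_smul]
    ext x
    simp only [smul_apply, neg_apply, Complex.real_smul, smul_eq_mul]
    push_cast
    ring
  rw [h1, FourierTransform.fourier_fourierInv_eq]

/-- By Plancherel the remainder of the difference quotient is a multiplication by e^{iθ} - 1 - iθ
with θ = -(s - t)P²/2M, hence quadratic in s - t. The resulting factor (P²/2M)² is harmless on
Schwartz functions. -/
theorem hasDerivAt_freeSchwartz (M : ℝ) (f : 𝓢(E3, ℂ)) (t : ℝ) :
    HasDerivAt (fun t => (freeSchwartz M t f).toLp 2 volume)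
      (-(I • (kinSchwartz M (freeSchwartz M t f)).toLp 2 volume)) t := by
  set g : ℝ → 𝓢(E3, ℂ) := fun s => SchwartzMap.smulLeftCLM ℂ (freePhase M s) (𝓕 f)
  have hfg : ∀ s, 𝓕 (freeSchwartz M s f) = g s := fun s => FourierTransform.fourier_fourierInv_eq _
  set k := SchwartzMap.smulLeftCLM ℂ (kinSymbol M) (SchwartzMap.smulLeftCLM ℂ (kinSymbol M) (𝓕 f))
  have hk := hasTemperateGrowth_kinSymbol M
  -- the estimate of the difference quotient
  have key : ∀ s, ‖(freeSchwartz M s f).toLp 2 volume - (freeSchwartz M t f).toLp 2 volume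
      - (s - t) • -(I • (kinSchwartz M (freeSchwartz M t f)).toLp 2 volume)‖
        ≤ 3 * (s - t) ^ 2 * ‖k.toLp 2 volume‖ := by
    intro s
    set u := freeSchwartz M s f - freeSchwartz M t f
        - (s - t) • -(I • kinSchwartz M (freeSchwartz M t f)) with hu
    have h1 : (freeSchwartz M s f).toLp 2 volume - (freeSchwartz M t f).toLp 2 volume
        - (s - t) • -(I • (kinSchwartz M (freeSchwartz M t f)).toLp 2 volume)
        = u.toLp 2 volume := by
      change SchwartzMap.toLpCLM ℝ ℂ 2 volume _ - SchwartzMap.toLpCLM ℝ ℂ 2 volume _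
        - (s - t) • -(I • SchwartzMap.toLpCLM ℂ ℂ 2 volume _) = SchwartzMap.toLpCLM ℝ ℂ 2 volume u
      rw [hu, map_sub, map_sub, map_smul, map_neg]
      rw [← map_smul (SchwartzMap.toLpCLM ℂ ℂ 2 volume)]
      rfl
    rw [h1, ← Lp.norm_fourier_eq, SchwartzMap.toLp_fourier_eq]
    refine Lp.norm_le_mul_norm_of_ae_le_mul ?_
    filter_upwards [(𝓕 u).coeFn_toLp 2, k.coeFn_toLp 2] with x h2 h3
    have h4 : 𝓕 u = g s - g t
        - (s - t) • -(I • SchwartzMap.smulLeftCLM ℂ (kinSymbol M) (g t)) := by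
      rw [hu]
      simp only [sub_eq_add_neg, FourierTransform.fourier_add, FourierTransform.fourier_neg,
        FourierTransform.fourier_smul]
      rw [fourier_kinSchwartz, hfg, hfg]
    rw [h2, h3, h4]
    have h5 : (k : E3 → ℂ) x = (kinSymbol M x) ^ 2 * 𝓕 f x := by
      rw [SchwartzMap.smulLeftCLM_apply_apply hk, SchwartzMap.smulLeftCLM_apply_apply hk]
      simp only [Complex.real_smul]
      ring
    have h6 : (g s - g t - (s - t) • -(I • SchwartzMap.smulLeftCLM ℂ (kinSymbol M) (g t))) x
        = (Complex.exp (I * ((-((s - t) * kinSymbol M x) : ℝ) : ℂ)) - 1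
            - I * ((-((s - t) * kinSymbol M x) : ℝ) : ℂ)) * (freePhase M t x * 𝓕 f x) := by
      have h7 : freePhase M s x
          = Complex.exp (I * ((-((s - t) * kinSymbol M x) : ℝ) : ℂ)) * freePhase M t x := by
        rw [freePhase, freePhase, ← Complex.exp_add]
        congr 1
        push_cast
        ring
      simp only [sub_apply, smul_apply, neg_apply, SchwartzMap.smulLeftCLM_apply_apply hk, g,
        SchwartzMap.smulLeftCLM_apply_apply (hasTemperateGrowth_freePhase M _), h7, smul_eq_mul,
        Complex.real_smul]
      push_cast
      ring
    rw [h6, h5, norm_mul, norm_mul, norm_mul, freePhase, norm_exp_I_mul_ofReal, one_mul, norm_pow,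
      Complex.norm_real, Real.norm_eq_abs, sq_abs, ← mul_assoc]
    refine mul_le_mul_of_nonneg_right ((norm_exp_I_sub_le _).trans (le_of_eq ?_)) (norm_nonneg _)
    ring
  rw [hasDerivAt_iff_isLittleO]
  refine Asymptotics.IsBigO.trans_isLittleO (g := fun s => (s - t) ^ 2) ?_ ?_
  · refine Asymptotics.IsBigO.of_bound (3 * ‖k.toLp 2 volume‖)
      (Filter.Eventually.of_forall fun s => ?_)
    refine (key s).trans (le_of_eq ?_)
    rw [Real.norm_eq_abs, abs_of_nonneg (sq_nonneg _)]
    ring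
  · simpa using Asymptotics.isLittleO_pow_sub_sub t (m := 2) (by norm_num)

/-! ### Approximating Schwartz functions by test functions -/

theorem fderiv_fderiv_mul {E : Type*} [NormedAddCommGroup E] [NormedSpace ℝ E] {a f : E → ℂ}
    (ha : ContDiff ℝ 2 a) (hf : ContDiff ℝ 2 f) (x u : E) :
    fderiv ℝ (fderiv ℝ fun y => a y * f y) x u u = a x * fderiv ℝ (fderiv ℝ f) x u u
      + 2 * (fderiv ℝ a x u * fderiv ℝ f x u) + fderiv ℝ (fderiv ℝ a) x u u * f x := by
  have ha1 : Differentiable ℝ a := ha.differentiable (by norm_num)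
  have hf1 : Differentiable ℝ f := hf.differentiable (by norm_num)
  have ha2 : Differentiable ℝ (fderiv ℝ a) :=
    (ha.fderiv_right (m := 1) (by norm_num)).differentiable (by norm_num)
  have hf2 : Differentiable ℝ (fderiv ℝ f) :=
    (hf.fderiv_right (m := 1) (by norm_num)).differentiable (by norm_num)
  have h1 : (fderiv ℝ fun y => a y * f y) = fun y => a y • fderiv ℝ f y + f y • fderiv ℝ a y := by
    funext y
    exact fderiv_fun_mul (ha1 y) (hf1 y)
  rw [h1, fderiv_fun_add ((ha1 x).fun_smul (hf2 x)) ((hf1 x).fun_smul (ha2 x)),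
    fderiv_fun_smul (ha1 x) (hf2 x), fderiv_fun_smul (hf1 x) (ha2 x)]
  simp only [add_apply, smul_apply, ContinuousLinearMap.smulRight_apply, smul_eq_mul]
  ring

/-- The bump is 1 on the unit ball and takes values in [0, 1]. The crude linear bound is chosen
because it scales: at εx it gives an error of at most ε‖x‖ ≤ ε(1 + ‖x‖²). -/
theorem exists_bump (E : Type*) [NormedAddCommGroup E] [InnerProductSpace ℝ E]
    [FiniteDimensional ℝ E] : ∃ χ : E → ℂ, ContDiff ℝ ∞ χ ∧ HasCompactSupport χ ∧
      ∀ x, ‖χ x - 1‖ ≤ ‖x‖ := by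
  let b : ContDiffBump (0 : E) := ⟨1, 2, one_pos, one_lt_two⟩
  refine ⟨fun x => (b x : ℂ), Complex.ofRealCLM.contDiff.comp b.contDiff,
    b.hasCompactSupport.comp_left (g := fun r : ℝ => (r : ℂ)) rfl, fun x => ?_⟩
  have h1 : ‖(b x : ℂ) - 1‖ = 1 - b x := by
    rw [← Complex.ofReal_one, ← Complex.ofReal_sub, Complex.norm_real,
      Real.norm_eq_abs, abs_of_nonpos (by linarith [b.le_one (x := x)])]
    ring
  rw [h1]
  by_cases h2 : ‖x‖ ≤ 1
  · rw [b.one_of_mem_closedBall (by simpa using h2), sub_self]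
    positivity
  · linarith [b.nonneg (x := x)]

theorem exists_norm_fderiv_le {E F : Type*} [NormedAddCommGroup E] [NormedSpace ℝ E]
    [NormedAddCommGroup F] [NormedSpace ℝ F] {χ : E → F}
    (hχ : ContDiff ℝ 1 χ) (hs : HasCompactSupport χ) :
    ∃ C, ∀ x, ‖fderiv ℝ χ x‖ ≤ C :=
  (hχ.continuous_fderiv one_ne_zero).bounded_above_of_compact_support (hs.fderiv ℝ)

/-- Smooth cutoffs `a` which are close to `1` on the scale `1 / ε`. -/
theorem exists_cutoff (E : Type*) [NormedAddCommGroup E] [InnerProductSpace ℝ E]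
    [FiniteDimensional ℝ E] : ∃ C : ℝ, 0 ≤ C ∧ ∀ ε : ℝ, 0 < ε → ε ≤ 1 → ∃ a : E → ℂ,
      ContDiff ℝ ∞ a ∧ HasCompactSupport a ∧ (∀ x, ‖a x - 1‖ ≤ ε * (1 + ‖x‖ ^ 2)) ∧
      (∀ x u, ‖fderiv ℝ a x u‖ ≤ ε * C * ‖u‖) ∧
      ∀ x u, ‖fderiv ℝ (fderiv ℝ a) x u u‖ ≤ ε * C * ‖u‖ ^ 2 := by
  obtain ⟨χ, hχ, hs, hb⟩ := exists_bump E
  have hχ1 : ContDiff ℝ 2 χ := contDiff_infty.1 hχ 2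
  obtain ⟨C1, hC1⟩ := exists_norm_fderiv_le (hχ1.of_le (by norm_num)) hs
  obtain ⟨C2, hC2⟩ := exists_norm_fderiv_le (hχ1.fderiv_right (m := 1) (by norm_num)) (hs.fderiv ℝ)
  obtain ⟨C, hC, hC1', hC2'⟩ : ∃ C : ℝ, 0 ≤ C ∧ C1 ≤ C ∧ C2 ≤ C :=
    ⟨max C1 C2, ((norm_nonneg _).trans (hC1 0)).trans (le_max_left _ _), le_max_left _ _,
      le_max_right _ _⟩
  refine ⟨C, hC, fun ε hε hε1 => ?_⟩
  obtain ⟨L, hL⟩ : ∃ L : E →L[ℝ] E, ∀ x, L x = ε • x :=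
    ⟨ε • ContinuousLinearMap.id ℝ E, fun x => rfl⟩
  have ha : ContDiff ℝ ∞ fun x => χ (0 + L x) := hχ.comp (contDiff_const.add L.contDiff)
  refine ⟨fun x => χ (0 + L x), ha, ?_, fun x => ?_, fun x u => ?_, fun x u => ?_⟩
  · have := hs.comp_homeomorph (Homeomorph.smulOfNeZero (α := E) ε hε.ne')
    convert! this using 1
    funext x
    simp [hL]
  · change ‖χ (0 + L x) - 1‖ ≤ _
    rw [zero_add, hL]
    have h1 := hb (ε • x)
    rw [norm_smul, Real.norm_of_nonneg hε.le] at h1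
    nlinarith [sq_nonneg (‖x‖ - 1), norm_nonneg x]
  · have h1 : fderiv ℝ (fun x => χ (0 + L x)) x u = fderiv ℝ χ (0 + L x) (L u) := by
      have := ((hχ1.differentiable (by norm_num)) (0 + L x)).hasFDerivAt.comp x
        (L.hasFDerivAt.const_add 0)
      exact congrArg (fun T : E →L[ℝ] ℂ => T u) this.fderiv
    rw [h1, hL u, map_smul, norm_smul, Real.norm_of_nonneg hε.le, mul_assoc]
    refine mul_le_mul_of_nonneg_left (((fderiv ℝ χ _).le_opNorm u).trans ?_) hε.le
    exact mul_le_mul_of_nonneg_right ((hC1 _).trans hC1') (norm_nonneg _)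
  · rw [fderiv_fderiv_comp_affine hχ1, hL u, map_smul, map_smul, smul_apply, norm_smul, norm_smul,
      Real.norm_of_nonneg hε.le, mul_assoc]
    refine mul_le_mul_of_nonneg_left ?_ hε.le
    -- Two factors ε come from the chain rule; one suffices, and the other is bounded by 1.
    refine (mul_le_of_le_one_left (norm_nonneg _) hε1).trans ?_
    refine (((fderiv ℝ (fderiv ℝ χ) _).le_opNorm₂ u u).trans ?_)
    rw [mul_assoc, ← sq]
    exact mul_le_mul_of_nonneg_right ((hC2 _).trans hC2') (sq_nonneg _)

/-- Multiply f by a cutoff a at scale 1/ε. The error in the image under the kinetic operator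
consists of (a - 1) times that image and of the commutator terms 2∇a·∇f and fΔa. All of them are
bounded by ε times a fixed L² function, since f decays faster than any weight grows. -/
theorem kinSchwartz_mem_closure (M : ℝ) (f : 𝓢(E3, ℂ)) :
    (f.toLp 2 volume, (kinSchwartz M f).toLp 2 volume) ∈ closure (kinGraph M) := by
  obtain ⟨C, hC, hcut⟩ := exists_cutoff E3
  have hw : Function.HasTemperateGrowth fun x : E3 => 1 + ‖x‖ ^ 2 := by fun_prop
  obtain ⟨b⟩ : Nonempty (OrthonormalBasis (Fin 3) ℝ E3) := ⟨EuclideanSpace.basisFun (Fin 3) ℝ⟩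
  set q : ℂ := 1 / (2 * M) with hq
  -- The weight 1 + ‖x‖² in the bound for a - 1 is absorbed into Schwartz functions, leaving the
  -- small factor ε.
  obtain ⟨f₁, hf₁⟩ : ∃ f₁ : 𝓢(E3, ℂ), ∀ x, f₁ x = (1 + ‖x‖ ^ 2) • f x :=
    ⟨_, SchwartzMap.smulLeftCLM_apply_apply hw f⟩
  obtain ⟨f₂, hf₂⟩ : ∃ f₂ : 𝓢(E3, ℂ), ∀ x, f₂ x = (1 + ‖x‖ ^ 2) • kinSchwartz M f x :=
    ⟨_, SchwartzMap.smulLeftCLM_apply_apply hw (kinSchwartz M f)⟩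
  obtain ⟨d, hd⟩ : ∃ d : Fin 3 → 𝓢(E3, ℂ), ∀ i x, d i x = fderiv ℝ f x (b i) :=
    ⟨fun i => ∂_{b i} f, fun _ _ => rfl⟩
  have hG : MemLp (fun x => ‖f₂ x‖ + ‖q‖ * ∑ i, (2 * C * ‖d i x‖ + C * ‖f x‖)) 2
      (volume : Measure E3) := by
    have h1 : MemLp (fun x => ‖f₂ x‖) 2 (volume : Measure E3) := (f₂.memLp 2).norm
    have h2 : MemLp (fun x => ‖f x‖) 2 (volume : Measure E3) := (f.memLp 2).norm
    have h3 : ∀ i, MemLp (fun x => ‖d i x‖) 2 (volume : Measure E3) :=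
      fun i => ((d i).memLp 2).norm
    have h4 : ∀ i ∈ Finset.univ, MemLp (fun x => 2 * C * ‖d i x‖ + C * ‖f x‖) 2
        (volume : Measure E3) := fun i _ => ((h3 i).const_mul (2 * C)).add (h2.const_mul C)
    exact h1.add ((memLp_finsetSum Finset.univ h4).const_mul ‖q‖)
  obtain ⟨G, hGG⟩ : ∃ G : Lp ℝ 2 (volume : Measure E3), G =ᵐ[volume] fun x =>
      ‖f₂ x‖ + ‖q‖ * ∑ i, (2 * C * ‖d i x‖ + C * ‖f x‖) := ⟨_, hG.coeFn_toLp⟩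
  obtain ⟨K, hK, hK1, hK2⟩ : ∃ K : ℝ, 0 ≤ K ∧ ‖f₁.toLp 2 volume‖ ≤ K ∧ ‖G‖ ≤ K :=
    ⟨_, (norm_nonneg _).trans (le_max_left _ _), le_max_left _ _, le_max_right _ _⟩
  have key : ∀ ε : ℝ, 0 < ε → ε ≤ 1 → ∃ p ∈ kinGraph M,
      dist (f.toLp 2 volume, (kinSchwartz M f).toLp 2 volume) p ≤ ε * K := by
    intro ε hε hε1
    obtain ⟨a, ha, has, ha0, ha1, ha2⟩ := hcut ε hε hε1
    have haf : ContDiff ℝ ∞ fun x => a x * f x := ha.mul f.smooth'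
    have hafs : HasCompactSupport fun x => a x * f x := has.mul_right
    have ha' : ContDiff ℝ 2 a := contDiff_infty.1 ha 2
    have hf' : ContDiff ℝ 2 f := f.smooth 2
    let F : 𝓢(E3, ℂ) := hafs.toSchwartzMap haf
    have hF : ∀ x, F x = a x * f x := fun x => rfl
    refine ⟨(F.toLp 2 volume, (kinSchwartz M F).toLp 2 volume), ?_, ?_⟩
    · exact ⟨F, haf, hafs, F.coeFn_toLp 2, by
        rw [← kinSchwartz_coe]
        exact (kinSchwartz M F).coeFn_toLp 2 volume⟩
    rw [Prod.dist_eq, max_le_iff, dist_comm, dist_comm ((kinSchwartz M f).toLp 2 volume),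
      dist_eq_norm, dist_eq_norm]
    constructor
    · refine (Lp.norm_le_mul_norm_of_ae_le_mul (c := ε) (g := f₁.toLp 2 volume) ?_).trans
        (mul_le_mul_of_nonneg_left hK1 hε.le)
      filter_upwards [Lp.coeFn_sub (F.toLp 2 volume) (f.toLp 2 volume), F.coeFn_toLp 2,
        f.coeFn_toLp 2, f₁.coeFn_toLp 2] with x h1 h2 h3 h4
      rw [h1, h4, Pi.sub_apply, h2, h3, hF, hf₁, norm_smul,
        ← sub_one_mul, norm_mul, ← mul_assoc, Real.norm_of_nonneg (by positivity)]
      exact mul_le_mul_of_nonneg_right (ha0 x) (norm_nonneg _)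
    · refine (Lp.norm_le_mul_norm_of_ae_le_mul (c := ε) (g := G) ?_).trans
        (mul_le_mul_of_nonneg_left hK2 hε.le)
      filter_upwards [Lp.coeFn_sub ((kinSchwartz M F).toLp 2 volume)
        ((kinSchwartz M f).toLp 2 volume), (kinSchwartz M F).coeFn_toLp 2,
        (kinSchwartz M f).coeFn_toLp 2, hGG] with x h1 h2 h3 h4
      have h5 : kinSchwartz M F x - kinSchwartz M f x = (a x - 1) * kinSchwartz M f x
          - q * ∑ i, (2 * (fderiv ℝ a x (b i) * d i x)
            + fderiv ℝ (fderiv ℝ a) x (b i) (b i) * f x) := by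
        rw [kinSchwartz_coe, kinSchwartz_coe, kinExpr, kinExpr, laplacian_eq_sum_fderiv b,
          laplacian_eq_sum_fderiv b]
        have h6 : ∀ i, fderiv ℝ (fderiv ℝ F) x (b i) (b i)
            = a x * fderiv ℝ (fderiv ℝ f) x (b i) (b i)
            + (2 * (fderiv ℝ a x (b i) * d i x)
            + fderiv ℝ (fderiv ℝ a) x (b i) (b i) * f x) := fun i => by
          rw [← add_assoc, hd]
          exact fderiv_fderiv_mul ha' hf' x (b i)
        rw [Finset.sum_congr rfl fun i _ => h6 i, Finset.sum_add_distrib, ← Finset.mul_sum]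
        ring
      rw [h1, h4, Pi.sub_apply, h2, h3, h5, Real.norm_of_nonneg (by positivity), mul_add]
      refine (norm_sub_le _ _).trans (add_le_add ?_ ?_)
      · rw [norm_mul, hf₂, norm_smul, ← mul_assoc,
          Real.norm_of_nonneg (by positivity)]
        exact mul_le_mul_of_nonneg_right (ha0 x) (norm_nonneg _)
      · rw [norm_mul, mul_left_comm]
        refine mul_le_mul_of_nonneg_left ?_ (norm_nonneg _)
        rw [Finset.mul_sum]
        refine (norm_sum_le _ _).trans (Finset.sum_le_sum fun i _ => ?_)
        have h7 := ha1 x (b i)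
        have h8 := ha2 x (b i)
        rw [b.norm_eq_one] at h7 h8
        refine (norm_add_le _ _).trans ?_
        rw [norm_mul, norm_mul, norm_mul, RCLike.norm_ofNat, mul_add]
        have h9 := mul_le_mul_of_nonneg_right h7 (norm_nonneg (d i x))
        have h10 := mul_le_mul_of_nonneg_right h8 (norm_nonneg (f x))
        linarith
  rw [Metric.mem_closure_iff]
  intro δ hδ
  have hK3 : 0 < δ / (K + 1) := by positivity
  obtain ⟨p, hp, hpd⟩ := key (min 1 (δ / (K + 1))) (lt_min one_pos hK3) (min_le_left _ _)
  refine ⟨p, hp, hpd.trans_lt ?_⟩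
  refine (mul_le_mul_of_nonneg_right (min_le_right _ _) hK).trans_lt ?_
  rw [div_mul_eq_mul_div, div_lt_iff₀ (by positivity)]
  nlinarith

theorem eq_of_forall_schwartz {X : Type*} [TopologicalSpace X] [T2Space X]
    {F G : Lp ℂ 2 (volume : Measure E3) → X} (hF : Continuous F) (hG : Continuous G)
    (h : ∀ f : 𝓢(E3, ℂ), F (f.toLp 2) = G (f.toLp 2)) (f : Lp ℂ 2 (volume : Measure E3)) :
    F f = G f :=
  congrFun ((SchwartzMap.denseRange_toLpCLM (by norm_num)).equalizer hF hG (funext h)) f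

variable {N : ℕ} {m : Fin N → ℝ}

/-- For Schwartz f the free solution is differentiable and stays in the closed kinetic graph, so
`evolution_tensor_of_solution` applies; Schwartz functions are dense. -/
theorem evolution_tensor (hN : 1 ≤ N) (hm : ∀ k, 0 < m k) {V : Config N → ℝ}
    (hV : IsGalileanPotential m V) (t : ℝ) (f : Lp ℂ 2 (volume : Measure E3)) (h : L2 (N - 1)) :
    evolution m V t (tensor hN hm f h) = tensor hN hm (freeEvolution (∑ j, m j) t f)
      (evolution (reducedMass m) (internalPotential m V) t h) := by
  refine eq_of_forall_schwartz (F := fun f => evolution m V t (tensor hN hm f h))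
    (G := fun f => tensor hN hm (freeEvolution (∑ j, m j) t f)
      (evolution (reducedMass m) (internalPotential m V) t h)) ?_ ?_ ?_ f
  · exact (evolution m V t).continuous.comp
      ((ContinuousLinearMap.apply ℂ (L2 N) h).continuous.comp (tensor hN hm).continuous)
  · exact (ContinuousLinearMap.apply ℂ (L2 N) _).continuous.comp
      ((tensor hN hm).continuous.comp (freeEvolution (∑ j, m j) t).continuous)
  · intro f
    have h0 : freeSchwartz (∑ j, m j) 0 f = f := by
      have h1 : freePhase (∑ j, m j) 0 = fun _ => 1 := by
        funext κ
        simp [freePhase]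
      rw [freeSchwartz, h1, SchwartzMap.smulLeftCLM_const, one_smul]
      exact FourierTransform.fourierInv_fourier_eq f
    have := evolution_tensor_of_solution hN hm hV
      (f := fun t => (freeSchwartz (∑ j, m j) t f).toLp 2) (fun t => kinSchwartz_mem_closure _ _)
      (hasDerivAt_freeSchwartz _ f) t h
    rw [h0] at this
    refine this.trans ?_
    rw [← freeEvolution_toLp]

end Free

/-! ## Translations and rotations -/

section Affine

variable {N : ℕ} {m : Fin N → ℝ} {V : Config N → ℝ}

/-- The transformation `ψ ↦ ψ(R (x_k + b))` of `L²(ℝ^{3N})`. -/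
def affinePull (N : ℕ) (R : SO3) (b : E3) : L2 N →ₗᵢ[ℂ] L2 N :=
  Lp.compMeasurePreservingₗᵢ ℂ _ (measurePreserving_affine_config N R b)

theorem coeFn_affinePull (R : SO3) (b : E3) (ψ : L2 N) :
    affinePull N R b ψ =ᵐ[volume] fun x => ψ fun k => R.1 (x k + b) :=
  Lp.coeFn_compMeasurePreserving ψ (measurePreserving_affine_config N R b)

/-- Rotating the arguments turns the trace of the Hessian over a basis into the trace over the
rotated basis, which is the same Laplacian. -/
theorem hamExpr_comp_affine {φ : Config N → ℂ} (hφ : ContDiff ℝ 2 φ) (R : SO3) (b : E3)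
    (hV : ∀ x : Config N, V (fun k => R.1 (x k + b)) = V x) (x : Config N) :
    hamExpr m V (fun x => φ fun k => R.1 (x k + b)) x
      = hamExpr m V φ fun k => R.1 (x k + b) := by
  let e := EuclideanSpace.basisFun (Fin 3) ℝ
  let L : Config N →L[ℝ] Config N := ContinuousLinearMap.pi fun k =>
    (R.1.toContinuousLinearEquiv : E3 →L[ℝ] E3) ∘L ContinuousLinearMap.proj k
  have hL : ∀ x : Config N, (fun k => R.1 (x k + b)) = (fun _ => R.1 b) + L x := by
    intro x
    funext k
    rw [map_add, add_comm]
    rfl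
  have hs : ∀ k v, L (Pi.single k v) = Pi.single k (R.1 v) := by
    intro k v
    funext l
    change R.1 ((Pi.single k v : Config N) l) = _
    rcases eq_or_ne l k with rfl | h
    · simp
    · simp [h]
  have hφ' : ContDiff ℝ 2 fun x : Config N => φ fun k => R.1 (x k + b) := by
    simp only [hL]
    exact hφ.comp (contDiff_const.add L.contDiff)
  have h1 : ∀ k, particleLaplacian k (fun x => φ fun k => R.1 (x k + b)) x
      = particleLaplacian k φ fun k => R.1 (x k + b) := by
    intro k
    rw [particleLaplacian_eq_sum e hφ', particleLaplacian_eq_sum (e.map R.1) hφ]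
    refine Finset.sum_congr rfl fun i _ => ?_
    simp only [hL]
    rw [fderiv_fderiv_comp_affine hφ, hs]
    rfl
  simp only [hamExpr, h1, hV]

theorem affinePull_mem_hamGraph (R : SO3) (b : E3)
    (hV : ∀ x : Config N, V (fun k => R.1 (x k + b)) = V x) (p : L2 N × L2 N)
    (hp : p ∈ hamGraph m V) :
    (affinePull N R b p.1, affinePull N R b p.2) ∈ hamGraph m V := by
  obtain ⟨φ, hφ, h1, h2⟩ := hp
  have hmp := (measurePreserving_affine_config N R b).quasiMeasurePreserving
  let e : Config N ≃ₜ Config N :=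
    Homeomorph.piCongrRight fun _ => (Homeomorph.addRight b).trans R.1.toHomeomorph
  have hR : ContDiff ℝ ∞ (R.1 : E3 → E3) :=
    (R.1.toContinuousLinearEquiv : E3 →L[ℝ] E3).contDiff
  refine ⟨fun x => φ fun k => R.1 (x k + b), ⟨?_, ?_⟩, ?_, ?_⟩
  · exact hφ.1.comp (contDiff_pi.2 fun k => hR.comp ((contDiff_apply ℝ E3 k).add contDiff_const))
  · exact hφ.2.comp_homeomorph e
  · exact (coeFn_affinePull R b p.1).trans (hmp.ae_eq_comp h1)
  · refine (coeFn_affinePull R b p.2).trans ((hmp.ae_eq_comp h2).trans ?_)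
    exact Filter.Eventually.of_forall fun x =>
      (hamExpr_comp_affine (contDiff_infty.1 hφ.1 2) R b hV x).symm

theorem evolution_affinePull (h : IsSelfAdjoint (hamiltonian m V).closure) (R : SO3) (b : E3)
    (hV : ∀ x : Config N, V (fun k => R.1 (x k + b)) = V x) (t : ℝ) (ψ : L2 N) :
    affinePull N R b (evolution m V t ψ) = evolution m V t (affinePull N R b ψ) :=
  evolution_comm h (affinePull N R b).toContinuousLinearMap
    (affinePull_mem_hamGraph R b hV) t ψ

theorem jacobi_affine (hm : ∀ k, 0 < m k) (R : SO3) (b : E3) (x : Config N) :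
    (jacobi m fun k => R.1 (x k + b)) = fun k => R.1 (jacobi m x k) := by
  funext k
  rw [jacobi_eq_sum, jacobi_eq_sum]
  simp only [map_add, smul_add, Finset.sum_add_distrib, ← Finset.sum_smul, sum_jacobiCoeff hm,
    zero_smul, add_zero, map_sum, map_smul]

theorem centreOfMass_affine (hN : 1 ≤ N) (hm : ∀ k, 0 < m k) (R : SO3) (b : E3) (x : Config N) :
    (centreOfMass m fun k => R.1 (x k + b)) = R.1 (centreOfMass m x + b) := by
  have hM : ∑ j, m j ≠ 0 := by
    have : Nonempty (Fin N) := ⟨⟨0, hN⟩⟩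
    exact (Finset.sum_pos (fun j _ => hm j) Finset.univ_nonempty).ne'
  simp only [centreOfMass, map_add, smul_add, Finset.sum_add_distrib, ← Finset.sum_smul, map_sum,
    map_smul, smul_smul, inv_mul_cancel₀ hM, one_smul]

theorem affinePull_affinePull (R R' : SO3) (b b' : E3) (ψ : L2 N) :
    affinePull N R b (affinePull N R' b' ψ) = affinePull N (R' * R) (b + R⁻¹.1 b') ψ := by
  refine Lp.ext ?_
  have h2 := (measurePreserving_affine_config N R b).quasiMeasurePreserving.ae
    (coeFn_affinePull R' b' ψ)
  filter_upwards [coeFn_affinePull R b (affinePull N R' b' ψ), h2,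
    coeFn_affinePull (R' * R) (b + R⁻¹.1 b') ψ] with x h3 h4 h5
  rw [h3, h4, h5]
  congr 1
  funext k
  rw [Galilei.so3_mul_apply, ← add_assoc, map_add R.1 (x k + b), Galilei.so3_self_apply_inv]

end Affine

/-! ## Density of the products -/

section Density

variable {N : ℕ} {m : Fin N → ℝ}

/-- A π-λ argument. The whole space is itself a rectangle, which gives the step to complements. -/
theorem setIntegral_eq_zero_of_rectangles {α β : Type*} [MeasurableSpace α] [MeasurableSpace β]
    {μ : Measure (α × β)} {f : α × β → ℂ} (hf : Integrable f μ)
    (h : ∀ s t, MeasurableSet s → MeasurableSet t → ∫ z in s ×ˢ t, f z ∂μ = 0)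
    {S : Set (α × β)} (hS : MeasurableSet S) : ∫ z in S, f z ∂μ = 0 := by
  have huniv : ∫ z, f z ∂μ = 0 := by
    have := h Set.univ Set.univ MeasurableSet.univ MeasurableSet.univ
    rwa [Set.univ_prod_univ, setIntegral_univ] at this
  induction S, hS using MeasurableSpace.induction_on_inter generateFrom_prod.symm isPiSystem_prod with
  | empty => simp
  | basic S hS =>
    obtain ⟨s, hs, t, ht, rfl⟩ := hS
    exact h s t hs ht
  | compl S hS ih => rw [setIntegral_compl hS hf, ih, huniv, sub_zero]
  | iUnion S hd hS ih =>
    rw [integral_iUnion hS hd hf.integrableOn]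
    simp [ih]

/-- Integrability is only assumed on rectangles with sides of finite measure, so the space is
exhausted by such rectangles before the π-λ argument is applied to each restriction. -/
theorem ae_eq_zero_of_rectangles {α β : Type*} [MeasurableSpace α] [MeasurableSpace β]
    (μ : Measure α) (ν : Measure β) [SigmaFinite μ] [SigmaFinite ν]
    {ρ : Measure (α × β)} {f : α × β → ℂ}
    (hf : ∀ s t, MeasurableSet s → MeasurableSet t → μ s ≠ ⊤ → ν t ≠ ⊤ → IntegrableOn f (s ×ˢ t) ρ)
    (h : ∀ s t, MeasurableSet s → MeasurableSet t → μ s ≠ ⊤ → ν t ≠ ⊤ →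
      ∫ z in s ×ˢ t, f z ∂ρ = 0) : f =ᵐ[ρ] 0 := by
  have h1 : ∀ i j, f =ᵐ[ρ.restrict (spanningSets μ i ×ˢ spanningSets ν j)] 0 := by
    intro i j
    have hi := measurableSet_spanningSets μ i
    have hj := measurableSet_spanningSets ν j
    have hint := hf _ _ hi hj (measure_spanningSets_lt_top μ i).ne
      (measure_spanningSets_lt_top ν j).ne
    refine Integrable.ae_eq_zero_of_forall_setIntegral_eq_zero hint fun S hS _ => ?_
    refine setIntegral_eq_zero_of_rectangles hint (fun s t hs ht => ?_) hS
    rw [Measure.restrict_restrict (hs.prod ht), Set.prod_inter_prod]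
    exact h _ _ (hs.inter hi) (ht.inter hj)
      ((measure_mono Set.inter_subset_right).trans_lt (measure_spanningSets_lt_top μ i)).ne
      ((measure_mono Set.inter_subset_right).trans_lt (measure_spanningSets_lt_top ν j)).ne
  have h2 : (⋃ p : ℕ × ℕ, spanningSets μ p.1 ×ˢ spanningSets ν p.2) = Set.univ := by
    rw [Set.iUnion_prod, iUnion_spanningSets, iUnion_spanningSets, Set.univ_prod_univ]
  rw [← Measure.restrict_univ (μ := ρ), ← h2]
  exact (ae_restrict_iUnion_iff _ _).2 fun p => h1 p.1 p.2

/-- Products of indicator functions are indicators of rectangles in (X, y), so ψ has zero integral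
over each rectangle with sides of finite measure. -/
theorem eq_zero_of_forall_inner_tensor (hN : 1 ≤ N) (hm : ∀ k, 0 < m k) {ψ : L2 N}
    (hψ : ∀ f h, inner ℂ (tensor hN hm f h) ψ = 0) : ψ = 0 := by
  set e := (jacobiEquiv hN hm).toHomeomorph.toMeasurableEquiv with he
  have hmeas : ∀ s t, MeasurableSet s → MeasurableSet t → volume s ≠ ⊤ → volume t ≠ ⊤ →
      volume (e ⁻¹' (s ×ˢ t)) ≠ ⊤ := by
    intro s t hs ht hs' ht'
    obtain ⟨c, -, hc⟩ := exists_map_jacobiEquiv hN hm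
    have h1 : volume (e ⁻¹' (s ×ˢ t)) = (Measure.map (jacobiEquiv hN hm) volume) (s ×ˢ t) :=
      (e.map_apply _).symm
    rw [h1, hc, Measure.smul_apply, Measure.volume_eq_prod, Measure.prod_prod]
    exact ENNReal.mul_ne_top (by simp) (ENNReal.mul_ne_top hs' ht')
  have key : (fun z => ψ (e.symm z)) =ᵐ[Measure.map e volume] 0 := by
    refine ae_eq_zero_of_rectangles volume volume (fun s t hs ht hs' ht' => ?_)
      fun s t hs ht hs' ht' => ?_
    · rw [e.measurableEmbedding.integrableOn_map_iff]
      have h1 : IntegrableOn ψ (e ⁻¹' (s ×ˢ t)) volume :=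
        integrableOn_Lp_of_measure_ne_top ψ fact_one_le_two_ennreal.elim (hmeas s t hs ht hs' ht')
      have h2 : (fun z => ψ (e.symm z)) ∘ e = ψ := funext fun x => congrArg ψ (e.symm_apply_apply x)
      rwa [h2]
    · rw [e.measurableEmbedding.setIntegral_map]
      simp only [e.symm_apply_apply]
      have h2 := hψ (indicatorConstLp 2 hs hs' 1) (indicatorConstLp 2 ht ht' 1)
      have h3 : tensor hN hm (indicatorConstLp 2 hs hs' 1) (indicatorConstLp 2 ht ht' 1)
          = indicatorConstLp 2 (e.measurable (hs.prod ht)) (hmeas s t hs ht hs' ht') 1 := by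
        refine Lp.ext ((coeFn_tensor_of_ae_eq hN hm indicatorConstLp_coeFn
          indicatorConstLp_coeFn).trans (Filter.EventuallyEq.trans ?_ indicatorConstLp_coeFn.symm))
        refine Filter.Eventually.of_forall fun x => ?_
        have h4 : (x ∈ e ⁻¹' (s ×ˢ t)) ↔ centreOfMass m x ∈ s ∧ jacobi m x ∈ t := Iff.rfl
        by_cases h5 : centreOfMass m x ∈ s <;> by_cases h6 : jacobi m x ∈ t <;>
          simp [Set.indicator, h4, h5, h6]
      rwa [h3, L2.inner_indicatorConstLp_one] at h2
  refine Lp.ext (Filter.EventuallyEq.trans ?_ (Lp.coeFn_zero _ _ _).symm)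
  have := ae_of_ae_map e.measurable.aemeasurable key
  filter_upwards [this] with x hx
  simpa using hx

theorem ext_tensor (hN : 1 ≤ N) (hm : ∀ k, 0 < m k) {F G : L2 N →L[ℂ] L2 N}
    (h : ∀ f g, F (tensor hN hm f g) = G (tensor hN hm f g)) : F = G := by
  have h1 : (Submodule.span ℂ (Set.range fun p : _ × _ => tensor hN hm p.1 p.2)).topologicalClosure
      = ⊤ := by
    rw [Submodule.topologicalClosure_eq_top_iff, Submodule.eq_bot_iff]
    intro ψ hψ
    exact eq_zero_of_forall_inner_tensor hN hm fun f g =>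
      hψ _ (Submodule.subset_span ⟨(f, g), rfl⟩)
  refine ContinuousLinearMap.ext_on (Submodule.dense_iff_topologicalClosure_eq_top.2 h1) ?_
  rintro _ ⟨p, rfl⟩
  exact h p.1 p.2

theorem linearIsometry_ext_tensor (hN : 1 ≤ N) (hm : ∀ k, 0 < m k) {F G : L2 N →ₗᵢ[ℂ] L2 N}
    (h : ∀ f g, F (tensor hN hm f g) = G (tensor hN hm f g)) (ψ : L2 N) : F ψ = G ψ :=
  DFunLike.congr_fun (ext_tensor hN hm (F := F.toContinuousLinearMap)
    (G := G.toContinuousLinearMap) h) ψ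

end Density

/-! ## Fourier transforms of translations, rotations and boosts -/

section Fourier

open scoped SchwartzMap
open Complex (I)

theorem inner_apply_so3 (R : SO3) (y z : E3) : inner ℝ y (R.1 z) = inner ℝ (R⁻¹.1 y) z := by
  rw [← R.1.inner_map_map (R⁻¹.1 y) z, Galilei.so3_self_apply_inv]

/-- The transformation `f ↦ f(R (x + b))` of `L²(ℝ³)`. -/
def spacePull (R : SO3) (b : E3) :
    Lp ℂ 2 (volume : Measure E3) →ₗᵢ[ℂ] Lp ℂ 2 (volume : Measure E3) :=
  Lp.compMeasurePreservingₗᵢ ℂ _ (measurePreserving_affine R b)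

theorem coeFn_spacePull (R : SO3) (b : E3) (f : Lp ℂ 2 (volume : Measure E3)) :
    spacePull R b f =ᵐ[volume] fun x => f (R.1 (x + b)) :=
  Lp.coeFn_compMeasurePreserving f (measurePreserving_affine R b)

theorem coeFn_spacePull_of_ae_eq (R : SO3) (b : E3) {f : Lp ℂ 2 (volume : Measure E3)}
    {f' : E3 → ℂ} (hf : f =ᵐ[volume] f') :
    spacePull R b f =ᵐ[volume] fun x => f' (R.1 (x + b)) :=
  (coeFn_spacePull R b f).trans ((measurePreserving_affine R b).quasiMeasurePreserving.ae_eq_comp hf)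

theorem hasTemperateGrowth_affine (R : SO3) (b : E3) :
    Function.HasTemperateGrowth fun x : E3 => R.1 (x + b) := by
  have h1 : Function.HasTemperateGrowth fun x : E3 => x + b := by fun_prop
  exact (R.1.toContinuousLinearEquiv : E3 →L[ℝ] E3).hasTemperateGrowth.comp h1

/-- The transformation `f ↦ f(R (x + b))` of Schwartz functions. -/
def schwartzPull (R : SO3) (b : E3) : 𝓢(E3, ℂ) →L[ℂ] 𝓢(E3, ℂ) :=
  SchwartzMap.compCLMOfAntilipschitz ℂ (K := 1) (hasTemperateGrowth_affine R b)
    ((R.1.isometry.comp (isometry_add_right b)).antilipschitz)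

theorem schwartzPull_apply (R : SO3) (b : E3) (f : 𝓢(E3, ℂ)) (x : E3) :
    schwartzPull R b f x = f (R.1 (x + b)) := rfl

theorem spacePull_toLp (R : SO3) (b : E3) (f : 𝓢(E3, ℂ)) :
    spacePull R b (f.toLp 2 volume) = (schwartzPull R b f).toLp 2 volume := by
  refine Lp.ext ?_
  have h := coeFn_spacePull_of_ae_eq R b (f := f.toLp 2 volume) (f.coeFn_toLp 2 volume)
  filter_upwards [h, (schwartzPull R b f).coeFn_toLp 2 volume] with x h1 h2
  rw [h1, h2]
  rfl

theorem hasTemperateGrowth_phase {θ : E3 → ℝ} (hθ : Function.HasTemperateGrowth θ) :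
    Function.HasTemperateGrowth fun x => Complex.exp (I * θ x) :=
  hasTemperateGrowth_exp_I.comp hθ

/-- The phase `2π ⟪w, x⟫ + s`. -/
def linPhase (w : E3) (s : ℝ) (x : E3) : ℝ := 2 * Real.pi * inner ℝ w x + s

theorem hasTemperateGrowth_linPhase (w : E3) (s : ℝ) :
    Function.HasTemperateGrowth (linPhase w s) := by
  have h1 : Function.HasTemperateGrowth fun x => inner ℝ w x := (innerSL ℝ w).hasTemperateGrowth
  unfold linPhase
  fun_prop

theorem continuous_linPhase (w : E3) (s : ℝ) : Continuous (linPhase w s) :=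
  (hasTemperateGrowth_linPhase w s).1.continuous

theorem continuous_fourier_Lp :
    Continuous fun f : Lp ℂ 2 (volume : Measure E3) => 𝓕 f :=
  (Lp.fourierTransformₗᵢ E3 ℂ).continuous

/-- On Schwartz functions this is a change of variables: the rotation passes through the transform
and the translation becomes a phase. Density and continuity give L². -/
theorem fourier_spacePull (R : SO3) (b : E3) (f : Lp ℂ 2 (volume : Measure E3)) :
    𝓕 (spacePull R b f)
      = phaseIsometry (linPhase b 0) (continuous_linPhase b 0) (spacePull R 0 (𝓕 f)) := by
  refine eq_of_forall_schwartz (F := fun f => 𝓕 (spacePull R b f))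
    (G := fun f => phaseIsometry (linPhase b 0) (continuous_linPhase b 0) (spacePull R 0 (𝓕 f)))
    (continuous_fourier_Lp.comp (spacePull R b).continuous)
    ((phaseIsometry _ _).continuous.comp ((spacePull R 0).continuous.comp continuous_fourier_Lp))
    (fun f => ?_) f
  simp only [spacePull_toLp, SchwartzMap.toLp_fourier_eq,
    phaseIsometry_toLp (hasTemperateGrowth_linPhase b 0)]
  congr 1
  ext κ
  rw [SchwartzMap.smulLeftCLM_apply_apply
    (hasTemperateGrowth_phase (hasTemperateGrowth_linPhase b 0)), schwartzPull_apply,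
    SchwartzMap.fourier_coe, SchwartzMap.fourier_coe, add_zero,
    ← Real.fourier_comp_linearIsometry, Real.fourier_eq', Real.fourier_eq', smul_eq_mul,
    ← integral_const_mul]
  refine Eq.trans ?_ (integral_add_right_eq_self _ b)
  refine integral_congr_ae (Filter.Eventually.of_forall fun x => ?_)
  simp only [schwartzPull_apply, Function.comp_apply, smul_eq_mul]
  rw [← mul_assoc, ← Complex.exp_add]
  congr 2
  simp only [linPhase, inner_add_left]
  push_cast
  ring

theorem fourier_phase (w : E3) (s : ℝ) (f : Lp ℂ 2 (volume : Measure E3)) :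
    𝓕 (phaseIsometry (linPhase w s) (continuous_linPhase w s) f)
      = phaseIsometry (fun _ => s) continuous_const (spacePull 1 (-w) (𝓕 f)) := by
  refine eq_of_forall_schwartz
    (F := fun f => 𝓕 (phaseIsometry (linPhase w s) (continuous_linPhase w s) f))
    (G := fun f => phaseIsometry (fun _ => s) continuous_const (spacePull 1 (-w) (𝓕 f)))
    (continuous_fourier_Lp.comp (phaseIsometry _ _).continuous)
    ((phaseIsometry _ _).continuous.comp ((spacePull 1 (-w)).continuous.comp continuous_fourier_Lp))
    (fun f => ?_) f
  have hs : Function.HasTemperateGrowth fun _ : E3 => s := by fun_prop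
  simp only [SchwartzMap.toLp_fourier_eq, spacePull_toLp,
    phaseIsometry_toLp (hasTemperateGrowth_linPhase w s), phaseIsometry_toLp hs]
  congr 1
  ext κ
  rw [SchwartzMap.smulLeftCLM_apply_apply (hasTemperateGrowth_phase hs), schwartzPull_apply,
    SchwartzMap.fourier_coe, SchwartzMap.fourier_coe, Real.fourier_eq', Real.fourier_eq',
    smul_eq_mul, ← integral_const_mul]
  refine integral_congr_ae (Filter.Eventually.of_forall fun x => ?_)
  simp only []
  rw [SchwartzMap.smulLeftCLM_apply_apply
    (hasTemperateGrowth_phase (hasTemperateGrowth_linPhase w s)), smul_eq_mul, smul_eq_mul,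
    smul_eq_mul, ← mul_assoc, ← mul_assoc, ← Complex.exp_add, ← Complex.exp_add]
  congr 2
  simp only [linPhase, Galilei.so3_one_apply, inner_add_right, inner_neg_right,
    real_inner_comm w x]
  push_cast
  ring

theorem fourier_freeEvolution (M t : ℝ) (f : Lp ℂ 2 (volume : Measure E3)) :
    𝓕 (freeEvolution M t f) = phaseIsometry _ (continuous_kinSymbol M t) (𝓕 f) := by
  rw [freeEvolution_apply]
  exact FourierTransform.fourier_fourierInv_eq _

theorem fourier_Lp_injective :
    Function.Injective fun f : Lp ℂ 2 (volume : Measure E3) => 𝓕 f :=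
  (Lp.fourierTransformₗᵢ E3 ℂ).injective

theorem coeFn_phaseIsometry_of_ae_eq {α : Type*} [TopologicalSpace α] [MeasurableSpace α]
    [OpensMeasurableSpace α] {μ : Measure α} {θ : α → ℝ} (hθ : Continuous θ) {f : Lp ℂ 2 μ}
    {f' : α → ℂ} (hf : f =ᵐ[μ] f') :
    phaseIsometry θ hθ f =ᵐ[μ] fun x => Complex.exp (I * θ x) * f' x := by
  filter_upwards [coeFn_phaseIsometry hθ f, hf] with x h1 h2
  rw [h1, h2]

/-- In momentum space this is P²/2M = (P - Mv)²/2M + v·(P - Mv) + Mv²/2: the middle term is the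
translation by tv and the last one the scalar phase. -/
theorem freeEvolution_boost {M : ℝ} (hM : M ≠ 0) (t : ℝ) (v : E3)
    (f : Lp ℂ 2 (volume : Measure E3)) :
    freeEvolution M t (phaseIsometry _ (continuous_linPhase ((M / (2 * Real.pi)) • v) 0) f)
      = phaseIsometry _ (continuous_linPhase ((M / (2 * Real.pi)) • v) (-(t * M * ‖v‖ ^ 2 / 2)))
        (spacePull 1 (-(t • v)) (freeEvolution M t f)) := by
  refine fourier_Lp_injective ?_
  simp only [fourier_freeEvolution, fourier_phase, fourier_spacePull]
  set F := 𝓕 f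
  refine Lp.ext ?_
  have h1 := coeFn_phaseIsometry_of_ae_eq (continuous_kinSymbol M t)
    (coeFn_phaseIsometry_of_ae_eq (θ := fun _ : E3 => (0 : ℝ)) continuous_const
      (coeFn_spacePull 1 (-((M / (2 * Real.pi)) • v)) F))
  have h2 := coeFn_phaseIsometry_of_ae_eq (θ := fun _ : E3 => -(t * M * ‖v‖ ^ 2 / 2))
    continuous_const (coeFn_spacePull_of_ae_eq 1 (-((M / (2 * Real.pi)) • v))
      (coeFn_phaseIsometry_of_ae_eq (continuous_linPhase (-(t • v)) 0)
        (coeFn_spacePull_of_ae_eq 1 0 (coeFn_phaseIsometry (continuous_kinSymbol M t) F))))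
  filter_upwards [h1, h2] with κ h3 h4
  rw [h3, h4]
  simp only [Galilei.so3_one_apply, add_zero, ← mul_assoc, ← Complex.exp_add]
  congr 2
  have hpi := Real.pi_ne_zero
  rw [← mul_add, ← mul_add, ← mul_add, ← Complex.ofReal_add, ← Complex.ofReal_add,
    ← Complex.ofReal_add]
  congr 2
  simp only [linPhase, kinSymbol, ← sub_eq_add_neg, norm_sub_sq_real, inner_sub_right,
    inner_smul_right, inner_neg_left, inner_smul_left, real_inner_self_eq_norm_sq, norm_smul, Real.norm_eq_abs,
    mul_pow, sq_abs, real_inner_comm v κ, RCLike.conj_to_real]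
  field_simp
  ring

/-- Splits the momentum-space formula into pullback, free evolution and boost, in the order used by
`galOp`, so that the two can be compared factor by factor on products. -/
theorem comOp_eq (M : ℝ) (γ : Galilei → ℝ) (g : Galilei)
    (f : Lp ℂ 2 (volume : Measure E3)) :
    comOp M γ g f
      = phaseIsometry _ (continuous_linPhase ((M / (2 * Real.pi)) • g.v) (M * γ g))
        (freeEvolution M (-g.c) (spacePull g.R⁻¹ (g.c • g.v - g.a) f)) := by
  refine fourier_Lp_injective ?_
  simp only [fourier_freeEvolution, fourier_phase, fourier_spacePull]
  have h0 : 𝓕 (comOp M γ g f) = phaseIsometry _ (continuous_momentumPhase M γ g)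
      (spacePull g.R⁻¹ (-((M / (2 * Real.pi)) • g.v)) (𝓕 f)) :=
    FourierTransform.fourier_fourierInv_eq _
  rw [h0]
  set F := 𝓕 f
  refine Lp.ext ?_
  have h1 := coeFn_phaseIsometry_of_ae_eq (continuous_momentumPhase M γ g)
      (coeFn_spacePull g.R⁻¹ (-((M / (2 * Real.pi)) • g.v)) F)
  have h2 := coeFn_phaseIsometry_of_ae_eq (θ := fun _ : E3 => M * γ g)
    continuous_const (coeFn_spacePull_of_ae_eq 1 (-((M / (2 * Real.pi)) • g.v))
      (coeFn_phaseIsometry_of_ae_eq (continuous_kinSymbol M (-g.c))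
        (coeFn_phaseIsometry_of_ae_eq (continuous_linPhase (g.c • g.v - g.a) 0)
          (coeFn_spacePull g.R⁻¹ 0 F))))
  filter_upwards [h1, h2] with κ h3 h4
  rw [h3, h4]
  simp only [Galilei.so3_one_apply, add_zero, ← mul_assoc, ← Complex.exp_add]
  congr 2
  have hpi := Real.pi_ne_zero
  rw [← mul_add, ← mul_add, ← Complex.ofReal_add, ← Complex.ofReal_add]
  congr 2
  have h5 : (2 * Real.pi) • κ - M • g.v
      = (2 * Real.pi) • (κ + -((M / (2 * Real.pi)) • g.v)) := by
    rw [smul_add, smul_neg, smul_smul, mul_div_cancel₀ _ (by positivity), sub_eq_add_neg]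
  rw [momentumPhase, h5, linPhase, kinSymbol, norm_smul, inner_smul_right, mul_pow, norm_mul,
    Real.norm_eq_abs, Real.norm_eq_abs, mul_pow, sq_abs, sq_abs]
  ring

end Fourier

/-! ## The Galileian operators for fixed masses -/

section GalileanOperators

open Complex (I)

variable {N : ℕ} {m : Fin N → ℝ} {V : Config N → ℝ} {γ : Galilei → ℝ}

/-- The phase `∑ m_j v · x_j + s`. -/
def boostPhase (m : Fin N → ℝ) (v : E3) (s : ℝ) (x : Config N) : ℝ :=
  ∑ j, m j * inner ℝ v (x j) + s

theorem continuous_boostPhase (m : Fin N → ℝ) (v : E3) (s : ℝ) :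
    Continuous (boostPhase m v s) := by
  unfold boostPhase
  fun_prop

/-- Multiplication by `e^{i (∑ m_j v · x_j + s)}`. -/
def boost (m : Fin N → ℝ) (v : E3) (s : ℝ) : L2 N →ₗᵢ[ℂ] L2 N :=
  phaseIsometry (boostPhase m v s) (continuous_boostPhase m v s)

theorem coeFn_boost (v : E3) (s : ℝ) (ψ : L2 N) :
    boost m v s ψ =ᵐ[volume] fun x => Complex.exp (I * boostPhase m v s x) * ψ x :=
  coeFn_phaseIsometry _ ψ

theorem boost_boost (v v' : E3) (s s' : ℝ) (ψ : L2 N) :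
    boost m v s (boost m v' s' ψ) = boost m (v' + v) (s' + s) ψ := by
  refine Lp.ext ?_
  filter_upwards [coeFn_phaseIsometry_of_ae_eq (continuous_boostPhase m v s) (coeFn_boost v' s' ψ),
    coeFn_boost (m := m) (v' + v) (s' + s) ψ] with x h1 h2
  rw [boost, h1, h2, ← mul_assoc, ← Complex.exp_add, ← mul_add, ← Complex.ofReal_add]
  congr 4
  simp only [boostPhase, inner_add_left, mul_add, Finset.sum_add_distrib]
  ring

theorem boost_zero (s : ℝ) (ψ : L2 N) : boost m 0 s ψ = Complex.exp (I * s) • ψ := by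
  refine Lp.ext ?_
  filter_upwards [coeFn_boost (m := m) 0 s ψ, Lp.coeFn_smul (Complex.exp (I * s)) ψ] with x h1 h2
  rw [h1, h2]
  simp [boostPhase]

theorem boost_eq_smul (v : E3) (s s' : ℝ) (ψ : L2 N) :
    boost m v (s + s') ψ = Complex.exp (I * s') • boost m v s ψ := by
  rw [← boost_zero (m := m), boost_boost, add_zero]

theorem affinePull_boost (R : SO3) (b v : E3) (s : ℝ) (ψ : L2 N) :
    affinePull N R b (boost m v s ψ)
      = boost m (R⁻¹.1 v) (s + (∑ j, m j) * inner ℝ (R⁻¹.1 v) b) (affinePull N R b ψ) := by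
  refine Lp.ext ?_
  have h1 := (measurePreserving_affine_config N R b).quasiMeasurePreserving.ae_eq_comp
    (coeFn_boost (m := m) v s ψ)
  filter_upwards [coeFn_affinePull R b (boost m v s ψ), h1, coeFn_phaseIsometry_of_ae_eq
    (continuous_boostPhase m (R⁻¹.1 v) (s + (∑ j, m j) * inner ℝ (R⁻¹.1 v) b))
    (coeFn_affinePull R b ψ)] with x h2 h3 h4
  refine (h2.trans h3).trans (Eq.trans ?_ h4.symm)
  simp only [Function.comp_apply]
  congr 4
  simp only [boostPhase, inner_apply_so3, inner_add_right, mul_add, Finset.sum_add_distrib,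
    Finset.sum_mul]
  ring

theorem affinePull_one_zero (ψ : L2 N) : affinePull N 1 0 ψ = ψ := by
  refine Lp.ext ?_
  filter_upwards [coeFn_affinePull 1 0 ψ] with x h
  rw [h]
  simp

theorem affinePull_tensor (hN : 1 ≤ N) (hm : ∀ k, 0 < m k) (R : SO3) (b : E3)
    (f : Lp ℂ 2 (volume : Measure E3)) (h : L2 (N - 1)) :
    affinePull N R b (tensor hN hm f h)
      = tensor hN hm (spacePull R b f) (affinePull (N - 1) R 0 h) := by
  refine Lp.ext ?_
  have h1 := (measurePreserving_affine_config N R b).quasiMeasurePreserving.ae_eq_comp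
    (coeFn_tensor hN hm f h)
  filter_upwards [coeFn_affinePull R b (tensor hN hm f h), h1,
    coeFn_tensor_of_ae_eq hN hm (coeFn_spacePull R b f) (coeFn_affinePull R 0 h)] with x h2 h3 h4
  rw [h2, h4]
  refine h3.trans ?_
  simp only [Function.comp_apply]
  rw [centreOfMass_affine hN hm, jacobi_affine hm]
  simp only [add_zero]

theorem sum_mass_pos (hN : 1 ≤ N) (hm : ∀ k, 0 < m k) : 0 < ∑ j, m j := by
  have : Nonempty (Fin N) := ⟨⟨0, hN⟩⟩
  exact Finset.sum_pos (fun j _ => hm j) Finset.univ_nonempty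

/-- The mass-weighted sum ∑ m_j v·x_j equals M v·X, so the internal factor is untouched. The 2π in
the frequency comes from the normalisation of the Fourier transform. -/
theorem boost_tensor (hN : 1 ≤ N) (hm : ∀ k, 0 < m k) (v : E3) (s : ℝ)
    (f : Lp ℂ 2 (volume : Measure E3)) (h : L2 (N - 1)) :
    boost m v s (tensor hN hm f h) = tensor hN hm
      (phaseIsometry _ (continuous_linPhase (((∑ j, m j) / (2 * Real.pi)) • v) s) f) h := by
  refine Lp.ext ?_
  filter_upwards [coeFn_phaseIsometry_of_ae_eq (continuous_boostPhase m v s)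
    (coeFn_tensor hN hm f h), coeFn_tensor_of_ae_eq hN hm
      (coeFn_phaseIsometry (continuous_linPhase (((∑ j, m j) / (2 * Real.pi)) • v) s) f)
      (Filter.EventuallyEq.refl _ h)] with x h1 h2
  rw [boost, h1, h2, mul_assoc]
  congr 4
  have hpi := Real.pi_ne_zero
  have hM := (sum_mass_pos hN hm).ne'
  rw [boostPhase, linPhase, inner_smul_left, centreOfMass, inner_smul_right, inner_sum]
  simp only [inner_smul_right, RCLike.conj_to_real]
  field_simp

/-- Boosts do not preserve the graph of H, so `evolution_comm` is of no use here. On products the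
evolution factorizes and the claim is `freeEvolution_boost` for the centre of mass. -/
theorem evolution_boost_zero (hN : 1 ≤ N) (hm : ∀ k, 0 < m k) (hV : IsGalileanPotential m V)
    (t : ℝ) (v : E3) (ψ : L2 N) : evolution m V t (boost m v 0 ψ)
      = boost m v (-(t * (∑ j, m j) * ‖v‖ ^ 2 / 2))
        (affinePull N 1 (-(t • v)) (evolution m V t ψ)) := by
  obtain ⟨F, hF⟩ : ∃ F : L2 N →ₗᵢ[ℂ] L2 N, ∀ ψ, F ψ = evolution m V t (boost m v 0 ψ) :=
    ⟨(evolution m V t).toLinearIsometry.comp (boost m v 0), fun _ => rfl⟩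
  obtain ⟨G, hG⟩ : ∃ G : L2 N →ₗᵢ[ℂ] L2 N, ∀ ψ, G ψ
      = boost m v (-(t * (∑ j, m j) * ‖v‖ ^ 2 / 2))
        (affinePull N 1 (-(t • v)) (evolution m V t ψ)) :=
    ⟨(boost m v (-(t * (∑ j, m j) * ‖v‖ ^ 2 / 2))).comp ((affinePull N 1 (-(t • v))).comp
        (evolution m V t).toLinearIsometry), fun _ => rfl⟩
  rw [← hF, ← hG]
  refine linearIsometry_ext_tensor hN hm (fun f h => ?_) ψ
  rw [hF, hG, boost_tensor, evolution_tensor hN hm hV, evolution_tensor hN hm hV,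
    affinePull_tensor]
  refine Eq.trans ?_ (boost_tensor hN hm v _ _ _).symm
  exact congrArg₂ (fun f h => tensor hN hm f h)
    (freeEvolution_boost (sum_mass_pos hN hm).ne' t v f) (affinePull_one_zero _).symm

theorem evolution_boost (hN : 1 ≤ N) (hm : ∀ k, 0 < m k) (hV : IsGalileanPotential m V)
    (t : ℝ) (v : E3) (s : ℝ) (ψ : L2 N) :
    evolution m V t (boost m v s ψ) = boost m v (s - t * (∑ j, m j) * ‖v‖ ^ 2 / 2)
      (affinePull N 1 (-(t • v)) (evolution m V t ψ)) := by
  have h2 := boost_eq_smul (m := m) v 0 s ψ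
  rw [zero_add] at h2
  have h3 : -(t * (∑ j, m j) * ‖v‖ ^ 2 / 2) + s = s - t * (∑ j, m j) * ‖v‖ ^ 2 / 2 := by ring
  rw [h2, (evolution m V t).map_smul,
    evolution_boost_zero hN hm hV, ← h3]
  exact (boost_eq_smul v _ s _).symm

/-! ### The operators U_g in normal form and their composition -/

theorem affine_invariant (hV : IsGalileanPotential m V) (R : SO3) (b : E3) (x : Config N) :
    V (fun k => R.1 (x k + b)) = V x := by
  rw [hV.rotation R fun k => x k + b, hV.translation]

/-- The operator `U_g` for the masses `m`:
`ψ ↦ e^{i ∑ m_j (v · x_j + γ_g)} e^{icH} ψ(R⁻¹(x_k + c v - a))`. -/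
def galOp (m : Fin N → ℝ) (V : Config N → ℝ) (γ : Galilei → ℝ) (g : Galilei) :
    L2 N →ₗᵢ[ℂ] L2 N :=
  (boost m g.v ((∑ j, m j) * γ g)).comp ((evolution m V (-g.c)).toLinearIsometry.comp
    (affinePull N g.R⁻¹ (g.c • g.v - g.a)))

theorem galOp_apply (g : Galilei) (ψ : L2 N) : galOp m V γ g ψ
    = boost m g.v ((∑ j, m j) * γ g) (evolution m V (-g.c)
      (affinePull N g.R⁻¹ (g.c • g.v - g.a) ψ)) := rfl

/-- The inner boost is moved left through pullback and evolution and the inner pullback right to the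
other pullbacks, until the product again reads boost, evolution, pullback. -/
theorem galOp_galOp (hN : 1 ≤ N) (hm : ∀ k, 0 < m k) (hV : IsGalileanPotential m V)
    (g' g : Galilei) (ψ : L2 N) : galOp m V γ g' (galOp m V γ g ψ)
      = Complex.exp (I * ((∑ j, m j) * xi γ g' g : ℝ)) • galOp m V γ (g' * g) ψ := by
  have hU := isUnitaryGroupOf_evolution hV.essSelfAdjoint
  have hA := fun R b => evolution_affinePull hV.essSelfAdjoint R b (affine_invariant hV R b)
  rw [galOp_apply, galOp_apply, galOp_apply, affinePull_boost, evolution_boost hN hm hV,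
    boost_boost, ← boost_eq_smul, hA g'.R⁻¹, ← hU.map_add, hA 1, affinePull_affinePull,
    affinePull_affinePull]
  have h1 : (g.R⁻¹ * (g'.R⁻¹ * 1) : SO3) = (g' * g).R⁻¹ := by
    rw [mul_one, Galilei.mul_R, mul_inv_rev]
  have h2 : -(-g'.c • g'.R⁻¹⁻¹.1 g.v) + (1 : SO3)⁻¹.1 (g'.c • g'.v - g'.a)
        + (g'.R⁻¹ * 1)⁻¹.1 (g.c • g.v - g.a)
      = (g' * g).c • (g' * g).v - (g' * g).a := by
    simp only [mul_one, inv_inv, inv_one, Galilei.so3_one_apply, map_sub, map_smul, Galilei.mul_c,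
      Galilei.mul_v, Galilei.mul_a]
    module
  have h3 : -g'.c + -g.c = -(g' * g).c := by
    rw [Galilei.mul_c]
    ring
  have h4 : g'.R⁻¹⁻¹.1 g.v + g'.v = (g' * g).v := by rw [inv_inv, Galilei.mul_v]
  -- The scalars collected from the two exchanges are M times ξ, evaluated at the origin of
  -- space-time as in the definition of `xi`.
  have h5 : (∑ j, m j) * γ g + (∑ j, m j) * inner ℝ (g'.R⁻¹⁻¹.1 g.v) (g'.c • g'.v - g'.a)
        - -g'.c * (∑ j, m j) * ‖g'.R⁻¹⁻¹.1 g.v‖ ^ 2 / 2 + (∑ j, m j) * γ g'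
      = (∑ j, m j) * γ (g' * g) + (∑ j, m j) * xi γ g' g := by
    simp only [inv_inv, xi, phi, Galilei.act, LinearIsometryEquiv.norm_map, map_zero, add_zero,
      zero_smul, Galilei.inv_a, Galilei.inv_c, inner_zero_right, mul_zero, zero_div, sub_zero,
      zero_add, inner_apply_so3]
    ring
  rw [h1, h2, h3, h4, h5]

theorem galOp_one (hV : IsGalileanPotential m V) (ψ : L2 N) :
    galOp m V γ 1 ψ = Complex.exp (I * ((∑ j, m j) * γ 1 : ℝ)) • ψ := by
  have hU := isUnitaryGroupOf_evolution hV.essSelfAdjoint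
  rw [galOp_apply]
  simp only [Galilei.one_v, Galilei.one_c, Galilei.one_R, Galilei.one_a, inv_one, smul_zero,
    sub_zero, neg_zero]
  rw [affinePull_one_zero, hU.map_zero, boost_zero]

theorem galOp_tensor (hN : 1 ≤ N) (hm : ∀ k, 0 < m k) (hV : IsGalileanPotential m V)
    (g : Galilei) (f : Lp ℂ 2 (volume : Measure E3)) (h : L2 (N - 1)) :
    galOp m V γ g (tensor hN hm f h)
      = tensor hN hm (comOp (∑ j, m j) γ g f) (internalOp m V g h) := by
  rw [galOp_apply, affinePull_tensor, evolution_tensor hN hm hV, boost_tensor, comOp_eq]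
  rfl

theorem isGalileanOp_galOp (hN : 1 ≤ N) (hm : ∀ k, 0 < m k) (hV : IsGalileanPotential m V)
    (g : Galilei) : IsGalileanOp m V γ g (galOp m V γ g).toContinuousLinearMap := by
  intro f h ψ hψ
  have h1 : ψ = tensor hN hm f h := Lp.ext (hψ.trans (coeFn_tensor hN hm f h).symm)
  rw [h1]
  change galOp m V γ g (tensor hN hm f h) =ᵐ[volume] _
  rw [galOp_tensor hN hm hV]
  exact coeFn_tensor hN hm _ _

/-- Moving the evolution through the boost adds -v²t/2 for each unit of mass, so the total phase is
∑ m_k φ_g(t, x_k): this is how φ_g enters the classical map. -/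
theorem evolution_galOp (hN : 1 ≤ N) (hm : ∀ k, 0 < m k) (hV : IsGalileanPotential m V)
    (t : ℝ) (g : Galilei) (ψ : L2 N) : evolution m V t (galOp m V γ g ψ)
      = boost m g.v ((∑ j, m j) * (γ g - ‖g.v‖ ^ 2 * t / 2))
        (affinePull N g.R⁻¹ ((g.c - t) • g.v - g.a) (evolution m V (t - g.c) ψ)) := by
  have hU := isUnitaryGroupOf_evolution hV.essSelfAdjoint
  have hA := fun R b => evolution_affinePull hV.essSelfAdjoint R b (affine_invariant hV R b)
  rw [galOp_apply, evolution_boost hN hm hV, ← hU.map_add, ← hA, affinePull_affinePull, mul_one]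
  have h1 : -(t • g.v) + (1 : SO3)⁻¹.1 (g.c • g.v - g.a) = (g.c - t) • g.v - g.a := by
    simp only [inv_one, Galilei.so3_one_apply]
    module
  have h2 : (∑ j, m j) * γ g - t * (∑ j, m j) * ‖g.v‖ ^ 2 / 2
      = (∑ j, m j) * (γ g - ‖g.v‖ ^ 2 * t / 2) := by ring
  rw [h1, h2, ← sub_eq_add_neg]

end GalileanOperators

/-! ## The representation of the central extension -/

section Representation

open Complex (I)

/-- A multiplicative family of isometries is a homomorphism into the unitary group. -/
def unitaryHom {G E : Type*} [Group G] [NormedAddCommGroup E] [InnerProductSpace ℂ E]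
    [CompleteSpace E] (T : G → E →ₗᵢ[ℂ] E) (h1 : ∀ x, T 1 x = x)
    (hmul : ∀ a b x, T a (T b x) = T (a * b) x) : G →* unitary (E →L[ℂ] E) :=
  (Unitary.linearIsometryEquiv (𝕜 := ℂ) (H := E)).symm.toMonoidHom.comp
    { toFun := fun a =>
        { T a with
          invFun := T a⁻¹
          left_inv := fun x => (hmul _ _ x).trans (by rw [inv_mul_cancel, h1])
          right_inv := fun x => (hmul _ _ x).trans (by rw [mul_inv_cancel, h1]) }
      map_one' := LinearIsometryEquiv.ext h1
      map_mul' := fun a b => LinearIsometryEquiv.ext fun x => (hmul a b x).symm }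

/-- The direct sum of linear isometries. -/
def lpIsometry {ι : Type*} {E : ι → Type*} [∀ i, NormedAddCommGroup (E i)]
    [∀ i, NormedSpace ℂ (E i)] (T : ∀ i, E i →ₗᵢ[ℂ] E i) : lp E 2 →ₗᵢ[ℂ] lp E 2 where
  toFun f := ⟨fun i => T i (f i), by
    have h : Memℓp (fun i => f i) 2 := lp.memℓp f
    have h' : Memℓp (fun i => T i (f i)) 2 := by
      rw [memℓp_gen_iff (by norm_num)] at h ⊢
      simpa using h
    exact h'⟩
  map_add' f g := lp.ext (funext fun i => map_add (T i) (f i) (g i))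
  map_smul' c f := lp.ext (funext fun i => map_smul (T i) c (f i))
  norm_map' f := by
    rw [lp.norm_eq_tsum_rpow (by norm_num), lp.norm_eq_tsum_rpow (by norm_num)]
    congr 2
    funext i
    exact congrArg (· ^ _) ((T i).norm_map (f i))

/-- The multiple of a linear isometry by a phase. -/
def circleSmul {E : Type*} [NormedAddCommGroup E] [NormedSpace ℂ E] (c : Circle)
    (T : E →ₗᵢ[ℂ] E) : E →ₗᵢ[ℂ] E where
  toLinearMap := (c : ℂ) • T.toLinearMap
  norm_map' x := by
    change ‖(c : ℂ) • T x‖ = ‖x‖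
    rw [norm_smul, Circle.norm_coe, one_mul, T.norm_map]

variable {N : ℕ} {γ : Galilei → ℝ} {V : (Fin N → ℝ) → Config N → ℝ}

theorem masses_pos (n : Sector N) (k : Fin N) : 0 < masses n k :=
  Nat.cast_pos.2 (Int.natAbs_pos.2 (n k).2)

theorem sum_masses (n : Sector N) : ∑ j, masses n j = totalMass n := by
  simp [masses, totalMass]

/-- The restriction of `U_{(χ,g)}` to the sector `n`. -/
def sectorOp (V : (Fin N → ℝ) → Config N → ℝ) (n : Sector N) (p : CentralExtension γ) :
    L2 N →ₗᵢ[ℂ] L2 N :=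
  circleSmul (p.χ ^ totalMass n) (galOp (masses n) (V (masses n)) γ p.g)

theorem sectorOp_apply (n : Sector N) (p : CentralExtension γ) (ψ : L2 N) : sectorOp V n p ψ
    = ((p.χ ^ totalMass n : Circle) : ℂ) • galOp (masses n) (V (masses n)) γ p.g ψ := rfl

theorem exp_I_mul_totalMass (n : Sector N) (r : ℝ) :
    Complex.exp (I * ((∑ j, masses n j) * r : ℝ)) = ((Circle.exp r ^ totalMass n : Circle) : ℂ) := by
  rw [sum_masses, Circle.coe_pow, Circle.coe_exp, ← Complex.exp_nat_mul]
  congr 1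
  push_cast
  ring

/-- The multiplier in the sector is ω^M, and χ ↦ χ^M is a character, so the factor ω in the product
of the extension cancels the projective phase. -/
theorem sectorOp_sectorOp (hN : 1 ≤ N)
    (hV : ∀ n : Sector N, IsGalileanPotential (masses n) (V (masses n))) (n : Sector N)
    (p' p : CentralExtension γ) (ψ : L2 N) :
    sectorOp V n p' (sectorOp V n p ψ) = sectorOp V n (p' * p) ψ := by
  rw [sectorOp_apply, sectorOp_apply, sectorOp_apply, LinearIsometry.map_smul,
    galOp_galOp hN (masses_pos n) (hV n), exp_I_mul_totalMass, smul_smul, smul_smul,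
    ← Circle.coe_mul, ← Circle.coe_mul, ← mul_pow, ← mul_pow]
  rfl

/-- As γ_e is arbitrary the multiplier is not normalised: the unit of the extension carries
e^{-iγ_e}, which compensates the phase of U_e. -/
theorem sectorOp_one (hV : ∀ n : Sector N, IsGalileanPotential (masses n) (V (masses n)))
    (n : Sector N) (ψ : L2 N) : sectorOp V n (1 : CentralExtension γ) ψ = ψ := by
  change (((Circle.exp (γ 1))⁻¹ ^ totalMass n : Circle) : ℂ)
    • galOp (masses n) (V (masses n)) γ 1 ψ = ψ
  rw [galOp_one (hV n), exp_I_mul_totalMass, smul_smul, ← Circle.coe_mul, ← mul_pow,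
    inv_mul_cancel, one_pow, Circle.coe_one, one_smul]

/-- The unitary representation of the central extension on the sector `n`. -/
def sectorHom (hN : 1 ≤ N) (hV : ∀ n : Sector N, IsGalileanPotential (masses n) (V (masses n)))
    (n : Sector N) : CentralExtension γ →* unitary (L2 N →L[ℂ] L2 N) :=
  unitaryHom (sectorOp V n) (sectorOp_one hV n) (sectorOp_sectorOp hN hV n)

/-- The unitary representation of the central extension. -/
def extendedHom (hN : 1 ≤ N) (hV : ∀ n : Sector N, IsGalileanPotential (masses n) (V (masses n))) :
    CentralExtension γ →* unitary (HSpace N →L[ℂ] HSpace N) :=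
  unitaryHom (fun p => lpIsometry fun n => sectorOp V n p)
    (fun Ψ => lp.ext (funext fun n => sectorOp_one hV n (Ψ n)))
    (fun p' p Ψ => lp.ext (funext fun n => sectorOp_sectorOp hN hV n p' p (Ψ n)))

theorem extendedHom_apply (hN : 1 ≤ N)
    (hV : ∀ n : Sector N, IsGalileanPotential (masses n) (V (masses n)))
    (p : CentralExtension γ) (Ψ : HSpace N) (n : Sector N) :
    ((extendedHom hN hV p : HSpace N →L[ℂ] HSpace N) Ψ) n = sectorOp V n p (Ψ n) := rfl

theorem sectorHom_apply (hN : 1 ≤ N)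
    (hV : ∀ n : Sector N, IsGalileanPotential (masses n) (V (masses n)))
    (n : Sector N) (p : CentralExtension γ) (ψ : L2 N) :
    (sectorHom hN hV n p : L2 N →L[ℂ] L2 N) ψ = sectorOp V n p ψ := rfl

theorem coeFn_sectorOp (n : Sector N) (p : CentralExtension γ) (Ψ : HSpace N) :
    sectorOp V n p (Ψ n) =ᵐ[volume] extendedOp V p Ψ n := by
  filter_upwards [Lp.coeFn_smul ((p.χ ^ totalMass n : Circle) : ℂ)
    (galOp (masses n) (V (masses n)) γ p.g (Ψ n)), coeFn_boost (m := masses n) p.g.v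
    ((∑ j, masses n j) * γ p.g) (evolution (masses n) (V (masses n)) (-p.g.c)
      (affinePull N p.g.R⁻¹ (p.g.c • p.g.v - p.g.a) (Ψ n)))] with x h1 h2
  rw [sectorOp_apply, h1, Pi.smul_apply, galOp_apply, h2, smul_eq_mul, ← mul_assoc, extendedOp,
    Circle.coe_pow]
  congr 5
  rw [boostPhase, Finset.sum_mul, ← Finset.sum_add_distrib]
  refine Finset.sum_congr rfl fun j _ => ?_
  ring

theorem sectorOp_one_left (n : Sector N) (g : Galilei) (ψ : L2 N) :
    sectorOp V n (⟨1, g⟩ : CentralExtension γ) ψ = galOp (masses n) (V (masses n)) γ g ψ := by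
  rw [sectorOp_apply, one_pow, Circle.coe_one, one_smul]

theorem isGalileanOp_sectorHom (hN : 1 ≤ N)
    (hV : ∀ n : Sector N, IsGalileanPotential (masses n) (V (masses n)))
    (n : Sector N) (g : Galilei) : IsGalileanOp (masses n) (V (masses n)) γ g
      (sectorHom (γ := γ) hN hV n ⟨1, g⟩ : L2 N →L[ℂ] L2 N) := by
  intro f h ψ hψ
  rw [sectorHom_apply, sectorOp_one_left]
  exact isGalileanOp_galOp hN (masses_pos n) (hV n) g f h ψ hψ

theorem sectorHom_mul_sectorHom (hN : 1 ≤ N)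
    (hV : ∀ n : Sector N, IsGalileanPotential (masses n) (V (masses n)))
    (n : Sector N) (g' g : Galilei) :
    (sectorHom (γ := γ) hN hV n ⟨1, g'⟩ * sectorHom (γ := γ) hN hV n ⟨1, g⟩ : L2 N →L[ℂ] L2 N)
      = Complex.exp (I * totalMass n * xi γ g' g) •
        (sectorHom (γ := γ) hN hV n ⟨1, g' * g⟩ : L2 N →L[ℂ] L2 N) := by
  ext1 ψ
  change sectorOp V n ⟨1, g'⟩ (sectorOp V n ⟨1, g⟩ ψ)
    = Complex.exp (I * totalMass n * xi γ g' g) • sectorOp V n ⟨1, g' * g⟩ ψ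
  rw [sectorOp_one_left, sectorOp_one_left, sectorOp_one_left,
    galOp_galOp hN (masses_pos n) (hV n), sum_masses]
  push_cast
  rw [mul_assoc]

end Representation

/-! ## The `ζ`-picture and the classical maps -/

section ZetaPicture

open Complex (I)

variable {N : ℕ} {γ : Galilei → ℝ} {V : (Fin N → ℝ) → Config N → ℝ}

theorem zetaPicture_of_mem {n : Sector N} {Ψ : HSpace N} (hΨ : Ψ ∈ sectorSubspace n) :
    zetaPicture N Ψ = sectorEmbedding n (Ψ n) := by
  classical
  have h : Ψ = lp.single 2 n (Ψ n) := by
    refine lp.ext (funext fun n' => ?_)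
    rcases eq_or_ne n' n with rfl | hn
    · simp
    · rw [hΨ n' hn, lp.single_apply_ne 2 n _ hn]
  rw [h]
  exact ((orthogonalFamily_sectorEmbedding N).linearIsometry_apply_single _).trans (by simp)

theorem coeFn_zetaPicture {n : Sector N} {Ψ : HSpace N} (hΨ : Ψ ∈ sectorSubspace n) :
    zetaPicture N Ψ =ᵐ[volume] fun z => torusChar n z.1 * Ψ n z.2 := by
  rw [zetaPicture_of_mem hΨ]
  exact (memLp_torus_mul n (Ψ n)).coeFn_toLp

theorem evolve_mem {n : Sector N} {Ψ : HSpace N} (hΨ : Ψ ∈ sectorSubspace n) (t : ℝ) :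
    evolve V t Ψ ∈ sectorSubspace n := fun n' hn => by
  change evolution (masses n') (V (masses n')) t (Ψ n') = 0
  rw [hΨ n' hn, map_zero]

/-- The cocycle identity for (g, g⁻¹, g), where the two terms involving the identity both equal γ_e.
-/
theorem xi_inv_comm (γ : Galilei → ℝ) (g : Galilei) : xi γ g g⁻¹ = xi γ g⁻¹ g := by
  have h := xi_cocycle γ g g⁻¹ g
  have h1 : xi γ g 1 = γ 1 := by
    have := xi_cocycle γ g 1 1
    rw [mul_one, mul_one, xi_one_left] at this
    linarith
  rw [mul_inv_cancel, inv_mul_cancel, xi_one_left, h1] at h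
  linarith

theorem fourier_add_coe (j : ℤ) (y : AddCircle (2 * Real.pi)) (r : ℝ) :
    fourier j (y + (r : AddCircle (2 * Real.pi))) = fourier j y * Complex.exp (I * (j * r : ℝ)) := by
  have h : fourier j (y + (r : AddCircle (2 * Real.pi)))
      = fourier j y * fourier j (r : AddCircle (2 * Real.pi)) := by
    rw [fourier_apply, fourier_apply, fourier_apply, smul_add, AddCircle.toCircle_add,
      Circle.coe_mul]
  rw [h, fourier_coe_apply]
  congr 2
  have := Real.pi_ne_zero
  push_cast
  field_simp

/-- Because n sign(n) = |n|, the sign in the shift makes the phase depend on the masses alone. -/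
theorem torusChar_add (n : Sector N) (ζ : Torus N) (r : Fin N → ℝ) :
    torusChar n (fun k => ζ k + (((n k).1.sign * r k : ℝ) : AddCircle (2 * Real.pi)))
      = torusChar n ζ * Complex.exp (I * (∑ k, masses n k * r k : ℝ)) := by
  have h : ∀ k, ((n k).1 * ((n k).1.sign * r k) : ℝ) = masses n k * r k := by
    intro k
    rw [← mul_assoc, masses, Nat.cast_natAbs, ← Int.cast_mul, Int.mul_sign_self]
    simp
  simp only [torusChar, fourier_add_coe, Finset.prod_mul_distrib, h]
  rw [← Complex.exp_sum, ← Finset.mul_sum, ← Complex.ofReal_sum, mul_assoc]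

/-! ### The classical maps on the torus and the configuration space -/

theorem continuous_phi (γ : Galilei → ℝ) (g : Galilei) (t : ℝ) :
    Continuous fun x => phi γ g (t, x) := by
  unfold phi
  fun_prop

/-- For fixed x the angles undergo a translation of the torus, which preserves its measure. This is
needed to pull almost-everywhere identities back along the classical map. -/
theorem measurePreserving_skew_add {s : Config N → Torus N} (hs : Continuous s)
    {A : Config N → Config N} (hA : MeasurePreserving A) :
    MeasurePreserving fun z : Torus N × Config N => (z.1 + s z.2, A z.2) := by
  have h0 : Continuous fun q : Config N × Torus N => q.2 + s q.1 :=
    continuous_snd.add (hs.comp continuous_fst)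
  have h1 := hA.skew_product (g := fun (x : Config N) (ζ : Torus N) => ζ + s x)
    (μc := volume) (μd := volume) h0.measurable
    (Filter.Eventually.of_forall fun x => (measurePreserving_add_right volume (s x)).map_eq)
  exact (Measure.measurePreserving_swap.comp h1).comp Measure.measurePreserving_swap

/-- The shift of the angles in `classicalMap`. -/
def angleShift (n : Sector N) (p : CentralExtension γ) (t : ℝ) (x : Config N) : Torus N :=
  fun k => (((n k).1.sign * (phi γ p.g⁻¹ (t, x k) - Complex.arg p.χ - xi γ p.g⁻¹ p.g) : ℝ) :
    AddCircle (2 * Real.pi))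

theorem continuous_angleShift (n : Sector N) (p : CentralExtension γ) (t : ℝ) :
    Continuous (angleShift n p t) := by
  refine continuous_pi fun k => (AddCircle.continuous_mk' _).comp ?_
  have := (continuous_phi γ p.g⁻¹ t).comp (continuous_apply (A := fun _ : Fin N => E3) k)
  exact continuous_const.mul ((this.sub continuous_const).sub continuous_const)

theorem measurePreserving_classicalMap (n : Sector N) (p : CentralExtension γ) (t : ℝ) :
    MeasurePreserving (fun z : Torus N × Config N => (classicalMap n p (t, z)).2) := by
  have h0 : (fun (x : Config N) k => p.g.a + t • p.g.v + p.g.R.1 (x k))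
      = fun x k => p.g.R.1 (x k + p.g.R⁻¹.1 (p.g.a + t • p.g.v)) := by
    funext x k
    rw [map_add p.g.R.1 (x k), Galilei.so3_self_apply_inv, add_comm]
  have hA : MeasurePreserving (fun (x : Config N) k => p.g.a + t • p.g.v + p.g.R.1 (x k)) := by
    rw [h0]
    exact measurePreserving_affine_config N p.g.R (p.g.R⁻¹.1 (p.g.a + t • p.g.v))
  exact measurePreserving_skew_add (continuous_angleShift n p t) hA

theorem evolve_extendedHom (hN : 1 ≤ N)
    (hV : ∀ n : Sector N, IsGalileanPotential (masses n) (V (masses n)))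
    (p : CentralExtension γ) (n : Sector N) (Ψ : HSpace N) (t : ℝ) :
    (evolve V t ((extendedHom hN hV p : HSpace N →L[ℂ] HSpace N) Ψ)) n
      = ((p.χ ^ totalMass n : Circle) : ℂ) • boost (masses n) p.g.v
        ((∑ j, masses n j) * (γ p.g - ‖p.g.v‖ ^ 2 * t / 2)) (affinePull N p.g.R⁻¹
          ((p.g.c - t) • p.g.v - p.g.a)
          (evolution (masses n) (V (masses n)) (t - p.g.c) (Ψ n))) := by
  change evolution (masses n) (V (masses n)) t (((p.χ ^ totalMass n : Circle) : ℂ) •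
    galOp (masses n) (V (masses n)) γ p.g (Ψ n)) = _
  rw [LinearIsometryEquiv.map_smul, evolution_galOp hN (masses_pos n) (hV n)]

theorem coeFn_circle_boost_affinePull (m : Fin N → ℝ) (c : Circle) (v : E3) (s : ℝ) (R : SO3)
    (b : E3) (F : L2 N) :
    ((c : ℂ) • boost m v s (affinePull N R b F) : L2 N) =ᵐ[volume] fun x =>
      c * (Complex.exp (I * boostPhase m v s x) * F fun k => R.1 (x k + b)) := by
  filter_upwards [Lp.coeFn_smul (c : ℂ) (boost m v s (affinePull N R b F)),
    coeFn_phaseIsometry_of_ae_eq (continuous_boostPhase m v s) (coeFn_affinePull R b F)]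
    with x h1 h2
  rw [h1, Pi.smul_apply, smul_eq_mul]
  exact congrArg _ h2

theorem coeFn_evolve_extendedHom (hN : 1 ≤ N)
    (hV : ∀ n : Sector N, IsGalileanPotential (masses n) (V (masses n)))
    (p : CentralExtension γ) (n : Sector N) (Ψ : HSpace N) (t : ℝ) :
    (evolve V t ((extendedHom hN hV p : HSpace N →L[ℂ] HSpace N) Ψ)) n =ᵐ[volume] fun x =>
      ((p.χ ^ totalMass n : Circle) : ℂ) *
        (Complex.exp (I * boostPhase (masses n) p.g.v
          ((∑ j, masses n j) * (γ p.g - ‖p.g.v‖ ^ 2 * t / 2)) x)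
          * evolution (masses n) (V (masses n)) (t - p.g.c) (Ψ n)
            fun k => p.g.R⁻¹.1 (x k + ((p.g.c - t) • p.g.v - p.g.a))) :=
  (Filter.EventuallyEq.of_eq (congrArg (fun G : L2 N => (G : Config N → ℂ))
    (evolve_extendedHom hN hV p n Ψ t))).trans (coeFn_circle_boost_affinePull _ _ _ _ _ _ _)

theorem zetaWave_left (hN : 1 ≤ N)
    (hV : ∀ n : Sector N, IsGalileanPotential (masses n) (V (masses n)))
    (p : CentralExtension γ) {n : Sector N} {Ψ : HSpace N}
    (hΨ' : (extendedHom hN hV p : HSpace N →L[ℂ] HSpace N) Ψ ∈ sectorSubspace n) (t : ℝ) :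
    (fun z => zetaWave V ((extendedHom hN hV p : HSpace N →L[ℂ] HSpace N) Ψ) (t, z)) =ᵐ[volume]
      fun z => torusChar n z.1 * (((p.χ ^ totalMass n : Circle) : ℂ) *
        (Complex.exp (I * boostPhase (masses n) p.g.v
          ((∑ j, masses n j) * (γ p.g - ‖p.g.v‖ ^ 2 * t / 2)) z.2)
          * evolution (masses n) (V (masses n)) (t - p.g.c) (Ψ n)
            fun k => p.g.R⁻¹.1 (z.2 k + ((p.g.c - t) • p.g.v - p.g.a)))) := by
  have e1 := coeFn_zetaPicture (evolve_mem (V := V) hΨ' t)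
  have e2 := Measure.quasiMeasurePreserving_snd (μ := (volume : Measure (Torus N)))
    (ν := (volume : Measure (Config N))) |>.ae (coeFn_evolve_extendedHom hN hV p n Ψ t)
  filter_upwards [e1, e2] with z h1 h2
  exact h1.trans (congrArg (torusChar n z.1 * ·) h2)

theorem zetaWave_right (q : CentralExtension γ) {n : Sector N} {Ψ : HSpace N}
    (hΨ : Ψ ∈ sectorSubspace n) (t : ℝ) :
    (fun z => zetaWave V Ψ (classicalMap n q (t, z))) =ᵐ[volume] fun z =>
      torusChar n (classicalMap n q (t, z)).2.1 *
        evolution (masses n) (V (masses n)) (t + q.g.c) (Ψ n) (classicalMap n q (t, z)).2.2 :=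
  (measurePreserving_classicalMap n q t).quasiMeasurePreserving.ae
    (coeFn_zetaPicture (evolve_mem (V := V) hΨ (t + q.g.c)))

theorem torusChar_classicalMap_inv (p : CentralExtension γ) (n : Sector N) (t : ℝ)
    (z : Torus N × Config N) :
    torusChar n (classicalMap (γ := γ) n ⟨(p.χ * omega γ p.g⁻¹ p.g)⁻¹, p.g⁻¹⟩ (t, z)).2.1
      = torusChar n z.1 * (((p.χ ^ totalMass n : Circle) : ℂ) *
        Complex.exp (I * boostPhase (masses n) p.g.v
          ((∑ j, masses n j) * (γ p.g - ‖p.g.v‖ ^ 2 * t / 2)) z.2)) := by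
  have hζ : torusChar n (classicalMap (γ := γ) n ⟨(p.χ * omega γ p.g⁻¹ p.g)⁻¹, p.g⁻¹⟩ (t, z)).2.1
      = torusChar n z.1 * Complex.exp (I * (∑ k, masses n k * (phi γ p.g (t, z.2 k)
        - Complex.arg ((p.χ * omega γ p.g⁻¹ p.g)⁻¹ : Circle) - xi γ p.g p.g⁻¹) : ℝ)) := by
    have h0 := torusChar_add n z.1 fun k => phi γ p.g⁻¹⁻¹ (t, z.2 k)
      - Complex.arg ((p.χ * omega γ p.g⁻¹ p.g)⁻¹ : Circle) - xi γ p.g⁻¹⁻¹ p.g⁻¹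
    refine h0.trans ?_
    rw [inv_inv]
  -- The classical map uses the branch `Complex.arg` for r. Only its exponential matters, and with
  -- ξ(g, g⁻¹) = ξ(g⁻¹, g) the factor ω cancels and χ is left.
  have h1 : Circle.exp (-(Complex.arg ((p.χ * omega γ p.g⁻¹ p.g)⁻¹ : Circle) + xi γ p.g p.g⁻¹))
      = p.χ := by
    rw [Circle.exp_neg, Circle.exp_add, Circle.exp_arg, xi_inv_comm, omega, mul_inv_rev, inv_inv,
      mul_comm p.χ, inv_mul_cancel_left]
  have hχ := exp_I_mul_totalMass n
    (-(Complex.arg ((p.χ * omega γ p.g⁻¹ p.g)⁻¹ : Circle) + xi γ p.g p.g⁻¹))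
  rw [h1] at hχ
  rw [hζ, ← hχ, ← Complex.exp_add, ← mul_add, ← Complex.ofReal_add]
  congr 4
  simp only [boostPhase, phi, mul_sub, mul_add, Finset.sum_add_distrib, Finset.sum_sub_distrib,
    ← Finset.sum_mul]
  ring

theorem extendedHom_mem (hN : 1 ≤ N)
    (hV : ∀ n : Sector N, IsGalileanPotential (masses n) (V (masses n)))
    (p : CentralExtension γ) {n : Sector N} {Ψ : HSpace N} (hΨ : Ψ ∈ sectorSubspace n) :
    (extendedHom hN hV p : HSpace N →L[ℂ] HSpace N) Ψ ∈ sectorSubspace n := fun n' hn => by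
  rw [extendedHom_apply, hΨ n' hn, map_zero]

/-- Both sides are a character times the solution at time t - c, taken at the same positions g⁻¹(t,
x_k); the phases agree by `torusChar_classicalMap_inv`. -/
theorem zetaWave_extendedHom (hN : 1 ≤ N)
    (hV : ∀ n : Sector N, IsGalileanPotential (masses n) (V (masses n)))
    (p : CentralExtension γ) {n : Sector N} {Ψ : HSpace N} (hΨ : Ψ ∈ sectorSubspace n) (t : ℝ) :
    (fun z => zetaWave V ((extendedHom hN hV p : HSpace N →L[ℂ] HSpace N) Ψ) (t, z)) =ᵐ[volume]
      fun z => zetaWave V Ψ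
        (classicalMap (γ := γ) n ⟨(p.χ * omega γ p.g⁻¹ p.g)⁻¹, p.g⁻¹⟩ (t, z)) := by
  filter_upwards [zetaWave_left hN hV p (extendedHom_mem hN hV p hΨ) t,
    zetaWave_right (V := V) ⟨(p.χ * omega γ p.g⁻¹ p.g)⁻¹, p.g⁻¹⟩ hΨ t] with z h1 h2
  rw [h1, h2, torusChar_classicalMap_inv, mul_assoc, mul_assoc]
  have hx : (classicalMap (γ := γ) n ⟨(p.χ * omega γ p.g⁻¹ p.g)⁻¹, p.g⁻¹⟩ (t, z)).2.2
      = fun k => p.g.R⁻¹.1 (z.2 k + ((p.g.c - t) • p.g.v - p.g.a)) := by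
    funext k
    change p.g.R⁻¹.1 (p.g.c • p.g.v - p.g.a) + t • -(p.g.R⁻¹.1 p.g.v) + p.g.R⁻¹.1 (z.2 k) = _
    simp only [map_add, map_sub, map_smul]
    module
  have hc : t + (p.g⁻¹).c = t - p.g.c := by
    rw [Galilei.inv_c, sub_eq_add_neg]
  rw [hx, hc]

theorem sign_mul_coe_eq_zero {r : ℝ} (hr : Circle.exp r = 1) (j : ℤ) :
    ((j.sign * r : ℝ) : AddCircle (2 * Real.pi)) = 0 := by
  obtain ⟨l, rfl⟩ := Circle.exp_eq_one.1 hr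
  rw [AddCircle.coe_eq_zero_iff]
  refine ⟨j.sign * l, ?_⟩
  rw [zsmul_eq_mul]
  push_cast
  ring

theorem inv_eq_of_exp_eq_one (hγ : Circle.exp (γ 1) = 1) (p : CentralExtension γ) :
    p⁻¹ = ⟨(p.χ * omega γ p.g⁻¹ p.g)⁻¹, p.g⁻¹⟩ := by
  change (⟨(p.χ * omega γ p.g⁻¹ p.g * Circle.exp (γ 1))⁻¹, p.g⁻¹⟩ : CentralExtension γ) = _
  rw [hγ, mul_one]

theorem classicalMap_inv_classicalMap (hγ : Circle.exp (γ 1) = 1) (p : CentralExtension γ)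
    (n : Sector N) (q : ℝ × Torus N × Config N) :
    classicalMap n p⁻¹ (classicalMap n p q) = q := by
  rw [inv_eq_of_exp_eq_one hγ]
  obtain ⟨t, ζ, x⟩ := q
  refine Prod.ext ?_ (Prod.ext (funext fun k => ?_) (funext fun k => ?_))
  · change t + p.g.c + -p.g.c = t
    ring
  · set A := Complex.arg p.χ
    set A' := Complex.arg ((p.χ * omega γ p.g⁻¹ p.g)⁻¹ : Circle) with hA'
    change ζ k + (((n k).1.sign * (phi γ p.g⁻¹ (t, x k) - A - xi γ p.g⁻¹ p.g) : ℝ) :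
        AddCircle (2 * Real.pi)) + (((n k).1.sign * (phi γ p.g⁻¹⁻¹ (p.g.act (t, x k))
        - A' - xi γ p.g⁻¹⁻¹ p.g⁻¹) : ℝ) : AddCircle (2 * Real.pi)) = ζ k
    -- The x-dependent parts of the two shifts add up to γ_e + ξ(g⁻¹, g). What remains is a constant
    -- whose exponential is 1, so the total shift vanishes mod 2π although the branches of the
    -- arguments need not match.
    have h1 := phi_cocycle γ p.g⁻¹ p.g (t, x k)
    have h2 : phi γ 1 (t, x k) = γ 1 := by simp [phi]
    rw [inv_mul_cancel, h2, inv_inv] at h1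
    rw [inv_inv, xi_inv_comm, add_assoc, ← AddCircle.coe_add, ← mul_add, sign_mul_coe_eq_zero,
      add_zero]
    have h3 : phi γ p.g⁻¹ (t, x k) - A - xi γ p.g⁻¹ p.g + (phi γ p.g (p.g.act (t, x k)) - A'
        - xi γ p.g⁻¹ p.g) = γ 1 - (A + A' + xi γ p.g⁻¹ p.g) := by linarith
    rw [h3, Circle.exp_sub, hγ, Circle.exp_add, Circle.exp_add, Circle.exp_arg, hA', Circle.exp_arg,
      omega]
    simp [mul_comm]
  · change p.g.R⁻¹.1 (p.g.c • p.g.v - p.g.a) + (t + p.g.c) • -(p.g.R⁻¹.1 p.g.v)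
      + p.g.R⁻¹.1 (p.g.a + t • p.g.v + p.g.R.1 (x k)) = x k
    simp only [map_add, map_sub, map_smul, Galilei.so3_inv_apply_self]
    module

end ZetaPicture

end GalileiMass

end

theorem mainTheorem6 (N : ℕ) (hN : 1 ≤ N) (γ : Galilei → ℝ) (V : (Fin N → ℝ) → Config N → ℝ)
    (hV : ∀ n : Sector N, IsGalileanPotential (masses n) (V (masses n))) :
    ∃ U : CentralExtension γ →* unitary (HSpace N →L[ℂ] HSpace N),
      -- the operators are the explicitly given ones
      (∀ (p : CentralExtension γ) (Ψ : HSpace N) (n : Sector N),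
        ((U p : HSpace N →L[ℂ] HSpace N) Ψ) n =ᵐ[volume] extendedOp V p Ψ n) ∧
      -- for `χ = 1` they reduce to the Galileian projective representation in each sector
      (∀ n : Sector N, ∃ W : Galilei → unitary (L2 N →L[ℂ] L2 N),
        (∀ g : Galilei,
          IsGalileanOp (masses n) (V (masses n)) γ g (W g : L2 N →L[ℂ] L2 N)) ∧
        (∀ g' g : Galilei, (W g' * W g : L2 N →L[ℂ] L2 N)
          = Complex.exp (Complex.I * totalMass n * xi γ g' g) • (W (g' * g) : L2 N →L[ℂ] L2 N)) ∧
        (∀ (g : Galilei) (Ψ : HSpace N),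
          ((U ⟨1, g⟩ : HSpace N →L[ℂ] HSpace N) Ψ) n = (W g : L2 N →L[ℂ] L2 N) (Ψ n))) ∧
      -- each sector is preserved, and the wavefunction is transported by the classical map
      (∀ (p : CentralExtension γ) (n : Sector N), ∀ Ψ ∈ sectorSubspace n, ∀ t : ℝ,
        evolve V t ((U p : HSpace N →L[ℂ] HSpace N) Ψ) ∈ sectorSubspace n ∧
        (fun z => zetaWave V ((U p : HSpace N →L[ℂ] HSpace N) Ψ) (t, z)) =ᵐ[volume]
          fun z => zetaWave V Ψ
            (classicalMap (γ := γ) n ⟨(p.χ * omega γ p.g⁻¹ p.g)⁻¹, p.g⁻¹⟩ (t, z))) ∧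
      -- when `U_{(1,e)} = I`, the map used there is `Ǧ` at the inverse group element, which is
      -- the inverse of the map `Ǧ`
      (Circle.exp (γ 1) = 1 → ∀ p : CentralExtension γ,
        p⁻¹ = ⟨(p.χ * omega γ p.g⁻¹ p.g)⁻¹, p.g⁻¹⟩ ∧
        ∀ n : Sector N,
          Function.LeftInverse (classicalMap n p⁻¹) (classicalMap n p) ∧
          Function.RightInverse (classicalMap n p⁻¹) (classicalMap n p)) := by
  refine ⟨extendedHom hN hV, fun p Ψ n => coeFn_sectorOp n p Ψ, fun n =>
    ⟨fun g => sectorHom (γ := γ) hN hV n ⟨1, g⟩, fun g => isGalileanOp_sectorHom hN hV n g,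
      fun g' g => sectorHom_mul_sectorHom hN hV n g' g, fun g Ψ => rfl⟩,
    fun p n Ψ hΨ t => ⟨evolve_mem (extendedHom_mem hN hV p hΨ) t,
      zetaWave_extendedHom hN hV p hΨ t⟩,
    fun hγ p => ⟨inv_eq_of_exp_eq_one hγ p, fun n => ⟨fun q => ?_, fun q => ?_⟩⟩⟩
  · exact classicalMap_inv_classicalMap hγ p n q
  -- The inverse on the other side is the same statement at p⁻¹.
  · have h := classicalMap_inv_classicalMap hγ p⁻¹ n q
    rwa [inv_inv] at h
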